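/- **Setting.** Let $\mathscr D=\bigcup_\alpha\mathscr D^\alpha$ and $(X,\mu)$ be one of the following. (a) $X=\mathbf R^n$ with a Borel measure $\mu$ such that $0<\mu(B)<\infty$ and $\mu(2B)\le C\mu(B)$ for all balls $B$, and for $\alpha\in\{0,\tfrac13,\tfrac23\}^n$ the grid $\mathscr D^\alpha$ consists of the cubes $2^{-k}([0,1)^n+m+(-1)^k\alpha)$, $k\in\mathbf Z$, $m\in\mathbf Z^n$. (b) $X$ is a set with a quasimetric $d$ and a measure $\mu$ for which balls are measurable, have measure in $(0,\infty)$, and satisfy $\mu(B(x;2r))\le C\mu(B(x;r))$; and $\mathscr D^1,\dots,\mathscr D^K$ are dyadic systems in $X$ with common parameters $0<c_0\le C_0<\infty$, $0<\delta<1$, such that for some $\rho>0$ every ball $B(x;r)$ is contained in some $Q\in\mathscr D$ with $\operatorname{diam}Q\le\rho r$. Here a dyadic system consists of collections $\mathscr D_k$, $k\in\mathbf Z$, of measurable sets (cubes), each $\mathscr D_k$ being a partition of $X$; for $l\ge k$, any $Q\in\mathscr D_l$ and $R\in\mathscr D_k$ satisfy $Q\cap R=\emptyset$ or $Q\subseteq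 R$; and each $Q\in\mathscr D_k$ has a centre $z$ with $B(z;c_0\delta^k)\subseteq Q\subseteq B(z;C_0\delta^k)$, where the balls $B(z;C_0\delta^k)$ are nested when the cubes are. Write $|E|=\mu(E)$, $\langle f\rangle_{p,E}=\|f\chi_E\|_{L^p(|E|^{-1}d\mu)}$, $\langle f,g\rangle=\int fg\,d\mu$, and $p'$ for the conjugate exponent of $p$. A *weight* is a measurable $w:X\to(0,\infty)$, and $L^p(w)=L^p(w\,d\mu)$. Put $[w]_{A_q}=\sup_{Q\in\mathscr D}\langle w\rangle_{1,Q}\langle w^{-1}\rangle_{q'-1,Q}$ for $1\le q<\infty$ and $[w]_{RH_s}=\sup_{Q\in\mathscr D}\langle w\rangle_{s,Q}\langle w\rangle_{1,Q}^{-1}$ for $1<s<\infty$; $A_q$ and $RH_s$ are the classes of weights for which these are finite, $A_\infty=\bigcup_{1\le q<\infty}A_q$, and $RH_1=A_\infty$. A collection $\mathscr S\subseteq\mathscr D$ is *$\eta$-sparse* if for each $\alpha$ there are pairwise disjoint measurable sets $E_Q\subseteq Q$, $Q\in\mathscr S\cap\mathscr D^\alpha$, with $|Q|\le\eta^{-1}|E_Q|$.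 Let $\mathcal D$ be a linear space of (real or complex) functions on $X$ that is contained and dense in $L^p(w)$ for all $1\le p<\infty$ and all $w\in A_\infty$. For $1\le p_0<q_0\le\infty$, $T\in S(p_0,q_0)$ means that $T$ is a linear or sublinear operator mapping $\mathcal D$ to measurable functions, that $(Tf)g$ is integrable for all $f,g\in\mathcal D$, and that there are $c>0$ and $0<\eta\le1$ such that for all $f,g\in\mathcal D$ there is an $\eta$-sparse $\mathscr S\subseteq\mathscr D$ with $$|\langle Tf,g\rangle|\le c\sum_{Q\in\mathscr S}\langle f\rangle_{p_0,Q}\langle g\rangle_{q_0',Q}|Q|.$$ Let $\|T\|_{L^p(w)\to L^p(w)}\in[0,\infty]$ be the least $C$ with $\|Tf\|_{L^p(w)}\le C\|f\|_{L^p(w)}$ for all $f\in\mathcal D$. Define, as suprema in $[0,\infty]$ with $\sup\emptyset=0$, $$\alpha_T(p_0)=\sup\{\alpha\ge0:\forall\varepsilon>0,\ \limsup_{p\downarrow p_0}(p-p_0)^{\alpha-\varepsilon}\|T\|_{L^p\to L^p}=\infty\},$$ $$\gamma_T(q_0)=\sup\{\gamma\ge0:\forall\varepsilon>0,\ \limsup_{p\uparrow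 q_0}(q_0-p)^{\gamma-\varepsilon}\|T\|_{L^p\to L^p}=\infty\}\quad(q_0<\infty),$$ $$\gamma_T(\infty)=\sup\{\gamma\ge0:\forall\varepsilon>0,\ \limsup_{p\to\infty}p^{-(\gamma-\varepsilon)}\|T\|_{L^p\to L^p}=\infty\}.$$ **Theorem 1.4.** Let $1\le p_0<p<q_0\le\infty$, let $T\in S(p_0,q_0)$, and let $\phi(p)=(q_0/p)'(p/p_0-1)+1$. For $q_0=\infty$ read $(q_0/p)'=1$ and $\frac{q_0-1}{q_0-p}=1$. 1. If $\alpha_T(p_0)=1/p_0$ and $\gamma_T(q_0)=1/q_0'$, then the least $\beta\in\mathbf R$ for which there is a finite constant $c$ with $$\|T\|_{L^p(w)\to L^p(w)}\le c\,[w^{(q_0/p)'}]_{A_{\phi(p)}}^{\beta/(q_0/p)'}\qquad\text{for all }w\in A_{p/p_0}\cap RH_{(q_0/p)'}$$ exists and equals $\max\left(\frac1{p-p_0},\frac{q_0-1}{q_0-p}\right)$. 2. If $\gamma_T(q_0)=1/q_0'$, then the least $\beta\in\mathbf R$ for which there is a finite constant $c$ with $$\|T\|_{L^p(w)\to L^p(w)}\le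 c\,[w^{(q_0/p)'}]_{A_1}^{\beta}\qquad\text{for all }w\in A_1\cap RH_{(q_0/p)'}$$ exists and equals $1/q_0'$. -/

import Mathlib

open MeasureTheory Filter Topology
open scoped ENNReal NNReal

noncomputable section

namespace SparseDom

/-! ### Spaces of homogeneous type, doubling measures, dyadic grids -/

section Spaces

variable {X : Type*}

/-- The ball of centre `x` and radius `r` for a (quasi)metric `d`. -/
def qball (d : X → X → ℝ) (x : X) (r : ℝ) : Set X := {y | d x y < r}

/-- `d` is a quasimetric: a metric, except that the triangle inequality holds up to a
constant `A ≥ 1`. -/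
structure IsQuasimetric (d : X → X → ℝ) : Prop where
  nonneg : ∀ x y, 0 ≤ d x y
  eq_zero_iff : ∀ x y, d x y = 0 ↔ x = y
  symm : ∀ x y, d x y = d y x
  triangle : ∃ A : ℝ, 1 ≤ A ∧ ∀ x y z, d x y ≤ A * (d x z + d z y)

/-- All balls have measure in `(0, ∞)`, and `μ` is doubling. -/
structure IsDoubling [MeasurableSpace X] (d : X → X → ℝ) (μ : Measure X) : Prop where
  measurable_ball : ∀ x r, MeasurableSet (qball d x r)
  pos : ∀ x r, 0 < r → 0 < μ (qball d x r)
  finite : ∀ x r, μ (qball d x r) < ∞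
  doubling : ∃ C : ℝ≥0, ∀ x r, 0 < r → μ (qball d x (2 * r)) ≤ C * μ (qball d x r)

/-- `𝒬 k`, `k ∈ ℤ`, are the generations of a dyadic system in `X` with parameters `c₀, C₀, δ`;
`z k Q` is the centre of `Q` as a cube of generation `k`. -/
structure IsDyadicSystem [MeasurableSpace X] (d : X → X → ℝ) (c₀ C₀ δ : ℝ)
    (𝒬 : ℤ → Set (Set X)) : Prop where
  measurable : ∀ k, ∀ Q ∈ 𝒬 k, MeasurableSet Q
  disjoint : ∀ k, (𝒬 k).PairwiseDisjoint id
  cover : ∀ k, ⋃₀ 𝒬 k = Set.univ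
  nested : ∀ k l, k ≤ l → ∀ Q ∈ 𝒬 l, ∀ R ∈ 𝒬 k, Disjoint Q R ∨ Q ⊆ R
  centres : ∃ z : ℤ → Set X → X,
    (∀ k, ∀ Q ∈ 𝒬 k, qball d (z k Q) (c₀ * δ ^ k) ⊆ Q ∧ Q ⊆ qball d (z k Q) (C₀ * δ ^ k)) ∧
    (∀ k l, k ≤ l → ∀ Q ∈ 𝒬 l, ∀ R ∈ 𝒬 k, Q ⊆ R →
      qball d (z l Q) (C₀ * δ ^ l) ⊆ qball d (z k R) (C₀ * δ ^ k))

/-- A finite family of dyadic systems with common parameters, such that every ball is contained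
in a cube, of one of the systems, of comparable diameter. -/
structure IsDyadicFamily [MeasurableSpace X] {K : ℕ} (d : X → X → ℝ)
    (𝒬 : Fin K → ℤ → Set (Set X)) : Prop where
  systems : ∃ c₀ C₀ δ : ℝ, 0 < c₀ ∧ c₀ ≤ C₀ ∧ 0 < δ ∧ δ < 1 ∧
    ∀ a, IsDyadicSystem d c₀ C₀ δ (𝒬 a)
  covering : ∃ ρ : ℝ, 0 < ρ ∧ ∀ x r, 0 < r → ∃ a k, ∃ Q ∈ 𝒬 a k,
    qball d x r ⊆ Q ∧ ∀ y ∈ Q, ∀ y₁ ∈ Q, d y y₁ ≤ ρ * r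

/-- The grids `𝒟^a` formed by the cubes of all generations. -/
def gridOf {ι : Type*} (𝒬 : ι → ℤ → Set (Set X)) (a : ι) : Set (Set X) := ⋃ k, 𝒬 a k

/-- The cube `2^(-k) ([0,1)^n + m + (-1)^k α)` in `ℝⁿ`, where `α = (a i / 3)_i`. -/
def euclideanCube {n : ℕ} (a : Fin n → Fin 3) (k : ℤ) (m : Fin n → ℤ) :
    Set (EuclideanSpace ℝ (Fin n)) :=
  {x | ∀ i, (2 : ℝ) ^ (-k) * (m i + (-1) ^ k * ((a i : ℕ) / 3 : ℝ)) ≤ x i ∧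
    x i < (2 : ℝ) ^ (-k) * (1 + m i + (-1) ^ k * ((a i : ℕ) / 3 : ℝ))}

/-- The translated dyadic grids `𝒟^α`, `α ∈ {0, 1/3, 2/3}^n`, in `ℝⁿ`. -/
def euclideanGrid (n : ℕ) (a : Fin n → Fin 3) : Set (Set (EuclideanSpace ℝ (Fin n))) :=
  {Q | ∃ k m, Q = euclideanCube a k m}

end Spaces

/-! ### Averages, weights -/

section Weights

variable {X : Type*} [MeasurableSpace X] {ι : Type*}

/-- `⟨f⟩_{p,E}`, the `L^p` norm of `f` on `E` for the measure `|E|⁻¹ dμ`. -/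
def avg {F : Type*} [NormedAddCommGroup F] (μ : Measure X) (p : ℝ≥0∞) (f : X → F) (E : Set X) :
    ℝ≥0∞ :=
  eLpNorm f p ((μ E)⁻¹ • μ.restrict E)

/-- A weight: a measurable function with values in `(0, ∞)`. -/
def IsWeight (w : X → ℝ) : Prop := Measurable w ∧ ∀ x, 0 < w x

/-- The measure `w dμ`. -/
def wMeasure (μ : Measure X) (w : X → ℝ) : Measure X :=
  μ.withDensity fun x => ENNReal.ofReal (w x)

/-- `[w]_{A_q} = sup_Q ⟨w⟩_{1,Q} ⟨w⁻¹⟩_{q'-1,Q}` for `1 ≤ q < ∞`. Here `q' - 1 = 1 / (q - 1)`,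
which is `∞` for `q = 1`. -/
def apConst (μ : Measure X) (𝒟 : ι → Set (Set X)) (q : ℝ) (w : X → ℝ) : ℝ≥0∞ :=
  ⨆ a, ⨆ Q ∈ 𝒟 a, avg μ 1 w Q * avg μ (ENNReal.ofReal (q - 1))⁻¹ (fun x => (w x)⁻¹) Q

/-- `w ∈ A_q`. -/
def InA (μ : Measure X) (𝒟 : ι → Set (Set X)) (q : ℝ) (w : X → ℝ) : Prop :=
  IsWeight w ∧ apConst μ 𝒟 q w < ∞

/-- `w ∈ A_∞`, that is, `w ∈ A_q` for some `1 ≤ q < ∞`. -/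
def InAInfty (μ : Measure X) (𝒟 : ι → Set (Set X)) (w : X → ℝ) : Prop :=
  ∃ q : ℝ, 1 ≤ q ∧ InA μ 𝒟 q w

/-- `[w]_{RH_s} = sup_Q ⟨w⟩_{s,Q} / ⟨w⟩_{1,Q}` for `1 < s < ∞`. -/
def rhConst (μ : Measure X) (𝒟 : ι → Set (Set X)) (s : ℝ) (w : X → ℝ) : ℝ≥0∞ :=
  ⨆ a, ⨆ Q ∈ 𝒟 a, avg μ (ENNReal.ofReal s) w Q / avg μ 1 w Q

/-- `w ∈ RH_s` for `1 ≤ s < ∞`, with the convention `RH_1 = A_∞`. -/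
def InRH (μ : Measure X) (𝒟 : ι → Set (Set X)) (s : ℝ) (w : X → ℝ) : Prop :=
  (s = 1 ∧ InAInfty μ 𝒟 w) ∨ (s ≠ 1 ∧ IsWeight w ∧ rhConst μ 𝒟 s w < ∞)

end Weights

/-! ### Exponents -/

/-- `(q₀/p)'`, for `0 < p < q₀ ≤ ∞`; it equals `1` if `q₀ = ∞`. -/
def dualRatio (q₀ : ℝ≥0∞) (p : ℝ) : ℝ := (ENNReal.conjExponent (q₀ / ENNReal.ofReal p)).toReal

/-- `φ(p) = (q₀/p)' (p/p₀ - 1) + 1`. -/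
def phi (p₀ : ℝ) (q₀ : ℝ≥0∞) (p : ℝ) : ℝ := dualRatio q₀ p * (p / p₀ - 1) + 1

/-- `(q₀ - 1) / (q₀ - p)`, read as `1` if `q₀ = ∞`. -/
def upperExp (q₀ : ℝ≥0∞) (p : ℝ) : ℝ :=
  if q₀ = ∞ then 1 else (q₀.toReal - 1) / (q₀.toReal - p)

/-- `1 / q₀'`, for `1 < q₀ ≤ ∞`. -/
def invConj (q₀ : ℝ≥0∞) : ℝ := 1 / (ENNReal.conjExponent q₀).toReal

/-! ### Sparsely dominated operators -/

section Operators

variable {X : Type*} [MeasurableSpace X] {ι : Type*} {𝕜 : Type*} [RCLike 𝕜]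

/-- `𝒮` is an `η`-sparse subcollection of the union of the grids. -/
def IsSparse (μ : Measure X) (𝒟 : ι → Set (Set X)) (η : ℝ) (𝒮 : Set (Set X)) : Prop :=
  𝒮 ⊆ ⋃ a, 𝒟 a ∧
  ∀ a, ∃ E : Set X → Set X, (𝒮 ∩ 𝒟 a).PairwiseDisjoint E ∧
    ∀ Q ∈ 𝒮 ∩ 𝒟 a, MeasurableSet (E Q) ∧ E Q ⊆ Q ∧ μ Q ≤ (ENNReal.ofReal η)⁻¹ * μ (E Q)

/-- `D` is a space of test functions: it is contained and dense in `L^p(w)` for all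
`1 ≤ p < ∞` and all `w ∈ A_∞`. -/
def IsTestSpace (μ : Measure X) (𝒟 : ι → Set (Set X)) (D : Submodule 𝕜 (X → 𝕜)) : Prop :=
  ∀ (p : ℝ≥0∞) (w : X → ℝ), 1 ≤ p → p < ∞ → InAInfty μ 𝒟 w →
    (∀ f ∈ D, MemLp f p (wMeasure μ w)) ∧
    ∀ h : X → 𝕜, MemLp h p (wMeasure μ w) → ∀ ε : ℝ≥0∞, 0 < ε →
      ∃ f ∈ D, eLpNorm (h - f) p (wMeasure μ w) < ε

/-- `T ∈ S(p₀, q₀)`: the operator `T`, defined on the test space `D`, is sublinear (which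
includes linear operators) and satisfies the sparse domination property, with constants `c, η`
not depending on the pair `f, g`. The pairing is `⟨T f, g⟩ = ∫ (T f) g dμ`. -/
structure IsSparselyDominated (μ : Measure X) (𝒟 : ι → Set (Set X)) {D : Submodule 𝕜 (X → 𝕜)}
    (T : D → X → 𝕜) (p₀ : ℝ) (q₀ : ℝ≥0∞) : Prop where
  measurable : ∀ f, AEStronglyMeasurable (T f) μ
  add_le : ∀ f g, ∀ᵐ x ∂μ, ‖T (f + g) x‖ ≤ ‖T f x‖ + ‖T g x‖
  smul : ∀ (c : 𝕜) f, ∀ᵐ x ∂μ, ‖T (c • f) x‖ = ‖c‖ * ‖T f x‖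
  integrable : ∀ f g : D, Integrable (fun x => T f x * (g : X → 𝕜) x) μ
  sparse : ∃ (c : ℝ≥0) (η : ℝ), 0 < η ∧ η ≤ 1 ∧ ∀ f g : D, ∃ 𝒮, IsSparse μ 𝒟 η 𝒮 ∧
    ‖∫ x, T f x * (g : X → 𝕜) x ∂μ‖ₑ ≤
      c * ∑' Q : 𝒮, avg μ (ENNReal.ofReal p₀) (f : X → 𝕜) Q *
        avg μ (ENNReal.conjExponent q₀) (g : X → 𝕜) Q * μ Q

/-- `‖T‖_{L^p(m) → L^p(m)}`: the least `C ∈ [0, ∞]` with `‖T f‖ ≤ C ‖f‖` in `L^p(m)` for all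
test functions `f`. If the test functions are dense in `L^p(m)`, then this is the norm of the
extension of `T` to `L^p(m)`. -/
def opNorm {D : Submodule 𝕜 (X → 𝕜)} (m : Measure X) (T : D → X → 𝕜) (p : ℝ) : ℝ≥0∞ :=
  sInf {C | ∀ f : D, eLpNorm (T f) (ENNReal.ofReal p) m ≤
    C * eLpNorm (f : X → 𝕜) (ENNReal.ofReal p) m}

/-- The critical exponent `α_T(p₀)`, a supremum in `[0, ∞]`. -/
def alphaExp {D : Submodule 𝕜 (X → 𝕜)} (μ : Measure X) (T : D → X → 𝕜) (p₀ : ℝ) : ℝ≥0∞ :=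
  sSup {s : ℝ≥0∞ | ∃ α : ℝ, 0 ≤ α ∧ s = ENNReal.ofReal α ∧ ∀ ε : ℝ, 0 < ε →
    limsup (fun p : ℝ => ENNReal.ofReal ((p - p₀) ^ (α - ε)) * opNorm μ T p) (𝓝[>] p₀) = ∞}

/-- The critical exponent `γ_T(q₀)`, a supremum in `[0, ∞]`. -/
def gammaExp {D : Submodule 𝕜 (X → 𝕜)} (μ : Measure X) (T : D → X → 𝕜) (q₀ : ℝ≥0∞) : ℝ≥0∞ :=
  sSup {s : ℝ≥0∞ | ∃ γ : ℝ, 0 ≤ γ ∧ s = ENNReal.ofReal γ ∧ ∀ ε : ℝ, 0 < ε →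
    if q₀ = ∞ then
      limsup (fun p : ℝ => opNorm μ T p / ENNReal.ofReal (p ^ (γ - ε))) atTop = ∞
    else
      limsup (fun p : ℝ => ENNReal.ofReal ((q₀.toReal - p) ^ (γ - ε)) * opNorm μ T p)
        (𝓝[<] q₀.toReal) = ∞}

/-- The set of all exponents `β ∈ ℝ` for which there is a finite constant `c` with
`‖T‖_{L^p(w) → L^p(w)} ≤ c [w^{(q₀/p)'}]_{A_{φ(p)}}^{β / (q₀/p)'}`
for all `w ∈ A_{p/p₀} ∩ RH_{(q₀/p)'}`. -/
def apExponents {D : Submodule 𝕜 (X → 𝕜)} (μ : Measure X) (𝒟 : ι → Set (Set X))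
    (T : D → X → 𝕜) (p₀ : ℝ) (q₀ : ℝ≥0∞) (p : ℝ) : Set ℝ :=
  {β | ∃ c : ℝ≥0, ∀ w : X → ℝ, InA μ 𝒟 (p / p₀) w → InRH μ 𝒟 (dualRatio q₀ p) w →
    opNorm (wMeasure μ w) T p ≤
      c * apConst μ 𝒟 (phi p₀ q₀ p) (fun x => w x ^ dualRatio q₀ p) ^ (β / dualRatio q₀ p)}

/-- The set of all exponents `β ∈ ℝ` for which there is a finite constant `c` with
`‖T‖_{L^p(w) → L^p(w)} ≤ c [w^{(q₀/p)'}]_{A_1}^β` for all `w ∈ A_1 ∩ RH_{(q₀/p)'}`. -/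
def a1Exponents {D : Submodule 𝕜 (X → 𝕜)} (μ : Measure X) (𝒟 : ι → Set (Set X))
    (T : D → X → 𝕜) (q₀ : ℝ≥0∞) (p : ℝ) : Set ℝ :=
  {β | ∃ c : ℝ≥0, ∀ w : X → ℝ, InA μ 𝒟 1 w → InRH μ 𝒟 (dualRatio q₀ p) w →
    opNorm (wMeasure μ w) T p ≤ c * apConst μ 𝒟 1 (fun x => w x ^ dualRatio q₀ p) ^ β}

end Operators

end SparseDom

end

open MeasureTheory Filter Topology
open scoped ENNReal NNReal

noncomputable section

namespace SparseDom

/-! ### Maximal functions of nested families -/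

section Maximal

variable {X : Type*} [MeasurableSpace X]

/-! Write s = (q₀/p)', W = w^s, φ = s(p/p₀ - 1) + 1 and σ = W^(-1/(φ-1)). That the stated exponents
are admissible comes from an estimate of sparse forms; that nothing smaller is admissible comes from
extrapolating to unweighted spaces L^r with r near p₀ or q₀.

Upper bounds. The average of f over a cube Q is rewritten as a σ-average and that of g as a
W-average. What remains is a numerical factor in |Q|, σ(Q) and W(Q), which has to be compared with
σ(E_Q)^(1/p) W(E_Q)^(1/p') for the disjoint sets E_Q of the sparse family. The A_φ condition on Q
and Hölder's inequality on E_Q give this with a power of [W]_{A_φ} (`rpow_mul_rpow_mul_le_Aq`), and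
`exponent_identity` shows that the power is the claimed one. Hölder's inequality for sums and the
maximal theorem of a nested family, whose constant does not depend on the measure
(`lintegral_maxFun_rpow_le`), then bound the form (`exists_sparseForm_le_Aq`). For A_1 weights the
first measure is μ itself and the essential supremum of 1/W on Q takes the role of σ
(`exists_sparseForm_le_A1`).

The sparse domination is only known for pairs of test functions, whereas duality in L^p(w) needs
more general g. Since γ_T(q₀) is finite, T is bounded on some unweighted L^t with p < t < q₀. So
both sides of the sparse bound are continuous in g in the norm of L^t', the bound passes to all g in
L^t', and these suffice to compute weighted norms (`exists_opNorm_le`).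

Lower bounds. The Rubio de Francia algorithm (`exists_majorant`) majorizes a function in L^t by an
A_1 weight of comparable norm and of A_1 constant O(t/(t-1)). For r > p a root of such a majorant of
a power of the dual function is used as weight (`opNorm_le_of_lt`); for r < p it is a negative power
of a majorant of |f|^p₀ (`opNorm_le_of_gt`). A weighted bound with exponent β thus turns into a
power bound for the norm of T on L^r as r tends to q₀ or to p₀. Comparison with γ_T(q₀) and α_T(p₀)
bounds β from below. -/

/-- A countable family of measurable sets, any two of which are disjoint or comparable. -/
structure IsNestedFamily (𝒟 : Set (Set X)) : Prop where
  countable : 𝒟.Countable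
  measurable : ∀ Q ∈ 𝒟, MeasurableSet Q
  nested : ∀ Q ∈ 𝒟, ∀ R ∈ 𝒟, Disjoint Q R ∨ Q ⊆ R ∨ R ⊆ Q

/-- The maximal function `sup_{Q ∋ x} ν(Q)⁻¹ ∫_Q h dν` of a family of sets. -/
def maxFun (ν : Measure X) (𝒟 : Set (Set X)) (h : X → ℝ≥0∞) (x : X) : ℝ≥0∞ :=
  ⨆ Q ∈ 𝒟, Q.indicator (fun _ => (∫⁻ y in Q, h y ∂ν) / ν Q) x

variable {ν : Measure X} {𝒟 : Set (Set X)}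

lemma measurable_maxFun (h𝒟 : 𝒟.Countable) (hm : ∀ Q ∈ 𝒟, MeasurableSet Q) (h : X → ℝ≥0∞) :
    Measurable (maxFun ν 𝒟 h) :=
  Measurable.biSup _ h𝒟 fun Q hQ => measurable_const.indicator (hm Q hQ)

lemma le_maxFun {Q : Set X} (hQ : Q ∈ 𝒟) (h : X → ℝ≥0∞) {x : X} (hx : x ∈ Q) :
    (∫⁻ y in Q, h y ∂ν) / ν Q ≤ maxFun ν 𝒟 h x := by
  refine le_trans ?_ (le_iSup₂ (f := fun Q (_ : Q ∈ 𝒟) =>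
    Q.indicator (fun _ => (∫⁻ y in Q, h y ∂ν) / ν Q) x) Q hQ)
  simp [hx]

lemma lt_maxFun_iff {h : X → ℝ≥0∞} {x : X} {l : ℝ≥0∞} :
    l < maxFun ν 𝒟 h x ↔ ∃ Q ∈ 𝒟, x ∈ Q ∧ l < (∫⁻ y in Q, h y ∂ν) / ν Q := by
  constructor
  · intro hl
    simp only [maxFun, lt_iSup_iff] at hl
    obtain ⟨Q, hQ, hl⟩ := hl
    by_cases hx : x ∈ Q
    · exact ⟨Q, hQ, hx, by simpa [hx] using hl⟩
    · simp [hx] at hl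
  · rintro ⟨Q, hQ, hx, hl⟩
    exact hl.trans_le (le_maxFun hQ h hx)

lemma maxFun_congr {h k : X → ℝ≥0∞} (hk : h =ᵐ[ν] k) : maxFun ν 𝒟 h = maxFun ν 𝒟 k := by
  ext x
  simp only [maxFun, lintegral_congr_ae (ae_restrict_of_ae hk)]

/-- A finite nested family has the same union as its disjoint maximal members, over which the
hypothesis can be summed. The induction discards a set that lies in another one; if the chosen set
is maximal, it is split off together with everything inside it. -/
lemma mul_measure_sUnion_finset_le (h : X → ℝ≥0∞) (l : ℝ≥0∞) (S : Finset (Set X))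
    (hS : ∀ Q ∈ S, MeasurableSet Q)
    (hn : ∀ Q ∈ S, ∀ R ∈ S, Disjoint Q R ∨ Q ⊆ R ∨ R ⊆ Q)
    (hl : ∀ Q ∈ S, l * ν Q ≤ ∫⁻ y in Q, h y ∂ν) :
    l * ν (⋃ Q ∈ S, Q) ≤ ∫⁻ y in ⋃ Q ∈ S, Q, h y ∂ν := by
  classical
  induction S using Finset.strongInduction with
  | H S ih =>
    rcases S.eq_empty_or_nonempty with rfl | ⟨Q, hQ⟩
    · simp
    by_cases hmax : ∃ R ∈ S.erase Q, Q ⊆ R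
    · obtain ⟨R, hR, hQR⟩ := hmax
      have : (⋃ P ∈ S, P) = ⋃ P ∈ S.erase Q, P := by
        refine Set.Subset.antisymm (Set.iUnion₂_subset fun P hP => ?_)
          (Set.iUnion₂_subset fun P hP => Set.subset_biUnion_of_mem (u := fun P => P)
            (Finset.mem_of_mem_erase hP))
        by_cases hPQ : P = Q
        · subst hPQ
          exact hQR.trans (Set.subset_biUnion_of_mem (s := (S.erase P : Set (Set X)))
            (u := fun P => P) hR)
        · exact Set.subset_biUnion_of_mem (s := (S.erase Q : Set (Set X)))
            (u := fun P => P) (Finset.mem_erase.2 ⟨hPQ, hP⟩)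
      rw [this]
      exact ih _ (Finset.erase_ssubset hQ) (fun P hP => hS P (Finset.mem_of_mem_erase hP))
        (fun P hP R hR => hn P (Finset.mem_of_mem_erase hP) R (Finset.mem_of_mem_erase hR))
        (fun P hP => hl P (Finset.mem_of_mem_erase hP))
    · push Not at hmax
      set S' := (S.erase Q).filter fun R => Disjoint Q R with hS'
      have hsub : ∀ P ∈ S', P ∈ S := fun P hP =>
        Finset.mem_of_mem_erase (Finset.mem_filter.1 hP).1
      have hU : (⋃ P ∈ S, P) = Q ∪ ⋃ P ∈ S', P := by
        refine Set.Subset.antisymm (Set.iUnion₂_subset fun P hP => ?_) (Set.union_subset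
          (Set.subset_biUnion_of_mem (u := fun P => P) hQ) (Set.iUnion₂_subset fun P hP =>
            Set.subset_biUnion_of_mem (u := fun P => P) (hsub P hP)))
        by_cases hPQ : P = Q
        · exact hPQ ▸ Set.subset_union_left
        · have hPe : P ∈ S.erase Q := Finset.mem_erase.2 ⟨hPQ, hP⟩
          rcases hn Q hQ P hP with hd | hd | hd
          · exact (Set.subset_biUnion_of_mem (s := (S' : Set (Set X))) (u := fun P => P)
              (Finset.mem_filter.2 ⟨hPe, hd⟩)).trans Set.subset_union_right
          · exact absurd hd (hmax P hPe)
          · exact hd.trans Set.subset_union_left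
      have hdis : Disjoint Q (⋃ P ∈ S', P) :=
        Set.disjoint_iUnion₂_right.2 fun P hP => (Finset.mem_filter.1 hP).2
      have hmeas : MeasurableSet (⋃ P ∈ S', P) :=
        S'.measurableSet_biUnion fun P hP => hS P (hsub P hP)
      rw [hU, measure_union hdis hmeas, lintegral_union hmeas hdis, mul_add]
      refine add_le_add (hl Q hQ) (ih S' ?_ (fun P hP => hS P (hsub P hP))
        (fun P hP R hR => hn P (hsub P hP) R (hsub R hR)) fun P hP => hl P (hsub P hP))
      exact (Finset.filter_subset _ _).trans_ssubset (Finset.erase_ssubset hQ)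

/-- The weak type `(1, 1)` inequality. -/
lemma mul_measure_lt_maxFun_le (h𝒟 : IsNestedFamily 𝒟) (h : X → ℝ≥0∞) (l : ℝ≥0∞) :
    l * ν {x | l < maxFun ν 𝒟 h x} ≤ ∫⁻ x, h x ∂ν := by
  classical
  set S : Set (Set X) := {Q ∈ 𝒟 | l < (∫⁻ y in Q, h y ∂ν) / ν Q} with hS
  have hset : {x | l < maxFun ν 𝒟 h x} = ⋃ Q ∈ S, Q := by
    ext x
    simp only [Set.mem_ofPred_eq, lt_maxFun_iff, Set.mem_iUnion, hS, exists_prop]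
    exact ⟨fun ⟨Q, a, b, c⟩ => ⟨Q, ⟨a, c⟩, b⟩, fun ⟨Q, ⟨a, c⟩, b⟩ => ⟨Q, a, b, c⟩⟩
  have hl : ∀ Q ∈ S, l * ν Q ≤ ∫⁻ y in Q, h y ∂ν := fun Q hQ =>
    ENNReal.mul_le_of_le_div hQ.2.le
  rw [hset]
  rcases S.eq_empty_or_nonempty with hS0 | hS0
  · simp [hS0]
  obtain ⟨e, he⟩ := Set.Countable.exists_eq_range (s := S)
    (h𝒟.countable.mono (Set.sep_subset _ _)) hS0
  have hmem : ∀ n, e n ∈ S := fun n => by rw [he]; exact Set.mem_range_self n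
  -- Infinitely many cubes may have no maximal ones, so the union is exhausted by finite
  -- subfamilies.
  rw [he, Set.biUnion_range, measure_iUnion_eq_iSup_accumulate, ENNReal.mul_iSup]
  refine iSup_le fun n => ?_
  have hacc : Set.accumulate e n = ⋃ Q ∈ (Finset.range (n + 1)).image e, Q := by
    ext x
    simp [Set.mem_accumulate]
  have hfin : ∀ Q ∈ (Finset.range (n + 1)).image e, Q ∈ S := by
    intro Q hQ
    obtain ⟨m, -, rfl⟩ := Finset.mem_image.1 hQ
    exact hmem m
  rw [hacc]
  refine (mul_measure_sUnion_finset_le h l _ (fun Q hQ => h𝒟.measurable Q (hfin Q hQ).1)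
    (fun Q hQ R hR => h𝒟.nested Q (hfin Q hQ).1 R (hfin R hR).1)
    fun Q hQ => hl Q (hfin Q hQ)).trans (setLIntegral_le_lintegral _ _)

/-- The layer cake formula for a number. -/
lemma rpow_eq_lintegral_ite (y : ℝ≥0∞) {q : ℝ} (hq : 0 < q) :
    y ^ q = ENNReal.ofReal q * ∫⁻ t in Set.Ioi (0 : ℝ),
      if ENNReal.ofReal t < y then ENNReal.ofReal (t ^ (q - 1)) else 0 := by
  have key : ∀ a : ℝ, 0 ≤ a → ENNReal.ofReal a ^ q = ENNReal.ofReal q * ∫⁻ t in Set.Ioi (0 : ℝ),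
      if ENNReal.ofReal t < ENNReal.ofReal a then ENNReal.ofReal (t ^ (q - 1)) else 0 := by
    intro a ha
    -- The layer cake formula for functions, applied to a constant on a one-point probability space.
    have := lintegral_rpow_eq_lintegral_meas_lt_mul (Measure.dirac ()) (f := fun _ => a)
      (ae_of_all _ fun _ => ha) aemeasurable_const hq
    rw [lintegral_dirac] at this
    rw [ENNReal.ofReal_rpow_of_nonneg ha hq.le, this]
    congr 1
    refine setLIntegral_congr_fun measurableSet_Ioi fun t ht => ?_
    have ht0 : (0 : ℝ) < t := ht
    by_cases hta : t < a
    · simp [hta, ENNReal.ofReal_lt_ofReal_iff (ht0.trans hta)]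
    · have : ¬ ENNReal.ofReal t < ENNReal.ofReal a := by
        rw [not_lt] at hta ⊢
        exact ENNReal.ofReal_le_ofReal hta
      simp [hta, this]
  by_cases hy : y = ∞
  · subst hy
    rw [ENNReal.top_rpow_of_pos hq]
    refine (eq_top_iff.2 (le_of_tendsto'
      (ENNReal.tendsto_ofReal_atTop.comp ((tendsto_rpow_atTop hq).comp
        (tendsto_natCast_atTop_atTop (R := ℝ)))) fun n => ?_)).symm
    simp only [Function.comp]
    rw [← ENNReal.ofReal_rpow_of_nonneg (Nat.cast_nonneg n) hq.le, key _ (Nat.cast_nonneg n)]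
    gcongr with t
    split_ifs <;> simp_all
  · rw [← ENNReal.ofReal_toReal hy]
    exact key _ ENNReal.toReal_nonneg

/-- The maximal theorem. -/
theorem lintegral_maxFun_rpow_le [SFinite ν] (h𝒟 : IsNestedFamily 𝒟) {h : X → ℝ≥0∞}
    (hh : Measurable h) {q : ℝ} (hq : 1 < q) :
    ∫⁻ x, maxFun ν 𝒟 h x ^ q ∂ν ≤ ENNReal.ofReal (2 ^ q * (q / (q - 1))) * ∫⁻ x, h x ^ q ∂ν := by
  have hq0 : 0 < q := by linarith
  have hM := measurable_maxFun (ν := ν) h𝒟.countable h𝒟.measurable h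
  have hlevel : ∀ t : ℝ, 0 < t → ν {x | ENNReal.ofReal t < maxFun ν 𝒟 h x} ≤
      ENNReal.ofReal (2 / t) * ∫⁻ x, (if ENNReal.ofReal t < 2 * h x then h x else 0) ∂ν := by
    intro t ht
    -- The part of h below t/2 contributes at most t/2 to any average, so the maximal function of
    -- the truncation k must exceed t/2 wherever that of h exceeds t.
    set k : X → ℝ≥0∞ := fun x => if ENNReal.ofReal t < 2 * h x then h x else 0
    have hle : ∀ x, h x ≤ k x + ENNReal.ofReal (t / 2) := by
      intro x
      by_cases hx : ENNReal.ofReal t < 2 * h x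
      · simp [k, hx]
      · simp only [k, hx, if_false, zero_add]
        rw [not_lt] at hx
        rw [ENNReal.ofReal_div_of_pos two_pos, ENNReal.le_div_iff_mul_le (by simp) (by simp)]
        simpa [mul_comm] using hx
    have hsub : {x | ENNReal.ofReal t < maxFun ν 𝒟 h x} ⊆
        {x | ENNReal.ofReal (t / 2) < maxFun ν 𝒟 k x} := by
      intro x hx
      obtain ⟨Q, hQ, hxQ, hl⟩ := lt_maxFun_iff.1 hx
      refine lt_maxFun_iff.2 ⟨Q, hQ, hxQ, ?_⟩
      have h1 : (∫⁻ y in Q, h y ∂ν) / ν Q ≤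
          (∫⁻ y in Q, k y ∂ν) / ν Q + ENNReal.ofReal (t / 2) := by
        calc (∫⁻ y in Q, h y ∂ν) / ν Q
            ≤ (∫⁻ y in Q, (k y + ENNReal.ofReal (t / 2)) ∂ν) / ν Q := by
              gcongr with y; exact hle y
          _ = (∫⁻ y in Q, k y ∂ν) / ν Q + ENNReal.ofReal (t / 2) * ν Q / ν Q := by
              rw [lintegral_add_right _ measurable_const, lintegral_const, ENNReal.add_div,
                Measure.restrict_apply_univ]
          _ ≤ _ := by
              gcongr
              rw [mul_div_assoc]
              exact mul_le_of_le_one_right' ENNReal.div_self_le_one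
      have h2 : ENNReal.ofReal (t / 2) + ENNReal.ofReal (t / 2) <
          (∫⁻ y in Q, k y ∂ν) / ν Q + ENNReal.ofReal (t / 2) := by
        rw [← ENNReal.ofReal_add (by positivity) (by positivity), add_halves]
        exact hl.trans_le h1
      exact (ENNReal.add_lt_add_iff_right ENNReal.ofReal_ne_top).1 h2
    have hw := mul_measure_lt_maxFun_le (ν := ν) h𝒟 k (ENNReal.ofReal (t / 2))
    calc _ ≤ ν {x | ENNReal.ofReal (t / 2) < maxFun ν 𝒟 k x} := measure_mono hsub
      _ = ENNReal.ofReal (2 / t) * (ENNReal.ofReal (t / 2) *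
          ν {x | ENNReal.ofReal (t / 2) < maxFun ν 𝒟 k x}) := by
          rw [← mul_assoc, ← ENNReal.ofReal_mul (by positivity)]
          have : 2 / t * (t / 2) = 1 := by field_simp
          simp [this]
      _ ≤ _ := by gcongr
  have hmeas2 : Measurable fun z : X × ℝ =>
      if ENNReal.ofReal z.2 < maxFun ν 𝒟 h z.1 then ENNReal.ofReal (z.2 ^ (q - 1)) else 0 := by
    refine Measurable.ite (measurableSet_lt (by fun_prop) (hM.comp measurable_fst)) ?_
      measurable_const
    fun_prop
  have hmeas3 : Measurable fun z : X × ℝ =>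
      if ENNReal.ofReal z.2 < 2 * h z.1 then ENNReal.ofReal (z.2 ^ (q - 1 - 1)) else 0 := by
    refine Measurable.ite (measurableSet_lt (by fun_prop)
      ((hh.comp measurable_fst).const_mul 2)) ?_ measurable_const
    fun_prop
  calc ∫⁻ x, maxFun ν 𝒟 h x ^ q ∂ν
      = ENNReal.ofReal q * ∫⁻ x, (∫⁻ t in Set.Ioi (0 : ℝ),
          if ENNReal.ofReal t < maxFun ν 𝒟 h x then ENNReal.ofReal (t ^ (q - 1)) else 0) ∂ν := by
        rw [← lintegral_const_mul' _ _ ENNReal.ofReal_ne_top]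
        exact lintegral_congr fun x => rpow_eq_lintegral_ite _ hq0
    _ = ENNReal.ofReal q * ∫⁻ t in Set.Ioi (0 : ℝ), ∫⁻ x,
          (if ENNReal.ofReal t < maxFun ν 𝒟 h x then ENNReal.ofReal (t ^ (q - 1)) else 0) ∂ν := by
        rw [lintegral_lintegral_swap hmeas2.aemeasurable]
    -- The factor 2/t of the level set estimate lowers the power of t by one, which leaves the layer
    -- cake density of exponent q - 1 for the number 2h(x).
    _ ≤ ENNReal.ofReal q * ∫⁻ t in Set.Ioi (0 : ℝ), ∫⁻ x, 2 * h x *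
          (if ENNReal.ofReal t < 2 * h x then ENNReal.ofReal (t ^ (q - 1 - 1)) else 0) ∂ν := by
        gcongr ENNReal.ofReal q * ?_
        refine setLIntegral_mono' measurableSet_Ioi fun t ht => ?_
        have ht : 0 < t := ht
        have e1 : (fun x => if ENNReal.ofReal t < maxFun ν 𝒟 h x then
            ENNReal.ofReal (t ^ (q - 1)) else 0) =
            {x | ENNReal.ofReal t < maxFun ν 𝒟 h x}.indicator
              fun _ => ENNReal.ofReal (t ^ (q - 1)) := by
          ext x; simp [Set.indicator_apply]
        have e2 : (fun x => 2 * h x * (if ENNReal.ofReal t < 2 * h x then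
            ENNReal.ofReal (t ^ (q - 1 - 1)) else 0)) = fun x =>
            ENNReal.ofReal (t ^ (q - 1)) * ENNReal.ofReal (2 / t) *
              (if ENNReal.ofReal t < 2 * h x then h x else 0) := by
          ext x
          have : ENNReal.ofReal (t ^ (q - 1)) * ENNReal.ofReal (2 / t) =
              2 * ENNReal.ofReal (t ^ (q - 1 - 1)) := by
            rw [← ENNReal.ofReal_mul (by positivity), Real.rpow_sub_one ht.ne' (q - 1),
              ← ENNReal.ofReal_ofNat 2, ← ENNReal.ofReal_mul (by positivity)]
            congr 1
            field_simp
          rw [this]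
          split_ifs
          · ring
          · simp
        rw [e1, lintegral_indicator_const (measurableSet_lt measurable_const hM), e2,
          lintegral_const_mul' _ _ (by finiteness), mul_assoc]
        gcongr
        exact hlevel t ht
    _ = ENNReal.ofReal q * ∫⁻ x, 2 * h x * (∫⁻ t in Set.Ioi (0 : ℝ),
          if ENNReal.ofReal t < 2 * h x then ENNReal.ofReal (t ^ (q - 1 - 1)) else 0) ∂ν := by
        have hm : Measurable fun z : X × ℝ => 2 * h z.1 *
            (if ENNReal.ofReal z.2 < 2 * h z.1 then ENNReal.ofReal (z.2 ^ (q - 1 - 1)) else 0) :=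
          ((hh.comp measurable_fst).const_mul 2).mul hmeas3
        rw [← lintegral_lintegral_swap hm.aemeasurable]
        congr 1
        refine lintegral_congr fun x => ?_
        rw [lintegral_const_mul _ (by
          exact hmeas3.comp (measurable_const.prodMk measurable_id))]
    _ = ENNReal.ofReal (2 ^ q * (q / (q - 1))) * ∫⁻ x, h x ^ q ∂ν := by
        rw [← lintegral_const_mul' _ _ ENNReal.ofReal_ne_top,
          ← lintegral_const_mul' _ _ ENNReal.ofReal_ne_top]
        refine lintegral_congr fun x => ?_
        have hq1 : 0 < q - 1 := by linarith
        have e := rpow_eq_lintegral_ite (2 * h x) hq1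
        set I := ∫⁻ t in Set.Ioi (0 : ℝ),
          (if ENNReal.ofReal t < 2 * h x then ENNReal.ofReal (t ^ (q - 1 - 1)) else 0)
        have e2 : I = ENNReal.ofReal (1 / (q - 1)) * (2 * h x) ^ (q - 1) := by
          rw [e, ← mul_assoc, ← ENNReal.ofReal_mul (by positivity)]
          simp [hq1.ne']
        have e3 : 2 * h x * (2 * h x) ^ (q - 1) = (2 * h x) ^ q := by
          conv_rhs => rw [show q = 1 + (q - 1) by ring]
          rw [ENNReal.rpow_add_of_nonneg _ _ zero_le_one hq1.le, ENNReal.rpow_one]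
        have e4 : ENNReal.ofReal q * (2 * h x * (ENNReal.ofReal (1 / (q - 1)) *
            (2 * h x) ^ (q - 1))) = ENNReal.ofReal q * ENNReal.ofReal (1 / (q - 1)) *
            (2 * h x * (2 * h x) ^ (q - 1)) := by ring
        rw [e2, e4, e3, ENNReal.mul_rpow_of_nonneg _ _ hq0.le, ← mul_assoc]
        congr 1
        rw [ENNReal.ofReal_mul (p := 2 ^ q) (by positivity), ← ENNReal.ofReal_rpow_of_pos two_pos,
          ENNReal.ofReal_ofNat, mul_comm, ← ENNReal.ofReal_mul hq0.le, mul_one_div]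

/-- Averages over the members of a nested family, weighted by the measures of disjoint subsets. -/
theorem tsum_average_rpow_le [SFinite ν] (h𝒟 : IsNestedFamily 𝒟) {E : Set X → Set X}
    (hE : 𝒟.PairwiseDisjoint E) (hEm : ∀ Q ∈ 𝒟, MeasurableSet (E Q)) (hEQ : ∀ Q ∈ 𝒟, E Q ⊆ Q)
    {h : X → ℝ≥0∞} (hh : AEMeasurable h ν) {q : ℝ} (hq : 1 < q) :
    ∑' Q : 𝒟, ((∫⁻ y in Q, h y ∂ν) / ν Q) ^ q * ν (E Q) ≤
      ENNReal.ofReal (2 ^ q * (q / (q - 1))) * ∫⁻ x, h x ^ q ∂ν := by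
  have hae := hh.ae_eq_mk
  have : Countable 𝒟 := h𝒟.countable
  calc ∑' Q : 𝒟, ((∫⁻ y in Q, h y ∂ν) / ν Q) ^ q * ν (E Q)
      ≤ ∑' Q : 𝒟, ∫⁻ x in E Q, maxFun ν 𝒟 (hh.mk h) x ^ q ∂ν := by
        refine ENNReal.tsum_le_tsum fun Q => ?_
        rw [← setLIntegral_const]
        refine setLIntegral_mono' (hEm Q Q.2) fun x hx => ?_
        rw [← maxFun_congr hae]
        gcongr
        exact le_maxFun Q.2 h (hEQ Q Q.2 hx)
    _ = ∫⁻ x in ⋃ Q : 𝒟, E Q, maxFun ν 𝒟 (hh.mk h) x ^ q ∂ν :=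
        (lintegral_iUnion (fun Q : 𝒟 => hEm Q Q.2)
          (fun Q R hQR => hE Q.2 R.2 (Subtype.coe_injective.ne hQR)) _).symm
    _ ≤ _ := setLIntegral_le_lintegral _ _
    _ ≤ _ := lintegral_maxFun_rpow_le h𝒟 hh.measurable_mk hq
    _ = _ := by
        congr 1
        exact lintegral_congr_ae (hae.mono fun x hx => by simp [hx])

end Maximal

/-! ### The Rubio de Francia algorithm -/

section Majorant

variable {X : Type*} [MeasurableSpace X] {ι : Type*}

/-- The properties of a system of dyadic grids that are needed below. -/
structure IsGridSystem (μ : Measure X) (𝒟 : ι → Set (Set X)) : Prop where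
  nestedFamily : ∀ a, IsNestedFamily (𝒟 a)
  pos : ∀ a, ∀ Q ∈ 𝒟 a, 0 < μ Q
  finite : ∀ a, ∀ Q ∈ 𝒟 a, μ Q < ∞

/-- Jensen's inequality for a countable convex combination. -/
lemma tsum_mul_rpow_le {α : Type*} (w f : α → ℝ≥0∞) (hw : ∑' i, w i = 1) {q : ℝ} (hq : 1 ≤ q) :
    (∑' i, w i * f i) ^ q ≤ ∑' i, w i * f i ^ q := by
  have hq0 : 0 < q := by linarith
  rw [← ENNReal.le_rpow_inv_iff hq0, ENNReal.tsum_eq_iSup_sum]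
  refine iSup_le fun s => ?_
  refine (ENNReal.inner_le_weight_mul_Lp_of_nonneg s hq w f).trans ?_
  calc _ ≤ (1 : ℝ≥0∞) ^ (1 - q⁻¹) * (∑' i, w i * f i ^ q) ^ q⁻¹ := by
        gcongr
        · exact sub_nonneg.2 (inv_le_one_of_one_le₀ hq)
        · exact (ENNReal.sum_le_tsum s).trans_eq hw
        · exact ENNReal.sum_le_tsum s
    _ = _ := by simp

variable {μ : Measure X} {𝒟 : ι → Set (Set X)}

lemma maxFun_iUnion_rpow_le [Fintype ι] (h : X → ℝ≥0∞) (x : X) {q : ℝ} (hq : 0 < q) :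
    maxFun μ (⋃ a, 𝒟 a) h x ^ q ≤ ∑ a, maxFun μ (𝒟 a) h x ^ q := by
  rw [← ENNReal.le_rpow_inv_iff hq]
  refine iSup₂_le fun Q hQ => ?_
  obtain ⟨a, ha⟩ := Set.mem_iUnion.1 hQ
  rw [ENNReal.le_rpow_inv_iff hq]
  refine le_trans ?_ (Finset.single_le_sum (fun _ _ => zero_le) (Finset.mem_univ a))
  gcongr
  exact le_iSup₂ (f := fun Q (_ : Q ∈ 𝒟 a) =>
    Q.indicator (fun _ => (∫⁻ y in Q, h y ∂μ) / μ Q) x) Q ha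

lemma measurable_maxFun_iUnion [Countable ι] (h𝒟 : IsGridSystem μ 𝒟) (h : X → ℝ≥0∞) :
    Measurable (maxFun μ (⋃ a, 𝒟 a) h) := by
  refine measurable_maxFun (Set.countable_iUnion fun a => (h𝒟.nestedFamily a).countable) ?_ h
  intro Q hQ
  obtain ⟨a, ha⟩ := Set.mem_iUnion.1 hQ
  exact (h𝒟.nestedFamily a).measurable Q ha

lemma lintegral_maxFun_iUnion_rpow_le [Finite ι] [SFinite μ] (h𝒟 : IsGridSystem μ 𝒟)
    {h : X → ℝ≥0∞} (hh : Measurable h) {q : ℝ} (hq : 1 < q) :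
    ∫⁻ x, maxFun μ (⋃ a, 𝒟 a) h x ^ q ∂μ ≤
      ENNReal.ofReal (2 * (Nat.card ι + 1) * (q / (q - 1))) ^ q * ∫⁻ x, h x ^ q ∂μ := by
  have := Fintype.ofFinite ι
  have hq0 : 0 < q := by linarith
  have hq1 : 0 < q - 1 := by linarith
  calc ∫⁻ x, maxFun μ (⋃ a, 𝒟 a) h x ^ q ∂μ
      ≤ ∫⁻ x, ∑ a, maxFun μ (𝒟 a) h x ^ q ∂μ :=
        lintegral_mono fun x => maxFun_iUnion_rpow_le h x hq0
    _ = ∑ a, ∫⁻ x, maxFun μ (𝒟 a) h x ^ q ∂μ :=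
        lintegral_finsetSum _ fun a _ => (measurable_maxFun (h𝒟.nestedFamily a).countable
          (h𝒟.nestedFamily a).measurable h).pow_const q
    _ ≤ ∑ _a : ι, ENNReal.ofReal (2 ^ q * (q / (q - 1))) * ∫⁻ x, h x ^ q ∂μ :=
        Finset.sum_le_sum fun a _ => lintegral_maxFun_rpow_le (h𝒟.nestedFamily a) hh hq
    _ ≤ _ := by
        rw [Finset.sum_const, nsmul_eq_mul, ← mul_assoc, Finset.card_univ, ← Nat.card_eq_fintype_card]
        gcongr
        rw [ENNReal.ofReal_rpow_of_nonneg (by positivity) hq0.le, ← ENNReal.ofReal_natCast,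
          ← ENNReal.ofReal_mul (by positivity)]
        refine ENNReal.ofReal_le_ofReal ?_
        rw [Real.mul_rpow (by positivity) (by positivity),
          Real.mul_rpow (by positivity) (by positivity)]
        have h1 : (Nat.card ι : ℝ) ≤ (Nat.card ι + 1) ^ q :=
          (le_add_of_nonneg_right zero_le_one).trans
            (Real.self_le_rpow_of_one_le (by simp) hq.le)
        -- Replacing q/(q-1) by its q-th power costs nothing as q tends to 1, where only the first
        -- order blow-up 1/(q-1) of the norm matters for the critical exponents.
        have h2 : q / (q - 1) ≤ (q / (q - 1)) ^ q :=
          Real.self_le_rpow_of_one_le (by rw [one_le_div hq1]; linarith) hq.le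
        calc (Nat.card ι : ℝ) * (2 ^ q * (q / (q - 1)))
            ≤ (Nat.card ι + 1) ^ q * (2 ^ q * (q / (q - 1)) ^ q) := by gcongr
          _ = _ := by ring

/-- Every function has a majorant of comparable `L^q` norm in the class `A_1`. -/
theorem exists_majorant [Finite ι] [SFinite μ] (h𝒟 : IsGridSystem μ 𝒟) {h : X → ℝ≥0∞}
    (hh : Measurable h) {q : ℝ} (hq : 1 < q) :
    ∃ H : X → ℝ≥0∞, Measurable H ∧ (∀ x, h x ≤ H x) ∧
      ∫⁻ x, H x ^ q ∂μ ≤ 2 ^ q * ∫⁻ x, h x ^ q ∂μ ∧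
      ∀ a, ∀ Q ∈ 𝒟 a, ∀ x ∈ Q, (∫⁻ y in Q, H y ∂μ) / μ Q ≤
        ENNReal.ofReal (4 * (Nat.card ι + 1) * (q / (q - 1))) * H x := by
  have hq0 : 0 < q := by linarith
  have hq1 : 0 < q - 1 := by linarith
  set b : ℝ := 2 * (Nat.card ι + 1) * (q / (q - 1)) with hb
  have hb0 : 0 < b := by positivity
  set B : ℝ≥0∞ := ENNReal.ofReal b with hB
  have hBz : B ≠ 0 := by simp [hB, hb0]
  have hBt : B ≠ ∞ := ENNReal.ofReal_ne_top
  set M : (X → ℝ≥0∞) → X → ℝ≥0∞ := maxFun μ (⋃ a, 𝒟 a) with hM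
  set u : ℕ → X → ℝ≥0∞ := fun k => M^[k] h with hu
  have hsucc : ∀ k, u (k + 1) = M (u k) := fun k => Function.iterate_succ_apply' M k h
  have hum : ∀ k, Measurable (u k) := by
    intro k
    cases k with
    | zero => exact hh
    | succ k => rw [hsucc]; exact measurable_maxFun_iUnion h𝒟 _
  have hunorm : ∀ k, ∫⁻ x, u k x ^ q ∂μ ≤ (B ^ q) ^ k * ∫⁻ x, h x ^ q ∂μ := by
    intro k
    induction k with
    | zero => simp [hu]
    | succ k ih =>
      rw [hsucc]
      refine (lintegral_maxFun_iUnion_rpow_le h𝒟 (hum k) hq).trans ?_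
      rw [pow_succ', mul_assoc (B ^ q)]
      gcongr
  -- The majorant is the series of the iterates M^k h / (2B)^k, where B bounds the norm of M. An
  -- average of the k-th term is at most 2B times the next term, which gives the A_1 condition with
  -- constant 2B.
  set c : ℕ → ℝ≥0∞ := fun k => ((2 * B)⁻¹) ^ k with hc
  have h2B : (2 * B) ≠ 0 ∧ (2 * B) ≠ ∞ := ⟨by simp [hBz], by finiteness⟩
  have hcB : ∀ k, c k * B ^ k = 2 * ((2 : ℝ≥0∞)⁻¹) ^ (k + 1) := by
    intro k
    have : (2 * B)⁻¹ * B = 2⁻¹ := by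
      rw [ENNReal.mul_inv (by simp) (by simp), mul_assoc, ENNReal.inv_mul_cancel hBz hBt, mul_one]
    rw [hc, ← mul_pow, this, pow_succ', ← mul_assoc, ENNReal.mul_inv_cancel (by simp) (by simp),
      one_mul]
  have hgeo : ∑' k : ℕ, ((2 : ℝ≥0∞)⁻¹) ^ (k + 1) = 1 := by
    simp_rw [pow_succ', ENNReal.tsum_mul_left, ENNReal.tsum_geometric]
    simp [ENNReal.inv_mul_cancel]
  refine ⟨fun x => ∑' k, c k * u k x, Measurable.tsum fun k => (hum k).const_mul _, ?_, ?_, ?_⟩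
  · intro x
    refine le_trans ?_ (ENNReal.le_tsum 0)
    simp [hc, hu]
  -- The series is twice a convex combination of the functions M^k h / B^k, with weights 2^(-k-1).
  -- Jensen's inequality therefore replaces the triangle inequality in L^q.
  · have hpt : ∀ x, (∑' k, c k * u k x) ^ q ≤
        2 ^ q * ∑' k : ℕ, ((2 : ℝ≥0∞)⁻¹) ^ (k + 1) * (u k x / B ^ k) ^ q := by
      intro x
      have : ∑' k, c k * u k x = 2 * ∑' k : ℕ, ((2 : ℝ≥0∞)⁻¹) ^ (k + 1) * (u k x / B ^ k) := by
        rw [← ENNReal.tsum_mul_left]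
        refine tsum_congr fun k => ?_
        rw [← mul_assoc, ← hcB, mul_assoc, ENNReal.mul_div_cancel (pow_ne_zero _ hBz)
          (ENNReal.pow_ne_top hBt)]
      rw [this, ENNReal.mul_rpow_of_nonneg _ _ hq0.le]
      gcongr
      exact tsum_mul_rpow_le _ _ hgeo hq.le
    refine (lintegral_mono hpt).trans ?_
    rw [lintegral_const_mul' _ _ (by finiteness), lintegral_tsum fun k =>
      ((((hum k).div_const _).pow_const q).const_mul _).aemeasurable]
    gcongr
    calc _ ≤ ∑' k : ℕ, ((2 : ℝ≥0∞)⁻¹) ^ (k + 1) * ∫⁻ x, h x ^ q ∂μ := by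
          refine ENNReal.tsum_le_tsum fun k => ?_
          rw [lintegral_const_mul' _ _ (by finiteness)]
          gcongr (2 : ℝ≥0∞)⁻¹ ^ (k + 1) * ?_
          simp_rw [ENNReal.div_rpow_of_nonneg _ _ hq0.le, div_eq_mul_inv]
          have h0 : (B ^ k) ^ q ≠ 0 := by
            simp [ENNReal.rpow_eq_zero_iff, hBz, hBt]
          have ht : (B ^ k) ^ q ≠ ∞ := by finiteness
          rw [lintegral_mul_const' _ _ (by simp [h0]), ← div_eq_mul_inv]
          refine ENNReal.div_le_of_le_mul' ((hunorm k).trans_eq ?_)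
          rw [← ENNReal.rpow_natCast, ← ENNReal.rpow_natCast, ← ENNReal.rpow_mul,
            ← ENNReal.rpow_mul, mul_comm q]
      _ = _ := by rw [ENNReal.tsum_mul_right, hgeo, one_mul]
  · intro a Q hQ x hx
    have h4 : ENNReal.ofReal (4 * (Nat.card ι + 1) * (q / (q - 1))) = 2 * B := by
      rw [hB, ← ENNReal.ofReal_ofNat 2, ← ENNReal.ofReal_mul (by positivity), hb]
      congr 1
      ring
    rw [h4, lintegral_tsum fun k => ((hum k).const_mul _).aemeasurable, div_eq_mul_inv,
      ← ENNReal.tsum_mul_right, ← ENNReal.tsum_mul_left]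
    calc _ ≤ ∑' k, 2 * B * (c (k + 1) * u (k + 1) x) := by
          refine ENNReal.tsum_le_tsum fun k => ?_
          have e : 2 * B * c (k + 1) = c k := by
            rw [hc]
            simp only [pow_succ']
            rw [← mul_assoc, ENNReal.mul_inv_cancel h2B.1 h2B.2, one_mul]
          rw [lintegral_const_mul _ (hum k), mul_assoc, ← mul_assoc (2 * B), e]
          gcongr
          rw [← div_eq_mul_inv, hsucc]
          exact le_maxFun (Set.mem_iUnion.2 ⟨a, hQ⟩) (u k) hx
      _ ≤ _ := ENNReal.tsum_comp_le_tsum_of_injective (add_left_injective 1) _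

end Majorant

/-! ### Averages and weight constants -/

section WeightConstants

variable {X : Type*} [MeasurableSpace X] {ι : Type*} {μ : Measure X} {𝒟 : ι → Set (Set X)}

lemma avg_ofReal_eq {F : Type*} [NormedAddCommGroup F] {p : ℝ} (hp : 0 < p) (f : X → F)
    (Q : Set X) :
    avg μ (ENNReal.ofReal p) f Q = ((∫⁻ x in Q, ‖f x‖ₑ ^ p ∂μ) / μ Q) ^ (1 / p) := by
  rw [avg, eLpNorm_eq_lintegral_rpow_enorm_toReal (by simpa using hp) ENNReal.ofReal_ne_top,
    ENNReal.toReal_ofReal hp.le, lintegral_smul_measure, smul_eq_mul, ENNReal.div_eq_inv_mul]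

lemma avg_one_eq {F : Type*} [NormedAddCommGroup F] (f : X → F) (Q : Set X) :
    avg μ 1 f Q = (∫⁻ x in Q, ‖f x‖ₑ ∂μ) / μ Q := by
  simpa using avg_ofReal_eq (μ := μ) one_pos f Q

lemma isProbabilityMeasure_avg {Q : Set X} (h0 : μ Q ≠ 0) (ht : μ Q ≠ ∞) :
    IsProbabilityMeasure ((μ Q)⁻¹ • μ.restrict Q) :=
  ⟨by simp [ENNReal.inv_mul_cancel h0 ht]⟩

lemma avg_mono_exponent {F : Type*} [NormedAddCommGroup F] {f : X → F}
    (hf : AEStronglyMeasurable f μ) {p q : ℝ≥0∞} (hpq : p ≤ q) {Q : Set X} (h0 : μ Q ≠ 0)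
    (ht : μ Q ≠ ∞) : avg μ p f Q ≤ avg μ q f Q :=
  have := isProbabilityMeasure_avg h0 ht
  eLpNorm_le_eLpNorm_of_exponent_le hpq (hf.restrict.smul_measure _)

lemma avg_rpow {f : X → ℝ} (hf : ∀ x, 0 ≤ f x) {s : ℝ} (hs : 0 < s) (p : ℝ≥0∞) (Q : Set X) :
    avg μ p (fun x => f x ^ s) Q = avg μ (p * ENNReal.ofReal s) f Q ^ s := by
  rw [avg, avg, ← eLpNorm_norm_rpow f hs]
  simp_rw [Real.norm_of_nonneg (hf _)]

lemma le_apConst {a : ι} {Q : Set X} (hQ : Q ∈ 𝒟 a) (q : ℝ) (w : X → ℝ) :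
    avg μ 1 w Q * avg μ (ENNReal.ofReal (q - 1))⁻¹ (fun x => (w x)⁻¹) Q ≤ apConst μ 𝒟 q w :=
  le_iSup_of_le a (le_iSup₂_of_le Q hQ le_rfl)

lemma IsWeight.rpow {w : X → ℝ} (hw : IsWeight w) (s : ℝ) : IsWeight fun x => w x ^ s :=
  ⟨hw.1.pow_const s, fun x => Real.rpow_pos_of_pos (hw.2 x) s⟩

lemma IsWeight.inv {w : X → ℝ} (hw : IsWeight w) : IsWeight fun x => (w x)⁻¹ :=
  ⟨hw.1.inv, fun x => inv_pos.2 (hw.2 x)⟩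

/-- Hölder's inequality with exponents 1 and 1/(q-1), applied to w · w⁻¹ = 1 on a probability space.
The resulting exponent 1/q is at most 1, which is harmless because Hölder's inequality does not need
a norm on the left. It makes weight constants at least 1, so that powers of them increase with the
exponent. -/
lemma one_le_avg_mul_avg_inv {w : X → ℝ} (hw : IsWeight w) {q : ℝ} (hq : 1 ≤ q) {Q : Set X}
    (h0 : μ Q ≠ 0) (ht : μ Q ≠ ∞) :
    1 ≤ avg μ 1 w Q * avg μ (ENNReal.ofReal (q - 1))⁻¹ (fun x => (w x)⁻¹) Q := by
  have := isProbabilityMeasure_avg h0 ht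
  have : ENNReal.HolderTriple 1 (ENNReal.ofReal (q - 1))⁻¹ (ENNReal.ofReal q)⁻¹ := by
    constructor
    rw [inv_inv, inv_inv, inv_one, ← ENNReal.ofReal_one,
      ← ENNReal.ofReal_add zero_le_one (by linarith)]
    congr 1
    ring
  have h := eLpNorm_smul_le_mul_eLpNorm (p := 1) (q := (ENNReal.ofReal (q - 1))⁻¹)
    (r := (ENNReal.ofReal q)⁻¹) (μ := (μ Q)⁻¹ • μ.restrict Q) (φ := w) (f := fun x => (w x)⁻¹)
    hw.inv.1.aestronglyMeasurable hw.1.aestronglyMeasurable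
  have h1 : (w • fun x => (w x)⁻¹) = fun _ => (1 : ℝ) := by
    ext x
    simp [(hw.2 x).ne']
  rw [h1, eLpNorm_const _ (by simp) (IsProbabilityMeasure.ne_zero _)] at h
  simpa [avg, mul_comm] using h

lemma one_le_apConst {w : X → ℝ} (hw : IsWeight w) {q : ℝ} (hq : 1 ≤ q) (h𝒟 : IsGridSystem μ 𝒟)
    (hne : ∃ a, (𝒟 a).Nonempty) : 1 ≤ apConst μ 𝒟 q w := by
  obtain ⟨a, Q, hQ⟩ := hne
  exact (one_le_avg_mul_avg_inv hw hq (h𝒟.pos a Q hQ).ne' (h𝒟.finite a Q hQ).ne).trans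
    (le_apConst hQ q w)

lemma apConst_anti {w : X → ℝ} (hw : IsWeight w) {q r : ℝ} (hqr : q ≤ r)
    (h𝒟 : IsGridSystem μ 𝒟) : apConst μ 𝒟 r w ≤ apConst μ 𝒟 q w := by
  refine iSup_le fun a => iSup₂_le fun Q hQ => le_trans ?_ (le_apConst hQ q w)
  gcongr
  exact avg_mono_exponent hw.inv.1.aestronglyMeasurable
    (ENNReal.inv_le_inv.2 (ENNReal.ofReal_le_ofReal (by linarith)))
    (h𝒟.pos a Q hQ).ne' (h𝒟.finite a Q hQ).ne

section Criterion

variable {w : X → ℝ} {s q : ℝ} {L : ℝ≥0∞}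

/-- The bound on ⟨w⟩_s ⟨w⁻¹⟩_{1/(q-1)} is, up to the power s, the A condition for w^s with index
s(q-1)+1: pulling the power s out of an average multiplies its exponent by s. Together with
`inA_of_avg_mul_avg_le` and `inRH_of_avg_mul_avg_le`, this single product controls everything that
is asked of the weights built by extrapolation. For q = 1 the exponent 1/(q-1) is ∞. -/
lemma apConst_rpow_le (hw : IsWeight w) (hs : 1 ≤ s) (hL : ∀ a, ∀ Q ∈ 𝒟 a,
      avg μ (ENNReal.ofReal s) w Q *
        avg μ (ENNReal.ofReal (q - 1))⁻¹ (fun x => (w x)⁻¹) Q ≤ L) :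
    apConst μ 𝒟 (s * (q - 1) + 1) (fun x => w x ^ s) ≤ L ^ s := by
  have hs0 : 0 < s := by linarith
  refine iSup_le fun a => iSup₂_le fun Q hQ => ?_
  have h1 : (fun x => (w x ^ s)⁻¹) = fun x => ((w x)⁻¹) ^ s := by
    ext x
    rw [Real.inv_rpow (hw.2 x).le]
  have h2 : (ENNReal.ofReal (s * (q - 1) + 1 - 1))⁻¹ * ENNReal.ofReal s =
      (ENNReal.ofReal (q - 1))⁻¹ := by
    rw [add_sub_cancel_right, ENNReal.ofReal_mul hs0.le,
      ENNReal.mul_inv (by simp [hs0]) (by simp), mul_right_comm,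
      ENNReal.inv_mul_cancel (by simpa using hs0) ENNReal.ofReal_ne_top, one_mul]
  rw [h1, avg_rpow (fun x => (hw.2 x).le) hs0, avg_rpow (fun x => (hw.inv.2 x).le) hs0, h2,
    one_mul, ← ENNReal.mul_rpow_of_nonneg _ _ hs0.le]
  gcongr
  exact hL a Q hQ

lemma apConst_le_of_avg_mul_avg_le (hw : IsWeight w) (hs : 1 ≤ s) (h𝒟 : IsGridSystem μ 𝒟)
    (hL : ∀ a, ∀ Q ∈ 𝒟 a, avg μ (ENNReal.ofReal s) w Q *
      avg μ (ENNReal.ofReal (q - 1))⁻¹ (fun x => (w x)⁻¹) Q ≤ L) :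
    apConst μ 𝒟 q w ≤ L := by
  refine iSup_le fun a => iSup₂_le fun Q hQ => le_trans ?_ (hL a Q hQ)
  gcongr
  exact avg_mono_exponent hw.1.aestronglyMeasurable (by simpa using hs)
    (h𝒟.pos a Q hQ).ne' (h𝒟.finite a Q hQ).ne

lemma rhConst_le_of_avg_mul_avg_le (hw : IsWeight w) (hq : 1 ≤ q) (h𝒟 : IsGridSystem μ 𝒟)
    (hL : ∀ a, ∀ Q ∈ 𝒟 a, avg μ (ENNReal.ofReal s) w Q *
      avg μ (ENNReal.ofReal (q - 1))⁻¹ (fun x => (w x)⁻¹) Q ≤ L) :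
    rhConst μ 𝒟 s w ≤ L := by
  refine iSup_le fun a => iSup₂_le fun Q hQ => ENNReal.div_le_of_le_mul ?_
  calc avg μ (ENNReal.ofReal s) w Q
      ≤ avg μ (ENNReal.ofReal s) w Q * (avg μ 1 w Q *
        avg μ (ENNReal.ofReal (q - 1))⁻¹ (fun x => (w x)⁻¹) Q) :=
        le_mul_of_one_le_right' (one_le_avg_mul_avg_inv hw hq (h𝒟.pos a Q hQ).ne'
          (h𝒟.finite a Q hQ).ne)
    _ = avg μ (ENNReal.ofReal s) w Q *
        avg μ (ENNReal.ofReal (q - 1))⁻¹ (fun x => (w x)⁻¹) Q * avg μ 1 w Q := by ring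
    _ ≤ L * avg μ 1 w Q := by gcongr; exact hL a Q hQ

lemma inA_of_avg_mul_avg_le (hw : IsWeight w) (hs : 1 ≤ s) (h𝒟 : IsGridSystem μ 𝒟)
    (hLt : L < ∞) (hL : ∀ a, ∀ Q ∈ 𝒟 a, avg μ (ENNReal.ofReal s) w Q *
      avg μ (ENNReal.ofReal (q - 1))⁻¹ (fun x => (w x)⁻¹) Q ≤ L) :
    InA μ 𝒟 q w :=
  ⟨hw, (apConst_le_of_avg_mul_avg_le hw hs h𝒟 hL).trans_lt hLt⟩

lemma inRH_of_avg_mul_avg_le (hw : IsWeight w) (hs : 1 ≤ s) (hq : 1 ≤ q)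
    (h𝒟 : IsGridSystem μ 𝒟) (hLt : L < ∞) (hL : ∀ a, ∀ Q ∈ 𝒟 a, avg μ (ENNReal.ofReal s) w Q *
      avg μ (ENNReal.ofReal (q - 1))⁻¹ (fun x => (w x)⁻¹) Q ≤ L) :
    InRH μ 𝒟 s w := by
  by_cases h1 : s = 1
  · exact Or.inl ⟨h1, q, hq, inA_of_avg_mul_avg_le hw hs h𝒟 hLt hL⟩
  · exact Or.inr ⟨h1, hw, (rhConst_le_of_avg_mul_avg_le hw hq h𝒟 hL).trans_lt hLt⟩

end Criterion

lemma apConst_const_one_le (q : ℝ) (h𝒟 : IsGridSystem μ 𝒟) :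
    apConst μ 𝒟 q (fun _ => 1) ≤ 1 := by
  refine iSup_le fun a => iSup₂_le fun Q hQ => ?_
  have := isProbabilityMeasure_avg (h𝒟.pos a Q hQ).ne' (h𝒟.finite a Q hQ).ne
  rw [avg, avg, eLpNorm_const _ (by simp) (IsProbabilityMeasure.ne_zero _),
    eLpNorm_const _ (by simp) (IsProbabilityMeasure.ne_zero _)]
  simp

lemma isWeight_one : IsWeight fun _ : X => (1 : ℝ) := ⟨measurable_const, fun _ => one_pos⟩

lemma inAInfty_one (h𝒟 : IsGridSystem μ 𝒟) : InAInfty μ 𝒟 (fun _ => 1) :=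
  ⟨1, le_rfl, isWeight_one, (apConst_const_one_le 1 h𝒟).trans_lt ENNReal.one_lt_top⟩

@[simp]
lemma wMeasure_one : wMeasure μ (fun _ => 1) = μ := by
  simp [wMeasure]

end WeightConstants

/-! ### Estimates of sparse forms -/

section Forms

variable {X : Type*} [MeasurableSpace X] {ι : Type*} {μ : Measure X} {𝒟 : ι → Set (Set X)}

/-- Hölder's inequality for sums. -/
lemma tsum_mul_le_Lp_mul_Lq {α : Type*} (x y : α → ℝ≥0∞) {p q : ℝ} (hpq : p.HolderConjugate q) :
    ∑' i, x i * y i ≤ (∑' i, x i ^ p) ^ (1 / p) * (∑' i, y i ^ q) ^ (1 / q) := by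
  let : MeasurableSpace α := ⊤
  simpa [lintegral_count] using ENNReal.lintegral_mul_le_Lp_mul_Lq Measure.count hpq
    (f := x) (g := y) (measurable_from_top).aemeasurable (measurable_from_top).aemeasurable

lemma IsNestedFamily.mono {𝒮 𝒯 : Set (Set X)} (h : IsNestedFamily 𝒯) (hs : 𝒮 ⊆ 𝒯) :
    IsNestedFamily 𝒮 :=
  ⟨h.countable.mono hs, fun Q hQ => h.measurable Q (hs hQ),
    fun Q hQ R hR => h.nested Q (hs hQ) R (hs hR)⟩

/-- The constant of the maximal theorem on `L^t`. -/
def maxConst (t : ℝ) : ℝ≥0∞ := ENNReal.ofReal (2 ^ t * (t / (t - 1)))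

/-- The abstract estimate of a sparse form, over one grid. -/
lemma tsum_mul_mul_le {𝒮 : Set (Set X)} (h𝒮 : IsNestedFamily 𝒮) {E : Set X → Set X}
    (hE : 𝒮.PairwiseDisjoint E) (hEm : ∀ Q ∈ 𝒮, MeasurableSet (E Q)) (hEQ : ∀ Q ∈ 𝒮, E Q ⊆ Q)
    {ν₁ ν₂ : Measure X} [SFinite ν₁] [SFinite ν₂] {φ₁ φ₂ : X → ℝ≥0∞} (h₁ : AEMeasurable φ₁ ν₁)
    (h₂ : AEMeasurable φ₂ ν₂) {r b p p' : ℝ} (hr : 0 < r) (hrp : r < p) (hb : 0 < b)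
    (hbp : b < p') (hpp : p.HolderConjugate p') (α β m A B : Set X → ℝ≥0∞) (K : ℝ≥0∞)
    (hα : ∀ Q ∈ 𝒮, α Q ≤ A Q * ((∫⁻ x in Q, φ₁ x ∂ν₁) / ν₁ Q) ^ (1 / r))
    (hβ : ∀ Q ∈ 𝒮, β Q ≤ B Q * ((∫⁻ x in Q, φ₂ x ∂ν₂) / ν₂ Q) ^ (1 / b))
    (hK : ∀ Q ∈ 𝒮, A Q * B Q * m Q ≤ K * (ν₁ (E Q) ^ (1 / p) * ν₂ (E Q) ^ (1 / p'))) :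
    ∑' Q : 𝒮, α Q * β Q * m Q ≤ K * ((maxConst (p / r) * ∫⁻ x, φ₁ x ^ (p / r) ∂ν₁) ^ (1 / p) *
      (maxConst (p' / b) * ∫⁻ x, φ₂ x ^ (p' / b) ∂ν₂) ^ (1 / p')) := by
  have hp0 := hpp.pos
  have hp0' := hpp.symm.pos
  calc ∑' Q : 𝒮, α Q * β Q * m Q
      ≤ ∑' Q : 𝒮, K * ((((∫⁻ x in Q, φ₁ x ∂ν₁) / ν₁ Q) ^ (1 / r) * ν₁ (E Q) ^ (1 / p)) *
          (((∫⁻ x in Q, φ₂ x ∂ν₂) / ν₂ Q) ^ (1 / b) * ν₂ (E Q) ^ (1 / p'))) := by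
        refine ENNReal.tsum_le_tsum fun Q => ?_
        set u := ((∫⁻ x in (Q : Set X), φ₁ x ∂ν₁) / ν₁ Q) ^ (1 / r)
        set v := ((∫⁻ x in (Q : Set X), φ₂ x ∂ν₂) / ν₂ Q) ^ (1 / b)
        calc α Q * β Q * m Q ≤ (A Q * u) * (B Q * v) * m Q := by
              gcongr
              exacts [hα Q Q.2, hβ Q Q.2]
          _ = (A Q * B Q * m Q) * (u * v) := by ring
          _ ≤ K * (ν₁ (E Q) ^ (1 / p) * ν₂ (E Q) ^ (1 / p')) * (u * v) :=
              mul_le_mul' (hK Q Q.2) le_rfl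
          _ = _ := by ring
    _ ≤ _ := by
        rw [ENNReal.tsum_mul_left]
        gcongr
        refine (tsum_mul_le_Lp_mul_Lq _ _ hpp).trans ?_
        gcongr
        · refine le_trans (le_of_eq (tsum_congr fun Q => ?_)) (tsum_average_rpow_le h𝒮 hE hEm hEQ h₁
            (q := p / r) (by rwa [one_lt_div hr]))
          rw [ENNReal.mul_rpow_of_nonneg _ _ hp0.le, ← ENNReal.rpow_mul, ← ENNReal.rpow_mul,
            one_div_mul_cancel hp0.ne', ENNReal.rpow_one]
          congr 2
          ring
        · refine le_trans (le_of_eq (tsum_congr fun Q => ?_)) (tsum_average_rpow_le h𝒮 hE hEm hEQ h₂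
            (q := p' / b) (by rwa [one_lt_div hb]))
          rw [ENNReal.mul_rpow_of_nonneg _ _ hp0'.le, ← ENNReal.rpow_mul, ← ENNReal.rpow_mul,
            one_div_mul_cancel hp0'.ne', ENNReal.rpow_one]
          congr 2
          ring

/-! #### Weighted measures -/

lemma lintegral_wMeasure {u : X → ℝ} (hu : Measurable u) (g : X → ℝ≥0∞) :
    ∫⁻ x, g x ∂wMeasure μ u = ∫⁻ x, ENNReal.ofReal (u x) * g x ∂μ :=
  lintegral_withDensity_eq_lintegral_mul_non_measurable _ hu.ennreal_ofReal
    (ae_of_all _ fun _ => ENNReal.ofReal_lt_top) _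

lemma setLIntegral_wMeasure {u : X → ℝ} (hu : Measurable u) (g : X → ℝ≥0∞) {Q : Set X}
    (hQ : MeasurableSet Q) :
    ∫⁻ x in Q, g x ∂wMeasure μ u = ∫⁻ x in Q, ENNReal.ofReal (u x) * g x ∂μ := by
  rw [wMeasure, restrict_withDensity hQ]
  exact lintegral_wMeasure hu g

lemma wMeasure_apply {u : X → ℝ} {Q : Set X} (hQ : MeasurableSet Q) :
    wMeasure μ u Q = ∫⁻ x in Q, ENNReal.ofReal (u x) ∂μ := withDensity_apply _ hQ

lemma wMeasure_absolutelyContinuous (u : X → ℝ) : wMeasure μ u ≪ μ :=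
  withDensity_absolutelyContinuous _ _

lemma absolutelyContinuous_wMeasure {u : X → ℝ} (hu : IsWeight u) : μ ≪ wMeasure μ u :=
  withDensity_absolutelyContinuous' hu.1.ennreal_ofReal.aemeasurable
    (ae_of_all _ fun x => by simpa using hu.2 x)

lemma ofReal_mul_ofReal_inv {a : ℝ} (ha : 0 < a) (b : ℝ≥0∞) :
    ENNReal.ofReal a * (b * ENNReal.ofReal a⁻¹) = b := by
  rw [mul_left_comm, ← ENNReal.ofReal_mul ha.le, mul_inv_cancel₀ ha.ne', ENNReal.ofReal_one,
    mul_one]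

/-- An average with respect to `μ` in terms of an average with respect to a weighted measure. -/
lemma avg_eq_wMeasure {F : Type*} [NormedAddCommGroup F] {u : X → ℝ} (hu : IsWeight u)
    {r : ℝ} (hr : 0 < r) (f : X → F) {Q : Set X} (hQ : MeasurableSet Q) (h0 : μ Q ≠ 0)
    (ht : wMeasure μ u Q ≠ ∞) :
    avg μ (ENNReal.ofReal r) f Q = (wMeasure μ u Q / μ Q) ^ (1 / r) *
      ((∫⁻ x in Q, ‖f x‖ₑ ^ r * ENNReal.ofReal (u x)⁻¹ ∂wMeasure μ u) / wMeasure μ u Q) ^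
        (1 / r) := by
  have hz : wMeasure μ u Q ≠ 0 := fun h => h0 (absolutelyContinuous_wMeasure hu h)
  rw [avg_ofReal_eq hr, setLIntegral_wMeasure hu.1 _ hQ,
    ← ENNReal.mul_rpow_of_nonneg _ _ (by positivity)]
  congr 1
  simp_rw [ofReal_mul_ofReal_inv (hu.2 _)]
  rw [div_eq_mul_inv, div_eq_mul_inv, div_eq_mul_inv, mul_mul_mul_comm, mul_right_comm,
    ← mul_assoc (wMeasure μ u Q), mul_right_comm (wMeasure μ u Q), ENNReal.mul_inv_cancel hz ht,
    one_mul, mul_comm]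

lemma lintegral_rpow_wMeasure {F : Type*} [NormedAddCommGroup F] {u : X → ℝ} (hu : IsWeight u)
    (f : X → F) {r t : ℝ} (ht : 0 ≤ t) :
    ∫⁻ x, (‖f x‖ₑ ^ r * ENNReal.ofReal (u x)⁻¹) ^ t ∂wMeasure μ u =
      ∫⁻ x, ‖f x‖ₑ ^ (r * t) ∂wMeasure μ (fun x => u x ^ (1 - t)) := by
  rw [lintegral_wMeasure hu.1, lintegral_wMeasure (hu.rpow _).1]
  refine lintegral_congr fun x => ?_
  rw [ENNReal.mul_rpow_of_nonneg _ _ ht, ← ENNReal.rpow_mul, mul_left_comm, mul_comm,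
    ENNReal.ofReal_rpow_of_pos (inv_pos.2 (hu.2 x)), ← ENNReal.ofReal_mul (hu.2 x).le,
    Real.inv_rpow (hu.2 x).le, Real.rpow_sub (hu.2 x), Real.rpow_one, div_eq_mul_inv]

lemma eLpNorm_ofReal_eq {F : Type*} [NormedAddCommGroup F] {p : ℝ} (hp : 0 < p) (f : X → F)
    (ν : Measure X) : eLpNorm f (ENNReal.ofReal p) ν = (∫⁻ x, ‖f x‖ₑ ^ p ∂ν) ^ (1 / p) := by
  rw [eLpNorm_eq_lintegral_rpow_enorm_toReal (by simpa using hp) ENNReal.ofReal_ne_top,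
    ENNReal.toReal_ofReal hp.le]

/-- `|E| ≤ W(E)^{1/q} σ(E)^{1/q'}` if `W σ^{q-1} = 1`, `1 < q`. -/
lemma measure_le_wMeasure_mul {W : X → ℝ} (hW : IsWeight W) {q : ℝ} (hq : 1 < q) {E : Set X}
    (hE : MeasurableSet E) :
    μ E ≤ wMeasure μ W E ^ (1 / q) *
      wMeasure μ (fun x => W x ^ (-(1 / (q - 1)))) E ^ ((q - 1) / q) := by
  have hq0 : 0 < q := by linarith
  have hq1 : 0 < q - 1 := by linarith
  have hc : q.HolderConjugate (q / (q - 1)) := Real.HolderConjugate.conjExponent hq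
  have hh := ENNReal.lintegral_mul_le_Lp_mul_Lq (μ.restrict E) hc
    (f := fun x => ENNReal.ofReal (W x ^ (1 / q)))
    (g := fun x => ENNReal.ofReal (W x ^ (-(1 / q))))
    (hW.rpow _).1.ennreal_ofReal.aemeasurable (hW.rpow _).1.ennreal_ofReal.aemeasurable
  have e1 : ∀ x, ((fun x => ENNReal.ofReal (W x ^ (1 / q))) *
      fun x => ENNReal.ofReal (W x ^ (-(1 / q)))) x = 1 := by
    intro x
    rw [Pi.mul_apply, ← ENNReal.ofReal_mul (Real.rpow_pos_of_pos (hW.2 x) _).le,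
      ← Real.rpow_add (hW.2 x)]
    simp
  have e2 : ∀ x, ENNReal.ofReal (W x ^ (1 / q)) ^ q = ENNReal.ofReal (W x) := by
    intro x
    rw [ENNReal.ofReal_rpow_of_pos (Real.rpow_pos_of_pos (hW.2 x) _), ← Real.rpow_mul (hW.2 x).le,
      one_div_mul_cancel hq0.ne', Real.rpow_one]
  have e3 : ∀ x, ENNReal.ofReal (W x ^ (-(1 / q))) ^ (q / (q - 1)) =
      ENNReal.ofReal (W x ^ (-(1 / (q - 1)))) := by
    intro x
    rw [ENNReal.ofReal_rpow_of_pos (Real.rpow_pos_of_pos (hW.2 x) _), ← Real.rpow_mul (hW.2 x).le]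
    congr 2
    field_simp
  rw [lintegral_congr e1, lintegral_one, Measure.restrict_apply_univ, lintegral_congr e2,
    lintegral_congr e3, one_div_div] at hh
  rwa [wMeasure_apply hE, wMeasure_apply hE]

end Forms

/-! ### Numerical inequalities for one cube and its sparse subset -/

section Numeric

/-- Here x, y, m are the measures σ(Q), W(Q), |Q|, and x', y', e those of the subset E; A bounds the
A_φ product and N = 1/η. The power θ of the A_φ condition reduces the exponents on the left to P and
P', after which the powers of m cancel since P + P' = 1. It remains to pass from Q to E. The
condition on Q and Hölder's inequality on E give (x/x')^(φ-1) (y/y') ≤ A N^φ, and the power τ of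
this suffices as x ≥ x', y ≥ y'. In logarithms all of this is linear. -/
lemma rpow_mul_rpow_mul_le_Aq {x y x' y' m e N A ρ β P P' θ τ φ : ℝ} (hx' : 0 < x') (hy' : 0 < y')
    (hm : 0 < m) (he : 0 < e) (hN : 0 < N) (hxx : x' ≤ x) (hyy : y' ≤ y)
    (hA : y / m * (x / m) ^ (φ - 1) ≤ A) (hmN : m ≤ N * e)
    (heE : e ≤ y' ^ (1 / φ) * x' ^ ((φ - 1) / φ)) (hφ : 1 < φ) (hρ : ρ = P + θ * (φ - 1))
    (hβ : β = P' + θ) (hP : P + P' = 1) (hθ : 0 ≤ θ) (hτ₁ : P ≤ τ * (φ - 1)) (hτ₂ : P' ≤ τ)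
    (hP' : 0 ≤ P') :
    (x / m) ^ ρ * (y / m) ^ β * m ≤ A ^ (θ + τ) * N ^ (τ * φ) * (x' ^ P * y' ^ P') := by
  have hx : 0 < x := hx'.trans_le hxx
  have hy : 0 < y := hy'.trans_le hyy
  have hA0 : 0 < A := lt_of_lt_of_le (by positivity) hA
  have h1 := Real.log_le_log (by positivity) hA
  have h2 := Real.log_le_log hm hmN
  have h3 := Real.log_le_log he heE
  have h4 := Real.log_le_log hx' hxx
  have h5 := Real.log_le_log hy' hyy
  rw [Real.log_mul (by positivity) (by positivity), Real.log_rpow (by positivity),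
    Real.log_div hy.ne' hm.ne', Real.log_div hx.ne' hm.ne'] at h1
  rw [Real.log_mul hN.ne' he.ne'] at h2
  rw [Real.log_mul (by positivity) (by positivity), Real.log_rpow hx', Real.log_rpow hy'] at h3
  rw [← Real.log_le_log_iff (by positivity) (by positivity), Real.log_mul (by positivity) hm.ne',
    Real.log_mul (by positivity) (by positivity), Real.log_mul (by positivity) (by positivity),
    Real.log_mul (by positivity) (by positivity), Real.log_mul (by positivity) (by positivity),
    Real.log_rpow (by positivity), Real.log_rpow (by positivity), Real.log_rpow (by positivity),
    Real.log_rpow (by positivity), Real.log_rpow (by positivity), Real.log_rpow (by positivity),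
    Real.log_div hy.ne' hm.ne', Real.log_div hx.ne' hm.ne']
  generalize Real.log x = X at *
  generalize Real.log y = Y at *
  generalize Real.log x' = X' at *
  generalize Real.log y' = Y' at *
  generalize Real.log m = M at *
  generalize Real.log e = Z at *
  generalize Real.log N = n at *
  generalize Real.log A = a at *
  have h3' : φ * Z ≤ Y' + (φ - 1) * X' := by
    have := mul_le_mul_of_nonneg_left h3 (by linarith : 0 ≤ φ)
    have e1 : φ * (1 / φ * Y' + (φ - 1) / φ * X') = Y' + (φ - 1) * X' := by field_simp
    rwa [e1] at this
  have h2' : φ * M ≤ φ * n + φ * Z := by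
    rw [← mul_add]; exact mul_le_mul_of_nonneg_left h2 (by linarith)
  have hτ : 0 ≤ τ := hP'.trans hτ₂
  -- The A_φ form of the statement that W and σ do not lose much in passing from Q to E.
  have k1 : (φ - 1) * (X - X') + (Y - Y') ≤ a + φ * n := by linarith
  have k2 := mul_le_mul_of_nonneg_left k1 hτ
  have k3 := mul_le_mul_of_nonneg_right hτ₁ (sub_nonneg.2 h4)
  have k4 := mul_le_mul_of_nonneg_right hτ₂ (sub_nonneg.2 h5)
  have k5 := mul_le_mul_of_nonneg_left h1 hθ
  have hPe : P = 1 - P' := by linarith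
  subst hρ hβ hPe
  linarith

/-- Here z is the essential supremum of 1/W on Q. The A_1 condition is used to the power θ to absorb
z^θ, and to the power P' in the form y/m ≤ A/z ≤ A y'/e. The loss is thus A^(θ+P') = A^β, with no
maximum of two exponents. -/
lemma rpow_mul_rpow_mul_le_A1 {y y' z m e N A β P P' θ : ℝ} (hy : 0 < y) (hy' : 0 < y')
    (hz : 0 < z) (hm : 0 < m) (he : 0 < e) (hN : 0 < N)
    (hA : y / m * z ≤ A) (hmN : m ≤ N * e) (heE : e ≤ y' * z)
    (hβ : β = P' + θ) (hP : P + P' = 1) (hθ : 0 ≤ θ) (hP' : 0 ≤ P') :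
    z ^ θ * (y / m) ^ β * m ≤ A ^ β * N * (e ^ P * y' ^ P') := by
  have hA0 : 0 < A := lt_of_lt_of_le (by positivity) hA
  have h1 := Real.log_le_log (by positivity) hA
  have h2 := Real.log_le_log hm hmN
  have h3 := Real.log_le_log he heE
  rw [Real.log_mul (by positivity) (by positivity), Real.log_div hy.ne' hm.ne'] at h1
  rw [Real.log_mul hN.ne' he.ne'] at h2
  rw [Real.log_mul (by positivity) (by positivity)] at h3
  rw [← Real.log_le_log_iff (by positivity) (by positivity), Real.log_mul (by positivity) hm.ne',
    Real.log_mul (by positivity) (by positivity), Real.log_mul (by positivity) (by positivity),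
    Real.log_mul (by positivity) (by positivity), Real.log_mul (by positivity) (by positivity),
    Real.log_rpow (by positivity), Real.log_rpow (by positivity), Real.log_rpow (by positivity),
    Real.log_rpow (by positivity), Real.log_rpow (by positivity),
    Real.log_div hy.ne' hm.ne']
  generalize Real.log y = Y at *
  generalize Real.log y' = Y' at *
  generalize Real.log z = Z at *
  generalize Real.log m = M at *
  generalize Real.log e = E at *
  generalize Real.log N = n at *
  generalize Real.log A = a at *
  have k1 := mul_le_mul_of_nonneg_left h1 hθ
  have k2 := mul_le_mul_of_nonneg_left h1 hP'
  have k3 := mul_le_mul_of_nonneg_left h3 hP'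
  have hPe : P = 1 - P' := by linarith
  subst hβ hPe
  linarith

lemma exists_pos_eq_ofReal {a : ℝ≥0∞} (h0 : a ≠ 0) (ht : a ≠ ∞) :
    ∃ x : ℝ, 0 < x ∧ a = ENNReal.ofReal x :=
  ⟨a.toReal, ENNReal.toReal_pos h0 ht, (ENNReal.ofReal_toReal ht).symm⟩

end Numeric

section Forms

variable {X : Type*} [MeasurableSpace X] {ι : Type*} {μ : Measure X}

instance [SFinite μ] (u : X → ℝ) : SFinite (wMeasure μ u) := by
  unfold wMeasure; infer_instance

lemma avg_one_weight {W : X → ℝ} (hW : IsWeight W) {Q : Set X} (hQ : MeasurableSet Q) :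
    avg μ 1 W Q = wMeasure μ W Q / μ Q := by
  rw [avg_one_eq, wMeasure_apply hQ]
  simp_rw [Real.enorm_of_nonneg (hW.2 _).le]

lemma avg_inv_weight {W : X → ℝ} (hW : IsWeight W) {q : ℝ} (hq : 0 < q) {Q : Set X}
    (hQ : MeasurableSet Q) :
    avg μ (ENNReal.ofReal q)⁻¹ (fun x => (W x)⁻¹) Q =
      (wMeasure μ (fun x => W x ^ (-(1 / q))) Q / μ Q) ^ q := by
  rw [← ENNReal.ofReal_inv_of_pos hq, avg_ofReal_eq (inv_pos.2 hq), wMeasure_apply hQ, one_div,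
    inv_inv]
  congr 3
  ext x
  rw [Real.enorm_of_nonneg (hW.inv.2 x).le, ENNReal.ofReal_rpow_of_pos (hW.inv.2 x),
    Real.inv_rpow (hW.2 x).le, ← Real.rpow_neg (hW.2 x).le, one_div]

lemma ne_zero_and_ne_top_of_mul_le {a b A : ℝ≥0∞} (hab : a * b ≤ A) (hA : A ≠ ∞)
    (ha : a ≠ 0) (hb : b ≠ 0) : a ≠ ∞ ∧ b ≠ ∞ := by
  have h := ne_top_of_le_ne_top hA hab
  exact ⟨fun h' => h (by simp [h', hb]), fun h' => h (by simp [h', ha])⟩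

end Forms

/-! ### Estimates of weighted measures on a single cube -/

section Cubes

variable {X : Type*} [MeasurableSpace X] {μ : Measure X} {W : X → ℝ} {Q E : Set X}
  {η : ℝ} {A : ℝ≥0∞}

lemma wMeasure_ne_top_of_avg_mul_avg_le (hW : IsWeight W) {φ : ℝ} (hφ : 1 < φ)
    (hQ : MeasurableSet Q) (h0 : μ Q ≠ 0) (ht : μ Q ≠ ∞) (hAt : A ≠ ∞)
    (hA : avg μ 1 W Q * avg μ (ENNReal.ofReal (φ - 1))⁻¹ (fun x => (W x)⁻¹) Q ≤ A) :
    wMeasure μ W Q ≠ ∞ ∧ wMeasure μ (fun x => W x ^ (-(1 / (φ - 1)))) Q ≠ ∞ := by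
  have hφ1 : 0 < φ - 1 := by linarith
  rw [avg_one_weight hW hQ, avg_inv_weight hW hφ1 hQ] at hA
  have z1 : wMeasure μ W Q ≠ 0 := fun h => h0 (absolutelyContinuous_wMeasure hW h)
  have z2 : wMeasure μ (fun x => W x ^ (-(1 / (φ - 1)))) Q ≠ 0 :=
    fun h => h0 (absolutelyContinuous_wMeasure (hW.rpow _) h)
  have z2' : (wMeasure μ (fun x => W x ^ (-(1 / (φ - 1)))) Q / μ Q) ^ (φ - 1) ≠ 0 := by
    rw [Ne, ENNReal.rpow_eq_zero_iff]
    rintro (⟨h, -⟩ | ⟨-, h⟩)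
    · exact ENNReal.div_ne_zero.2 ⟨z2, ht⟩ h
    · linarith
  obtain ⟨h1, h2⟩ := ne_zero_and_ne_top_of_mul_le hA hAt
    (by simp [ENNReal.div_eq_zero_iff, z1, ht]) z2'
  exact ⟨fun h => h1 (by rw [h, ENNReal.top_div_of_ne_top ht]),
    fun h => h2 (by rw [h, ENNReal.top_div_of_ne_top ht, ENNReal.top_rpow_of_pos hφ1])⟩

/-- The work is in reducing to `rpow_mul_rpow_mul_le_Aq`: all measures involved are positive because
weights are, and finite because the product in the A_φ condition is finite and neither of its
factors vanishes. -/
lemma wMeasure_mul_le_Aq (hW : IsWeight W) {φ ρ β P P' θ τ : ℝ} (hφ : 1 < φ)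
    (hQ : MeasurableSet Q) (hE : MeasurableSet E) (hEQ : E ⊆ Q) (h0 : μ Q ≠ 0) (ht : μ Q ≠ ∞)
    (hη : 0 < η) (hQE : μ Q ≤ (ENNReal.ofReal η)⁻¹ * μ E) (hAt : A ≠ ∞)
    (hA : avg μ 1 W Q * avg μ (ENNReal.ofReal (φ - 1))⁻¹ (fun x => (W x)⁻¹) Q ≤ A)
    (hρ : ρ = P + θ * (φ - 1)) (hβ : β = P' + θ) (hP : P + P' = 1) (hθ : 0 ≤ θ)
    (hτ₁ : P ≤ τ * (φ - 1)) (hτ₂ : P' ≤ τ) (hP' : 0 ≤ P') :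
    (wMeasure μ (fun x => W x ^ (-(1 / (φ - 1)))) Q / μ Q) ^ ρ * (wMeasure μ W Q / μ Q) ^ β * μ Q ≤
      A ^ (θ + τ) * ENNReal.ofReal (η⁻¹ ^ (τ * φ)) *
        (wMeasure μ (fun x => W x ^ (-(1 / (φ - 1)))) E ^ P * wMeasure μ W E ^ P') := by
  have hφ1 : 0 < φ - 1 := by linarith
  obtain ⟨t2, t1⟩ := wMeasure_ne_top_of_avg_mul_avg_le hW hφ hQ h0 ht hAt hA
  have hE0 : μ E ≠ 0 := fun h => h0 (by simpa [h] using hQE)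
  have hEt : μ E ≠ ∞ := ne_top_of_le_ne_top ht (measure_mono hEQ)
  have hh := measure_le_wMeasure_mul (μ := μ) hW hφ hE
  rw [avg_one_weight hW hQ, avg_inv_weight hW hφ1 hQ] at hA
  set σ := wMeasure μ (fun x => W x ^ (-(1 / (φ - 1)))) with hσ
  set ω := wMeasure μ W with hω
  have zσ : ∀ S, μ S ≠ 0 → σ S ≠ 0 :=
    fun S hS h => hS (absolutelyContinuous_wMeasure (hW.rpow _) h)
  have zω : ∀ S, μ S ≠ 0 → ω S ≠ 0 := fun S hS h => hS (absolutelyContinuous_wMeasure hW h)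
  have lσ : σ E ≤ σ Q := measure_mono hEQ
  have lω : ω E ≤ ω Q := measure_mono hEQ
  obtain ⟨x, hx, ex⟩ := exists_pos_eq_ofReal (zσ Q h0) t1
  obtain ⟨y, hy, ey⟩ := exists_pos_eq_ofReal (zω Q h0) t2
  obtain ⟨x', hx', ex'⟩ := exists_pos_eq_ofReal (zσ E hE0) (ne_top_of_le_ne_top t1 lσ)
  obtain ⟨y', hy', ey'⟩ := exists_pos_eq_ofReal (zω E hE0) (ne_top_of_le_ne_top t2 lω)
  obtain ⟨m, hm, em⟩ := exists_pos_eq_ofReal h0 ht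
  obtain ⟨e, he, ee⟩ := exists_pos_eq_ofReal hE0 hEt
  have hA0 : A ≠ 0 := by
    intro h
    rw [h, ex, ey, em, ← ENNReal.ofReal_div_of_pos hm, ← ENNReal.ofReal_div_of_pos hm,
      ENNReal.ofReal_rpow_of_pos (by positivity), ← ENNReal.ofReal_mul (by positivity),
      nonpos_iff_eq_zero, ENNReal.ofReal_eq_zero] at hA
    have : 0 < y / m * (x / m) ^ (φ - 1) := by positivity
    linarith
  obtain ⟨a, ha, ea⟩ := exists_pos_eq_ofReal hA0 hAt
  rw [ex, ey, em, ea, ← ENNReal.ofReal_div_of_pos hm, ← ENNReal.ofReal_div_of_pos hm,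
    ENNReal.ofReal_rpow_of_pos (by positivity), ← ENNReal.ofReal_mul (by positivity),
    ENNReal.ofReal_le_ofReal_iff ha.le] at hA
  rw [em, ee, ← ENNReal.ofReal_inv_of_pos hη, ← ENNReal.ofReal_mul (by positivity),
    ENNReal.ofReal_le_ofReal_iff (by positivity)] at hQE
  rw [ee, ex', ey', ENNReal.ofReal_rpow_of_pos hx', ENNReal.ofReal_rpow_of_pos hy',
    ← ENNReal.ofReal_mul (by positivity), ENNReal.ofReal_le_ofReal_iff (by positivity)] at hh
  rw [ex, ex', ENNReal.ofReal_le_ofReal_iff hx.le] at lσ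
  rw [ey, ey', ENNReal.ofReal_le_ofReal_iff hy.le] at lω
  rw [ex, ey, ex', ey', em, ea, ← ENNReal.ofReal_div_of_pos hm, ← ENNReal.ofReal_div_of_pos hm,
    ENNReal.ofReal_rpow_of_pos (by positivity), ENNReal.ofReal_rpow_of_pos (by positivity),
    ENNReal.ofReal_rpow_of_pos (by positivity), ENNReal.ofReal_rpow_of_pos (by positivity),
    ENNReal.ofReal_rpow_of_pos (by positivity), ← ENNReal.ofReal_mul (by positivity),
    ← ENNReal.ofReal_mul (by positivity), ← ENNReal.ofReal_mul (by positivity),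
    ← ENNReal.ofReal_mul (by positivity), ← ENNReal.ofReal_mul (by positivity)]
  exact ENNReal.ofReal_le_ofReal (rpow_mul_rpow_mul_le_Aq hx' hy' hm he (inv_pos.2 hη) lσ lω hA
    hQE hh hφ hρ hβ hP hθ hτ₁ hτ₂ hP')

lemma avg_top_eq {F : Type*} [NormedAddCommGroup F] (f : X → F) (ht : μ Q ≠ ∞) :
    avg μ ∞ f Q = eLpNormEssSup f (μ.restrict Q) := by
  rw [avg, eLpNorm_exponent_top, eLpNormEssSup, eLpNormEssSup, essSup, essSup,
    Measure.ae_ennreal_smul_measure_eq (by simpa using ht)]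

/-- The properties of a weight that satisfies the `A_1` condition on a set. -/
lemma avg_top_inv_properties (hW : IsWeight W)
    (hQ : MeasurableSet Q) (h0 : μ Q ≠ 0) (ht : μ Q ≠ ∞) (hAt : A ≠ ∞)
    (hA : avg μ 1 W Q * avg μ ∞ (fun x => (W x)⁻¹) Q ≤ A) :
    wMeasure μ W Q ≠ ∞ ∧ avg μ ∞ (fun x => (W x)⁻¹) Q ≠ 0 ∧
      avg μ ∞ (fun x => (W x)⁻¹) Q ≠ ∞ ∧
      ∀ᵐ x ∂μ.restrict Q, ENNReal.ofReal (W x)⁻¹ ≤ avg μ ∞ (fun x => (W x)⁻¹) Q := by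
  have hone := one_le_avg_mul_avg_inv (μ := μ) hW le_rfl h0 ht
  rw [sub_self, ENNReal.ofReal_zero, ENNReal.inv_zero] at hone
  have hne : avg μ ∞ (fun x => (W x)⁻¹) Q ≠ 0 := by
    intro h
    simp [h] at hone
  have z1 : wMeasure μ W Q ≠ 0 := fun h => h0 (absolutelyContinuous_wMeasure hW h)
  rw [avg_one_weight hW hQ] at hA
  obtain ⟨h1, h2⟩ := ne_zero_and_ne_top_of_mul_le hA hAt
    (by simp [ENNReal.div_eq_zero_iff, z1, ht]) hne
  refine ⟨fun h => h1 (by rw [h, ENNReal.top_div_of_ne_top ht]), hne, h2, ?_⟩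
  have hae := enorm_ae_le_eLpNormEssSup (fun x => (W x)⁻¹) (μ.restrict Q)
  rw [← avg_top_eq _ ht] at hae
  filter_upwards [hae] with x hx
  rwa [Real.enorm_of_nonneg (hW.inv.2 x).le] at hx

lemma measure_le_wMeasure_mul_avg_top (hW : IsWeight W) (hE : MeasurableSet E) (hEQ : E ⊆ Q)
    {Z : ℝ≥0∞} (hZ : ∀ᵐ x ∂μ.restrict Q, ENNReal.ofReal (W x)⁻¹ ≤ Z) :
    μ E ≤ wMeasure μ W E * Z := by
  calc μ E = ∫⁻ _ in E, 1 ∂μ := by simp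
    _ ≤ ∫⁻ x in E, ENNReal.ofReal (W x) * Z ∂μ := by
        refine lintegral_mono_ae ((ae_restrict_of_ae_restrict_of_subset hEQ hZ).mono fun x hx => ?_)
        calc (1 : ℝ≥0∞) = ENNReal.ofReal (W x) * ENNReal.ofReal (W x)⁻¹ := by
              rw [← ENNReal.ofReal_mul (hW.2 x).le, mul_inv_cancel₀ (hW.2 x).ne',
                ENNReal.ofReal_one]
          _ ≤ _ := by gcongr
    _ = _ := by rw [lintegral_mul_const _ hW.1.ennreal_ofReal, wMeasure_apply hE]

/-- The analogue for A_1, reduced to `rpow_mul_rpow_mul_le_A1`. The input on E is |E| ≤ W(E) ·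
esssup_Q W⁻¹. -/
lemma wMeasure_mul_le_A1 (hW : IsWeight W) {β P P' θ : ℝ}
    (hQ : MeasurableSet Q) (hE : MeasurableSet E) (hEQ : E ⊆ Q) (h0 : μ Q ≠ 0) (ht : μ Q ≠ ∞)
    (hη : 0 < η) (hQE : μ Q ≤ (ENNReal.ofReal η)⁻¹ * μ E) (hAt : A ≠ ∞)
    (hA : avg μ 1 W Q * avg μ ∞ (fun x => (W x)⁻¹) Q ≤ A)
    (hβ : β = P' + θ) (hP : P + P' = 1) (hθ : 0 ≤ θ) (hP' : 0 ≤ P') :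
    avg μ ∞ (fun x => (W x)⁻¹) Q ^ θ * (wMeasure μ W Q / μ Q) ^ β * μ Q ≤
      A ^ β * ENNReal.ofReal η⁻¹ * (μ E ^ P * wMeasure μ W E ^ P') := by
  obtain ⟨t2, z0, zt, hZ⟩ := avg_top_inv_properties hW hQ h0 ht hAt hA
  have hh := measure_le_wMeasure_mul_avg_top hW hE hEQ hZ
  have hE0 : μ E ≠ 0 := fun h => h0 (by simpa [h] using hQE)
  have hEt : μ E ≠ ∞ := ne_top_of_le_ne_top ht (measure_mono hEQ)
  rw [avg_one_weight hW hQ] at hA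
  set ω := wMeasure μ W with hω
  have zω : ∀ S, μ S ≠ 0 → ω S ≠ 0 := fun S hS h => hS (absolutelyContinuous_wMeasure hW h)
  have lω : ω E ≤ ω Q := measure_mono hEQ
  obtain ⟨z, hz, ez⟩ := exists_pos_eq_ofReal z0 zt
  obtain ⟨y, hy, ey⟩ := exists_pos_eq_ofReal (zω Q h0) t2
  obtain ⟨y', hy', ey'⟩ := exists_pos_eq_ofReal (zω E hE0) (ne_top_of_le_ne_top t2 lω)
  obtain ⟨m, hm, em⟩ := exists_pos_eq_ofReal h0 ht
  obtain ⟨e, he, ee⟩ := exists_pos_eq_ofReal hE0 hEt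
  have hA0 : A ≠ 0 := by
    intro h
    rw [h, ez, ey, em, ← ENNReal.ofReal_div_of_pos hm, ← ENNReal.ofReal_mul (by positivity),
      nonpos_iff_eq_zero, ENNReal.ofReal_eq_zero] at hA
    have : 0 < y / m * z := by positivity
    linarith
  obtain ⟨a, ha, ea⟩ := exists_pos_eq_ofReal hA0 hAt
  rw [ez, ey, em, ea, ← ENNReal.ofReal_div_of_pos hm,
    ← ENNReal.ofReal_mul (by positivity), ENNReal.ofReal_le_ofReal_iff ha.le] at hA
  rw [em, ee, ← ENNReal.ofReal_inv_of_pos hη, ← ENNReal.ofReal_mul (by positivity),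
    ENNReal.ofReal_le_ofReal_iff (by positivity)] at hQE
  rw [ee, ez, ey', ← ENNReal.ofReal_mul (by positivity),
    ENNReal.ofReal_le_ofReal_iff (by positivity)] at hh
  rw [ez, ey, ee, ey', em, ea, ← ENNReal.ofReal_div_of_pos hm,
    ENNReal.ofReal_rpow_of_pos (by positivity), ENNReal.ofReal_rpow_of_pos (by positivity),
    ENNReal.ofReal_rpow_of_pos (by positivity), ENNReal.ofReal_rpow_of_pos (by positivity),
    ENNReal.ofReal_rpow_of_pos (by positivity), ← ENNReal.ofReal_mul (by positivity),
    ← ENNReal.ofReal_mul (by positivity), ← ENNReal.ofReal_mul (by positivity),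
    ← ENNReal.ofReal_mul (by positivity), ← ENNReal.ofReal_mul (by positivity)]
  exact ENNReal.ofReal_le_ofReal (rpow_mul_rpow_mul_le_A1 hy hy' hz hm he (inv_pos.2 hη) hA
    hQE hh hβ hP hθ hP')

end Cubes

/-! ### Weighted bounds for sparse forms -/

section SparseForms

variable {X : Type*} [MeasurableSpace X] {ι : Type*} {μ : Measure X} {𝒟 : ι → Set (Set X)}
  {F : Type*} [NormedAddCommGroup F]

/-- The sparse form `∑_{Q ∈ 𝒮} ⟨f⟩_{p,Q} ⟨g⟩_{q,Q} |Q|`. -/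
def sparseForm (μ : Measure X) (p q : ℝ≥0∞) (f g : X → F) (𝒮 : Set (Set X)) : ℝ≥0∞ :=
  ∑' Q : 𝒮, avg μ p f Q * avg μ q g Q * μ Q

/-- The sets E_Q are disjoint only within one grid, so the form is estimated grid by grid. A cube
that belongs to several grids is counted in each, which is harmless for an upper bound. -/
lemma sparseForm_le_card_mul [Finite ι] {η : ℝ} {𝒮 : Set (Set X)} (h𝒮 : IsSparse μ 𝒟 η 𝒮)
    (p q : ℝ≥0∞) (f g : X → F) (B : ℝ≥0∞)
    (hB : ∀ a, ∀ E : Set X → Set X, (𝒮 ∩ 𝒟 a).PairwiseDisjoint E →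
      (∀ Q ∈ 𝒮 ∩ 𝒟 a, MeasurableSet (E Q) ∧ E Q ⊆ Q ∧ μ Q ≤ (ENNReal.ofReal η)⁻¹ * μ (E Q)) →
      sparseForm μ p q f g (𝒮 ∩ 𝒟 a) ≤ B) :
    sparseForm μ p q f g 𝒮 ≤ Nat.card ι * B := by
  have := Fintype.ofFinite ι
  have hsub : 𝒮 ⊆ ⋃ a, 𝒮 ∩ 𝒟 a := by
    rw [← Set.inter_iUnion]
    exact Set.subset_inter le_rfl h𝒮.1
  calc sparseForm μ p q f g 𝒮
      ≤ ∑' Q : ⋃ a, 𝒮 ∩ 𝒟 a, avg μ p f Q * avg μ q g Q * μ Q :=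
        ENNReal.tsum_mono_subtype (fun Q => avg μ p f Q * avg μ q g Q * μ Q) hsub
    _ ≤ ∑ a, sparseForm μ p q f g (𝒮 ∩ 𝒟 a) :=
        ENNReal.tsum_iUnion_le (fun Q => avg μ p f Q * avg μ q g Q * μ Q) fun a => 𝒮 ∩ 𝒟 a
    _ ≤ ∑ _a : ι, B := Finset.sum_le_sum fun a _ => by
        obtain ⟨E, hE, hE'⟩ := h𝒮.2 a
        exact hB a E hE hE'
    _ = _ := by simp [Nat.card_eq_fintype_card]

/-- The relations between the exponents of a sparse form `⟨f⟩_{r,Q} ⟨g⟩_{b,Q}` and of the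
weighted spaces on which it is estimated. -/
structure IsExponents (r b s p p' : ℝ) : Prop where
  one_le_r : 1 ≤ r
  r_lt : r < p
  one_le_b : 1 ≤ b
  one_le_s : 1 ≤ s
  conj : p.HolderConjugate p'
  inv_b : 1 / b = 1 / p' + 1 / (s * p)

namespace IsExponents

variable {r b s p p' : ℝ}

lemma r_pos (h : IsExponents r b s p p') : 0 < r := by linarith [h.one_le_r]

lemma b_pos (h : IsExponents r b s p p') : 0 < b := by linarith [h.one_le_b]

lemma s_pos (h : IsExponents r b s p p') : 0 < s := by linarith [h.one_le_s]

lemma p_pos (h : IsExponents r b s p p') : 0 < p := h.conj.pos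

lemma p'_pos (h : IsExponents r b s p p') : 0 < p' := h.conj.symm.pos

lemma b_lt (h : IsExponents r b s p p') : b < p' := by
  have := h.p'_pos
  have := h.b_pos
  have hs : 0 < 1 / (s * p) := one_div_pos.2 (mul_pos h.s_pos h.p_pos)
  rw [← one_div_lt_one_div h.p'_pos h.b_pos]
  linarith [h.inv_b]

/-- This identity is what turns the W-norm of the function maximized on the g-side into the norm
with the dual weight w^(1-p'). -/
lemma one_sub_div (h : IsExponents r b s p p') : s * (1 - p' / b) = 1 - p' := by
  have h1 := h.inv_b
  have h2 := h.conj.inv_add_inv_eq_one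
  have hp := h.p_pos
  have hp' := h.p'_pos
  have hs := h.s_pos
  have e1 : p' / b = p' * (1 / b) := by ring
  have e2 : (1 : ℝ) - p' = -(p' / p) := by
    have : p' / p = p' * (1 - p'⁻¹) := by rw [← h2]; ring
    rw [this, mul_sub, mul_inv_cancel₀ hp'.ne']
    ring
  rw [e1, h1, e2]
  field_simp
  ring

lemma lintegral_second (h : IsExponents r b s p p') {w : X → ℝ} (hw : IsWeight w) (g : X → F) :
    (∫⁻ x, (‖g x‖ₑ ^ b * ENNReal.ofReal (w x ^ s)⁻¹) ^ (p' / b) ∂wMeasure μ fun x => w x ^ s) =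
      ∫⁻ x, ‖g x‖ₑ ^ p' ∂wMeasure μ fun x => w x ^ (1 - p') := by
  rw [lintegral_rpow_wMeasure (hw.rpow s) g (div_nonneg h.p'_pos.le h.b_pos.le),
    mul_div_cancel₀ _ h.b_pos.ne']
  congr 2
  ext x
  rw [← Real.rpow_mul (hw.2 x).le, h.one_sub_div]

end IsExponents

lemma aemeasurable_enorm_rpow_mul {f : X → F} (hf : AEStronglyMeasurable f μ) (r : ℝ)
    {v : X → ℝ} (hv : Measurable v) :
    AEMeasurable (fun x => ‖f x‖ₑ ^ r * ENNReal.ofReal (v x)) μ :=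
  (hf.enorm.pow_const r).mul hv.ennreal_ofReal.aemeasurable

variable {r b s p p' : ℝ}

lemma mul_Lp_mul_Lq (a b c d K A : ℝ≥0∞) (hp : 0 ≤ p) (hp' : 0 ≤ p') :
    K * A * ((a * b) ^ (1 / p) * (c * d) ^ (1 / p')) =
      (A * (a ^ (1 / p) * c ^ (1 / p'))) * K * (b ^ (1 / p) * d ^ (1 / p')) := by
  rw [ENNReal.mul_rpow_of_nonneg _ _ (by positivity), ENNReal.mul_rpow_of_nonneg _ _ (by positivity)]
  ring

/-- The sharp estimate of sparse forms for weights in `A_{p/r} ∩ RH_s`. -/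
theorem exists_sparseForm_le_Aq [Finite ι] [SFinite μ] (h𝒟 : IsGridSystem μ 𝒟)
    (h : IsExponents r b s p p') {η : ℝ} (hη : 0 < η) :
    ∃ C : ℝ≥0, ∀ w : X → ℝ, IsWeight w →
      apConst μ 𝒟 (s * (p / r - 1) + 1) (fun x => w x ^ s) ≠ ∞ →
      ∀ f g : X → F, AEStronglyMeasurable f μ → AEStronglyMeasurable g μ →
      ∀ 𝒮, IsSparse μ 𝒟 η 𝒮 →
        sparseForm μ (ENNReal.ofReal r) (ENNReal.ofReal b) f g 𝒮 ≤
          C * apConst μ 𝒟 (s * (p / r - 1) + 1) (fun x => w x ^ s) ^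
            (1 / (s * p) + max (1 / (p * (s * (p / r - 1)))) (1 / p')) *
          (eLpNorm f (ENNReal.ofReal p) (wMeasure μ w) *
            eLpNorm g (ENNReal.ofReal p') (wMeasure μ fun x => w x ^ (1 - p'))) := by
  have hr := h.r_pos
  have hb := h.b_pos
  have hs := h.s_pos
  have hp := h.p_pos
  have hp' := h.p'_pos
  have hpr : 0 < p / r - 1 := by
    rw [sub_pos, one_lt_div hr]; exact h.r_lt
  set φ := s * (p / r - 1) + 1 with hφ
  have hφ1 : φ - 1 = s * (p / r - 1) := by rw [hφ]; ring
  have hφ0 : 0 < φ - 1 := by rw [hφ1]; positivity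
  set θ := 1 / (s * p) with hθ
  rw [← hφ1]
  -- The least τ with 1/p ≤ τ(φ-1) and 1/p' ≤ τ, as the passage from Q to E_Q requires. The two
  -- cases are the source of the maximum in the theorem.
  set τ := max (1 / (p * (φ - 1))) (1 / p') with hτ
  set c : ℝ≥0∞ := Nat.card ι * (ENNReal.ofReal (η⁻¹ ^ (τ * φ)) *
    (maxConst (p / r) ^ (1 / p) * maxConst (p' / b) ^ (1 / p'))) with hc
  have hct : c ≠ ∞ := by
    have h1 : maxConst (p / r) ≠ ∞ := ENNReal.ofReal_ne_top
    have h2 : maxConst (p' / b) ≠ ∞ := ENNReal.ofReal_ne_top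
    finiteness
  refine ⟨c.toNNReal, fun w hw hAt f g hf hg 𝒮 h𝒮 => ?_⟩
  rw [ENNReal.coe_toNNReal hct, hc, mul_assoc, mul_assoc]
  set A := apConst μ 𝒟 φ fun x => w x ^ s with hA
  refine sparseForm_le_card_mul h𝒮 _ _ f g _ fun a E hE hE' => ?_
  have hW : IsWeight fun x => w x ^ s := hw.rpow s
  have hσ : IsWeight fun x => (w x ^ s) ^ (-(1 / (φ - 1))) := hW.rpow _
  have hAQ : ∀ Q ∈ 𝒟 a, _ := fun Q hQ => le_apConst (μ := μ) hQ φ fun x => w x ^ s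
  have hfin : ∀ Q ∈ 𝒟 a, _ := fun Q hQ => wMeasure_ne_top_of_avg_mul_avg_le (μ := μ) hW
    (by linarith) ((h𝒟.nestedFamily a).measurable Q hQ) (h𝒟.pos a Q hQ).ne' (h𝒟.finite a Q hQ).ne
    hAt (hAQ Q hQ)
  have key := tsum_mul_mul_le ((h𝒟.nestedFamily a).mono Set.inter_subset_right) hE
    (fun Q hQ => (hE' Q hQ).1) (fun Q hQ => (hE' Q hQ).2.1)
    (ν₁ := wMeasure μ fun x => (w x ^ s) ^ (-(1 / (φ - 1)))) (ν₂ := wMeasure μ fun x => w x ^ s)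
    ((aemeasurable_enorm_rpow_mul hf r hσ.inv.1).mono_ac (wMeasure_absolutelyContinuous _))
    ((aemeasurable_enorm_rpow_mul hg b hW.inv.1).mono_ac (wMeasure_absolutelyContinuous _))
    hr h.r_lt hb h.b_lt h.conj
    (fun Q => avg μ (ENNReal.ofReal r) f Q) (fun Q => avg μ (ENNReal.ofReal b) g Q) (fun Q => μ Q)
    _ _ (A ^ (θ + τ) * ENNReal.ofReal (η⁻¹ ^ (τ * φ)))
    (fun Q hQ => (avg_eq_wMeasure hσ hr f ((h𝒟.nestedFamily a).measurable Q hQ.2)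
      (h𝒟.pos a Q hQ.2).ne' (hfin Q hQ.2).2).le)
    (fun Q hQ => (avg_eq_wMeasure hW hb g ((h𝒟.nestedFamily a).measurable Q hQ.2)
      (h𝒟.pos a Q hQ.2).ne' (hfin Q hQ.2).1).le)
    (fun Q hQ => wMeasure_mul_le_Aq hW (by linarith) ((h𝒟.nestedFamily a).measurable Q hQ.2)
      (hE' Q hQ).1 (hE' Q hQ).2.1 (h𝒟.pos a Q hQ.2).ne' (h𝒟.finite a Q hQ.2).ne hη (hE' Q hQ).2.2
      hAt (hAQ Q hQ.2) (θ := θ) (τ := τ)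
      (by rw [hφ1, hθ]; field_simp; ring) h.inv_b
      (by simpa using h.conj.inv_add_inv_eq_one) (by positivity)
      (by
        calc 1 / p = 1 / (p * (φ - 1)) * (φ - 1) := by field_simp
          _ ≤ τ * (φ - 1) := by gcongr; exact le_max_left _ _)
      (le_max_right _ _) (by positivity))
  refine key.trans (le_of_eq ?_)
  rw [mul_Lp_mul_Lq _ _ _ _ _ _ hp.le hp'.le, h.lintegral_second hw,
    lintegral_rpow_wMeasure hσ f (by positivity), mul_div_cancel₀ _ hr.ne',
    eLpNorm_ofReal_eq hp, eLpNorm_ofReal_eq hp', mul_assoc]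
  -- The choice of φ makes σ^(1-p/r) equal to w, so the f-side gives the norm of L^p(w).
  have : (fun x => ((w x ^ s) ^ (-(1 / (φ - 1)))) ^ (1 - p / r)) = w := by
    ext x
    rw [← Real.rpow_mul (hw.2 x).le, ← Real.rpow_mul (hw.2 x).le, hφ1]
    have : s * -(1 / (s * (p / r - 1))) * (1 - p / r) = 1 := by
      rw [← neg_sub (p / r)]
      generalize p / r - 1 = k at hpr
      field_simp
    rw [this, Real.rpow_one]
  rw [this]

/-- Since w^(-s) ≤ Z on Q, one can insert 1 ≤ Z^(r/(sp)) w^(r/p) under the integral. This moves the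
weight onto f, so that no dual measure σ is needed on the f-side. -/
lemma avg_le_avg_top_rpow_mul {w : X → ℝ} (hw : IsWeight w) (h : IsExponents r b s p p')
    (f : X → F) {Q : Set X}
    {Z : ℝ≥0∞} (hZt : Z ≠ ∞) (hZ : ∀ᵐ x ∂μ.restrict Q, ENNReal.ofReal (w x ^ s)⁻¹ ≤ Z) :
    avg μ (ENNReal.ofReal r) f Q ≤ Z ^ (1 / (s * p)) *
      ((∫⁻ x in Q, ‖f x‖ₑ ^ r * ENNReal.ofReal (w x ^ (r / p)) ∂μ) / μ Q) ^ (1 / r) := by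
  have hr := h.r_pos
  have hs := h.s_pos
  have hp := h.p_pos
  have e : Z ^ (1 / (s * p)) = (Z ^ (r / (s * p))) ^ (1 / r) := by
    rw [← ENNReal.rpow_mul]
    congr 1
    field_simp
  have hrsp : 0 ≤ r / (s * p) := by positivity
  rw [avg_ofReal_eq hr, e, ← ENNReal.mul_rpow_of_nonneg _ _ (by positivity), ← mul_div_assoc,
    ← lintegral_const_mul' _ _ (by finiteness)]
  gcongr ?_ ^ (1 / r)
  gcongr ?_ / _
  refine lintegral_mono_ae (hZ.mono fun x hx => ?_)
  have h1 : (1 : ℝ≥0∞) ≤ Z ^ (r / (s * p)) * ENNReal.ofReal (w x ^ (r / p)) := by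
    calc (1 : ℝ≥0∞) = ENNReal.ofReal (w x ^ s)⁻¹ ^ (r / (s * p)) * ENNReal.ofReal (w x ^ (r / p)) := by
          rw [ENNReal.ofReal_rpow_of_pos ((hw.rpow s).inv.2 x),
            ← ENNReal.ofReal_mul (Real.rpow_nonneg ((hw.rpow s).inv.2 x).le _),
            Real.inv_rpow ((hw.rpow s).2 x).le, ← Real.rpow_mul (hw.2 x).le]
          have : s * (r / (s * p)) = r / p := by field_simp
          rw [this, inv_mul_cancel₀ ((hw.rpow _).2 x).ne', ENNReal.ofReal_one]
      _ ≤ _ := by gcongr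
  calc ‖f x‖ₑ ^ r = ‖f x‖ₑ ^ r * 1 := (mul_one _).symm
    _ ≤ ‖f x‖ₑ ^ r * (Z ^ (r / (s * p)) * ENNReal.ofReal (w x ^ (r / p))) := by gcongr
    _ = _ := by ring

/-- The sharp estimate of sparse forms for weights in `A_1 ∩ RH_s`. -/
theorem exists_sparseForm_le_A1 [Finite ι] [SFinite μ] (h𝒟 : IsGridSystem μ 𝒟)
    (h : IsExponents r b s p p') {η : ℝ} (hη : 0 < η) :
    ∃ C : ℝ≥0, ∀ w : X → ℝ, IsWeight w →
      apConst μ 𝒟 1 (fun x => w x ^ s) ≠ ∞ →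
      ∀ f g : X → F, AEStronglyMeasurable f μ → AEStronglyMeasurable g μ →
      ∀ 𝒮, IsSparse μ 𝒟 η 𝒮 →
        sparseForm μ (ENNReal.ofReal r) (ENNReal.ofReal b) f g 𝒮 ≤
          C * apConst μ 𝒟 1 (fun x => w x ^ s) ^ (1 / b) *
          (eLpNorm f (ENNReal.ofReal p) (wMeasure μ w) *
            eLpNorm g (ENNReal.ofReal p') (wMeasure μ fun x => w x ^ (1 - p'))) := by
  have hr := h.r_pos
  have hb := h.b_pos
  have hs := h.s_pos
  have hp := h.p_pos
  have hp' := h.p'_pos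
  set c : ℝ≥0∞ := Nat.card ι * (ENNReal.ofReal η⁻¹ *
    (maxConst (p / r) ^ (1 / p) * maxConst (p' / b) ^ (1 / p'))) with hc
  have hct : c ≠ ∞ := by
    have h1 : maxConst (p / r) ≠ ∞ := ENNReal.ofReal_ne_top
    have h2 : maxConst (p' / b) ≠ ∞ := ENNReal.ofReal_ne_top
    finiteness
  refine ⟨c.toNNReal, fun w hw hAt f g hf hg 𝒮 h𝒮 => ?_⟩
  rw [ENNReal.coe_toNNReal hct, hc, mul_assoc, mul_assoc]
  set A := apConst μ 𝒟 1 fun x => w x ^ s with hA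
  refine sparseForm_le_card_mul h𝒮 _ _ f g _ fun a E hE hE' => ?_
  have hW : IsWeight fun x => w x ^ s := hw.rpow s
  have hAQ : ∀ Q ∈ 𝒟 a, avg μ 1 (fun x => w x ^ s) Q * avg μ ∞ (fun x => (w x ^ s)⁻¹) Q ≤ A := by
    intro Q hQ
    simpa using le_apConst (μ := μ) hQ 1 fun x => w x ^ s
  have hfin : ∀ Q ∈ 𝒟 a, _ := fun Q hQ => avg_top_inv_properties (μ := μ) hW
    ((h𝒟.nestedFamily a).measurable Q hQ) (h𝒟.pos a Q hQ).ne' (h𝒟.finite a Q hQ).ne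
    hAt (hAQ Q hQ)
  have key := tsum_mul_mul_le ((h𝒟.nestedFamily a).mono Set.inter_subset_right) hE
    (fun Q hQ => (hE' Q hQ).1) (fun Q hQ => (hE' Q hQ).2.1)
    -- The maximal theorem is applied to |f|^r w^(r/p) with respect to μ itself.
    (ν₁ := μ) (ν₂ := wMeasure μ fun x => w x ^ s)
    (aemeasurable_enorm_rpow_mul hf r (hw.rpow (r / p)).1)
    ((aemeasurable_enorm_rpow_mul hg b hW.inv.1).mono_ac (wMeasure_absolutelyContinuous _))
    hr h.r_lt hb h.b_lt h.conj
    (fun Q => avg μ (ENNReal.ofReal r) f Q) (fun Q => avg μ (ENNReal.ofReal b) g Q) (fun Q => μ Q)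
    (fun Q => avg μ ∞ (fun x => (w x ^ s)⁻¹) Q ^ (1 / (s * p)))
    (fun Q => (wMeasure μ (fun x => w x ^ s) Q / μ Q) ^ (1 / b))
    (A ^ (1 / b) * ENNReal.ofReal η⁻¹)
    (fun Q hQ => avg_le_avg_top_rpow_mul hw h f (hfin Q hQ.2).2.2.1
      (hfin Q hQ.2).2.2.2)
    (fun Q hQ => (avg_eq_wMeasure hW hb g ((h𝒟.nestedFamily a).measurable Q hQ.2)
      (h𝒟.pos a Q hQ.2).ne' (hfin Q hQ.2).1).le)
    (fun Q hQ => wMeasure_mul_le_A1 hW ((h𝒟.nestedFamily a).measurable Q hQ.2)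
      (hE' Q hQ).1 (hE' Q hQ).2.1 (h𝒟.pos a Q hQ.2).ne' (h𝒟.finite a Q hQ.2).ne hη (hE' Q hQ).2.2
      hAt (hAQ Q hQ.2) h.inv_b
      (by simpa using h.conj.inv_add_inv_eq_one) (by positivity) (by positivity))
  refine key.trans (le_of_eq ?_)
  have : ∫⁻ x, (‖f x‖ₑ ^ r * ENNReal.ofReal (w x ^ (r / p))) ^ (p / r) ∂μ =
      ∫⁻ x, ‖f x‖ₑ ^ p ∂wMeasure μ w := by
    rw [lintegral_wMeasure hw.1]
    refine lintegral_congr fun x => ?_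
    rw [ENNReal.mul_rpow_of_nonneg _ _ (by positivity), ← ENNReal.rpow_mul,
      mul_div_cancel₀ _ hr.ne', ENNReal.ofReal_rpow_of_pos ((hw.rpow _).2 x),
      ← Real.rpow_mul (hw.2 x).le, div_mul_div_cancel₀ hp.ne', div_self hr.ne', Real.rpow_one,
      mul_comm]
  rw [mul_Lp_mul_Lq _ _ _ _ _ _ hp.le hp'.le, h.lintegral_second hw, this,
    eLpNorm_ofReal_eq hp, eLpNorm_ofReal_eq hp', mul_assoc]

end SparseForms

/-! ### Duality -/

section Duality

variable {X : Type*} [MeasurableSpace X] {μ : Measure X} {𝕜 : Type*} [RCLike 𝕜]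

lemma le_of_le_mul_rpow {I K : ℝ≥0∞} (hI : I ≠ ∞) {p p' : ℝ} (hpp : p.HolderConjugate p')
    (h : I ≤ K * I ^ (1 / p')) : I ^ (1 / p) ≤ K := by
  by_cases h0 : I = 0
  · simp [h0, hpp.pos]
  have e : I = I ^ (1 / p) * I ^ (1 / p') := by
    rw [← ENNReal.rpow_add _ _ h0 hI]
    have := hpp.inv_add_inv_eq_one
    simp [this]
  have h1 : I ^ (1 / p') ≠ 0 := by simp [ENNReal.rpow_eq_zero_iff, h0, hI]
  have h2 : I ^ (1 / p') ≠ ∞ := ENNReal.rpow_ne_top_of_nonneg hpp.symm.one_div_nonneg hI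
  rw [← ENNReal.mul_le_mul_iff_left h1 h2]
  rwa [← e]

/-- The extremal dual function w |F|^(p-2) F̄ is cut off to sets of finite measure on which F and w
are bounded. The cut-offs lie in every L^t(μ), so no relation between t and p or w is needed, and
they make the integral finite, so that a power of it can be cancelled. The cut-offs then exhaust the
space. -/
lemma eLpNorm_le_of_forall_integral_le_of_stronglyMeasurable [SigmaFinite μ] {F : X → 𝕜}
    (hF : StronglyMeasurable F) {w : X → ℝ} (hw : IsWeight w) {p p' t : ℝ}
    (hpp : p.HolderConjugate p') {K : ℝ≥0∞}
    (hK : ∀ g : X → 𝕜, MemLp g (ENNReal.ofReal t) μ → ‖∫ x, F x * g x ∂μ‖ₑ ≤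
      K * eLpNorm g (ENNReal.ofReal p') (wMeasure μ fun x => w x ^ (1 - p'))) :
    eLpNorm F (ENNReal.ofReal p) (wMeasure μ w) ≤ K := by
  have hp := hpp.pos
  have hp' := hpp.symm.pos
  have hp1 := hpp.lt
  set S : ℕ → Set X := fun N =>
    spanningSets μ N ∩ ({x | ‖F x‖ ≤ N} ∩ {x | w x ≤ N}) with hS
  have hSm : ∀ N, MeasurableSet (S N) := fun N => (measurableSet_spanningSets μ N).inter
    ((measurableSet_le hF.measurable.norm measurable_const).inter
      (measurableSet_le hw.1 measurable_const))
  have hSmono : Monotone S := by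
    intro M N hMN
    have : (M : ℝ) ≤ N := by exact_mod_cast hMN
    exact Set.inter_subset_inter (monotone_spanningSets μ hMN)
      (Set.inter_subset_inter (fun x hx => le_trans hx this) (fun x hx => le_trans hx this))
  have hSU : ⋃ N, S N = Set.univ := by
    refine Set.eq_univ_of_forall fun x => ?_
    obtain ⟨i, hi⟩ := Set.mem_iUnion.1 ((iUnion_spanningSets μ).symm ▸ Set.mem_univ x)
    obtain ⟨j, hj⟩ := exists_nat_ge ‖F x‖
    obtain ⟨k, hk⟩ := exists_nat_ge (w x)
    refine Set.mem_iUnion.2 ⟨max i (max j k), monotone_spanningSets μ (le_max_left _ _) hi,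
      hj.trans ?_, hk.trans ?_⟩ <;> simp
  have key : ∀ N, (∫⁻ x in S N, ENNReal.ofReal (w x) * ‖F x‖ₑ ^ p ∂μ) ^ (1 / p) ≤ K := by
    intro N
    set I := ∫⁻ x in S N, ENNReal.ofReal (w x) * ‖F x‖ₑ ^ p ∂μ with hI
    set h : X → ℝ := (S N).indicator fun x => w x * ‖F x‖ ^ p with hh
    -- The pairing carries no weight, so w is part of g. Where F = 0 the exponent p - 2 may be
    -- negative, but the conjugate factor vanishes there.
    set g : X → 𝕜 := (S N).indicator fun x => ((w x * ‖F x‖ ^ (p - 2) : ℝ) : 𝕜) *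
      (starRingEnd 𝕜) (F x) with hg
    have hfin : μ (S N) < ∞ :=
      (measure_mono Set.inter_subset_left).trans_lt (measure_spanningSets_lt_top μ N)
    have hFg : ∀ x, F x * g x = (h x : 𝕜) := by
      intro x
      by_cases hx : x ∈ S N
      · simp only [hg, hh, Set.indicator_of_mem hx]
        rw [mul_left_comm, RCLike.mul_conj]
        by_cases hz : F x = 0
        · simp [hz, hp.ne']
        · have hn : 0 < ‖F x‖ := norm_pos_iff.2 hz
          have : ‖F x‖ ^ p = ‖F x‖ ^ (p - 2) * ‖F x‖ ^ 2 := by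
            rw [← Real.rpow_natCast, ← Real.rpow_add hn]
            simp
          rw [this]
          push_cast
          ring
      · simp [hg, hh, hx]
    have hgn : ∀ x, ‖g x‖ = (S N).indicator (fun x => w x * ‖F x‖ ^ (p - 1)) x := by
      intro x
      by_cases hx : x ∈ S N
      · simp only [hg, Set.indicator_of_mem hx, norm_mul, RCLike.norm_conj, RCLike.norm_ofReal]
        rw [abs_of_nonneg (mul_nonneg (hw.2 x).le (Real.rpow_nonneg (norm_nonneg _) _)), mul_assoc]
        by_cases hz : F x = 0
        · simp [hz, (by linarith : p - 1 ≠ 0)]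
        · have hn : 0 < ‖F x‖ := norm_pos_iff.2 hz
          rw [← Real.rpow_add_one hn.ne']
          congr 2
          ring
      · simp [hg, hx]
    have hgm : AEStronglyMeasurable g μ := by
      refine Measurable.aestronglyMeasurable (Measurable.indicator ?_ (hSm N))
      have h1 : Measurable fun x => ((w x * ‖F x‖ ^ (p - 2) : ℝ) : 𝕜) :=
        RCLike.measurable_ofReal.comp (hw.1.mul (hF.measurable.norm.pow_const _))
      exact h1.mul (RCLike.continuous_conj.measurable.comp hF.measurable)
    have hgL : MemLp g (ENNReal.ofReal t) μ := by
      rw [hg, memLp_indicator_iff_restrict (hSm N)]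
      have : IsFiniteMeasure (μ.restrict (S N)) := ⟨by simpa using hfin⟩
      have hb : MemLp g (ENNReal.ofReal t) (μ.restrict (S N)) := by
        refine MemLp.of_bound hgm.restrict (N * (N : ℝ) ^ (p - 1)) (ae_of_all _ fun x => ?_)
        rw [hgn]
        by_cases hx : x ∈ S N
        · rw [Set.indicator_of_mem hx]
          have h1 : ‖F x‖ ≤ N := hx.2.1
          have h2 : w x ≤ N := hx.2.2
          gcongr
        · rw [Set.indicator_of_notMem hx]
          positivity
      refine hb.ae_eq ?_
      filter_upwards [ae_restrict_mem (hSm N)] with x hx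
      simp [hg, hx]
    have hhn : ∀ x, 0 ≤ h x := fun x => Set.indicator_nonneg
      (fun x _ => mul_nonneg (hw.2 x).le (Real.rpow_nonneg (norm_nonneg _) _)) x
    have hhm : Measurable h :=
      (hw.1.mul (hF.measurable.norm.pow_const p)).indicator (hSm N)
    have hlin : ∫⁻ x, ENNReal.ofReal (h x) ∂μ = I := by
      rw [hI, ← lintegral_indicator (hSm N)]
      refine lintegral_congr fun x => ?_
      by_cases hx : x ∈ S N
      · simp only [hh, Set.indicator_of_mem hx]
        rw [ENNReal.ofReal_mul (hw.2 x).le, ← ENNReal.ofReal_rpow_of_nonneg (norm_nonneg _) hp.le,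
          ofReal_norm]
      · simp [hh, hx]
    have hIt : I ≠ ∞ := by
      rw [← hlin]
      refine ne_top_of_le_ne_top (b := ENNReal.ofReal (N * (N : ℝ) ^ p) * μ (S N))
        (by finiteness) ?_
      rw [← lintegral_indicator_const (hSm N)]
      refine lintegral_mono fun x => ?_
      by_cases hx : x ∈ S N
      · simp only [hh, Set.indicator_of_mem hx]
        have h1 : ‖F x‖ ≤ N := hx.2.1
        have h2 : w x ≤ N := hx.2.2
        gcongr
      · simp [hh, hx]
    have hint : ‖∫ x, F x * g x ∂μ‖ₑ = I := by
      simp_rw [hFg]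
      rw [integral_ofReal, ← ofReal_norm, RCLike.norm_ofReal,
        abs_of_nonneg (integral_nonneg hhn), integral_eq_lintegral_of_nonneg_ae (ae_of_all _ hhn)
        hhm.aestronglyMeasurable, hlin, ENNReal.ofReal_toReal hIt]
    have hgnorm : eLpNorm g (ENNReal.ofReal p') (wMeasure μ fun x => w x ^ (1 - p')) =
        I ^ (1 / p') := by
      rw [eLpNorm_ofReal_eq hp', lintegral_wMeasure (hw.rpow _).1, hI,
        ← lintegral_indicator (hSm N)]
      congr 1
      refine lintegral_congr fun x => ?_
      rw [← ofReal_norm (g x), hgn]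
      by_cases hx : x ∈ S N
      · simp only [Set.indicator_of_mem hx]
        have hF0 := norm_nonneg (F x)
        rw [ENNReal.ofReal_rpow_of_nonneg (mul_nonneg (hw.2 x).le (Real.rpow_nonneg hF0 _)) hp'.le,
          ← ENNReal.ofReal_mul ((hw.rpow _).2 x).le,
          Real.mul_rpow (hw.2 x).le (Real.rpow_nonneg hF0 _), ← mul_assoc,
          ← Real.rpow_add (hw.2 x), ← Real.rpow_mul hF0, hpp.sub_one_mul_conj,
          ← ofReal_norm, ENNReal.ofReal_rpow_of_nonneg hF0 hp.le, ← ENNReal.ofReal_mul (hw.2 x).le]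
        simp
      · simp [hx, hp']
    have := hK g hgL
    rw [hint, hgnorm] at this
    exact le_of_le_mul_rpow hIt hpp this
  rw [eLpNorm_ofReal_eq hp, lintegral_wMeasure hw.1, ← setLIntegral_univ, ← hSU,
    setLIntegral_iUnion_of_directed _ hSmono.directed_le, one_div, ENNReal.rpow_inv_le_iff hp]
  refine iSup_le fun N => ?_
  rw [← ENNReal.rpow_inv_le_iff hp, ← one_div]
  exact key N

lemma eLpNorm_le_of_forall_integral_le [SigmaFinite μ] {F : X → 𝕜}
    (hF : AEStronglyMeasurable F μ) {w : X → ℝ} (hw : IsWeight w) {p p' t : ℝ}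
    (hpp : p.HolderConjugate p') {K : ℝ≥0∞}
    (hK : ∀ g : X → 𝕜, MemLp g (ENNReal.ofReal t) μ → ‖∫ x, F x * g x ∂μ‖ₑ ≤
      K * eLpNorm g (ENNReal.ofReal p') (wMeasure μ fun x => w x ^ (1 - p'))) :
    eLpNorm F (ENNReal.ofReal p) (wMeasure μ w) ≤ K := by
  rw [eLpNorm_congr_ae ((wMeasure_absolutelyContinuous w).ae_le hF.ae_eq_mk)]
  refine eLpNorm_le_of_forall_integral_le_of_stronglyMeasurable (t := t)
    hF.stronglyMeasurable_mk hw hpp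
    fun g hg => ?_
  rw [integral_congr_ae (g := fun x => F x * g x)]
  · exact hK g hg
  · filter_upwards [hF.ae_eq_mk] with x hx
    rw [← hx]

end Duality

/-! ### From sparse forms to operator bounds -/

section UpperBounds

variable {X : Type*} [MeasurableSpace X] {ι : Type*} {μ : Measure X} {𝒟 : ι → Set (Set X)}
  {𝕜 : Type*} [RCLike 𝕜] {D : Submodule 𝕜 (X → 𝕜)}

lemma sparseForm_add_le {p q : ℝ≥0∞} (hq : 1 ≤ q) (f : X → 𝕜) {g k : X → 𝕜}
    (hg : AEStronglyMeasurable g μ) (hk : AEStronglyMeasurable k μ) (𝒮 : Set (Set X)) :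
    sparseForm μ p q f (g + k) 𝒮 ≤ sparseForm μ p q f g 𝒮 + sparseForm μ p q f k 𝒮 := by
  rw [sparseForm, sparseForm, sparseForm, ← ENNReal.tsum_add]
  refine ENNReal.tsum_le_tsum fun Q => ?_
  rw [← add_mul, ← mul_add]
  gcongr
  exact eLpNorm_add_le (hg.restrict.smul_measure _) (hk.restrict.smul_measure _) hq

lemma holderConjugate_ofReal {p p' : ℝ} (h : p.HolderConjugate p') :
    ENNReal.HolderTriple (ENNReal.ofReal p) (ENNReal.ofReal p') 1 := by
  constructor
  rw [inv_one, ← ENNReal.ofReal_inv_of_pos h.pos, ← ENNReal.ofReal_inv_of_pos h.symm.pos,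
    ← ENNReal.ofReal_add h.inv_nonneg h.symm.inv_nonneg, h.inv_add_inv_eq_one,
    ENNReal.ofReal_one]

lemma enorm_integral_mul_le {p p' : ℝ} (h : p.HolderConjugate p') {f g : X → 𝕜}
    (hf : AEStronglyMeasurable f μ) (hg : AEStronglyMeasurable g μ) :
    ‖∫ x, f x * g x ∂μ‖ₑ ≤ eLpNorm f (ENNReal.ofReal p) μ * eLpNorm g (ENNReal.ofReal p') μ := by
  have := holderConjugate_ofReal h
  refine (enorm_integral_le_lintegral_enorm _).trans ?_
  rw [← eLpNorm_one_eq_lintegral_enorm]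
  have e : (fun x => f x * g x) = f • g := by
    ext x
    simp
  rw [e]
  exact eLpNorm_smul_le_mul_eLpNorm hg hf

lemma IsTestSpace.memLp (hD : IsTestSpace μ 𝒟 D) {w : X → ℝ} (hw : InAInfty μ 𝒟 w) {p : ℝ}
    (hp : 1 ≤ p) (f : D) : MemLp (f : X → 𝕜) (ENNReal.ofReal p) (wMeasure μ w) :=
  (hD (ENNReal.ofReal p) w (by simpa using hp) ENNReal.ofReal_lt_top hw).1 f f.2

lemma IsTestSpace.memLp_one (hD : IsTestSpace μ 𝒟 D) (h𝒟 : IsGridSystem μ 𝒟) {p : ℝ}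
    (hp : 1 ≤ p) (f : D) : MemLp (f : X → 𝕜) (ENNReal.ofReal p) μ := by
  have h := hD.memLp (inAInfty_one h𝒟) hp f
  rwa [wMeasure_one] at h

lemma IsTestSpace.exists_approx (hD : IsTestSpace μ 𝒟 D) (h𝒟 : IsGridSystem μ 𝒟) {p : ℝ}
    (hp : 1 ≤ p) {g : X → 𝕜} (hg : MemLp g (ENNReal.ofReal p) μ) {ε : ℝ≥0∞} (hε : 0 < ε) :
    ∃ k : D, eLpNorm (g - (k : X → 𝕜)) (ENNReal.ofReal p) μ < ε := by
  have h := (hD (ENNReal.ofReal p) (fun _ => 1) (by simpa using hp) ENNReal.ofReal_lt_top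
    (inAInfty_one h𝒟)).2
  rw [wMeasure_one] at h
  obtain ⟨k, hk, hk'⟩ := h g hg ε hε
  exact ⟨⟨k, hk⟩, hk'⟩

lemma IsTestSpace.aestronglyMeasurable (hD : IsTestSpace μ 𝒟 D) (h𝒟 : IsGridSystem μ 𝒟) (f : D) :
    AEStronglyMeasurable (f : X → 𝕜) μ := (hD.memLp_one h𝒟 le_rfl f).1

lemma eLpNorm_le_of_opNorm_lt {m : Measure X} {T : D → X → 𝕜} {p : ℝ} {K : ℝ≥0∞}
    (hK : opNorm m T p < K) (f : D) :
    eLpNorm (T f) (ENNReal.ofReal p) m ≤ K * eLpNorm (f : X → 𝕜) (ENNReal.ofReal p) m := by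
  obtain ⟨C, hC, hCK⟩ := sInf_lt_iff.1 hK
  refine (hC f).trans ?_
  gcongr

/-- The infimum in `opNorm` is approached with an error that is small relative to the norm of f;
finiteness of that norm is what makes this possible. -/
lemma eLpNorm_le_of_opNorm_le {m : Measure X} {T : D → X → 𝕜} {p : ℝ} {K : ℝ≥0∞}
    (hKt : K ≠ ∞) (hK : opNorm m T p ≤ K) (f : D)
    (hf : eLpNorm (f : X → 𝕜) (ENNReal.ofReal p) m ≠ ∞) :
    eLpNorm (T f) (ENNReal.ofReal p) m ≤ K * eLpNorm (f : X → 𝕜) (ENNReal.ofReal p) m := by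
  refine ENNReal.le_of_forall_pos_le_add fun ε hε _ => ?_
  set a := eLpNorm (f : X → 𝕜) (ENNReal.ofReal p) m
  have hlt : opNorm m T p < K + ε / (a + 1) :=
    hK.trans_lt (ENNReal.lt_add_right hKt (by
      simp only [ne_eq, ENNReal.div_eq_zero_iff, not_or]
      exact ⟨by simpa using hε.ne', by finiteness⟩))
  refine (eLpNorm_le_of_opNorm_lt hlt f).trans ?_
  rw [add_mul]
  gcongr
  rw [mul_comm, ← mul_div_assoc]
  refine ENNReal.div_le_of_le_mul' ?_
  gcongr
  exact le_self_add

/-- The sparse domination, extended from test functions to a Lebesgue space. -/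
lemma enorm_integral_le_of_sparse (hD : IsTestSpace μ 𝒟 D) (h𝒟 : IsGridSystem μ 𝒟)
    {r b t t' : ℝ} (hb : 1 ≤ b) (htt : t.HolderConjugate t') {F f : X → 𝕜}
    (hF : MemLp F (ENNReal.ofReal t) μ) {c : ℝ≥0} {η : ℝ}
    (hsp : ∀ g : D, ∃ 𝒮, IsSparse μ 𝒟 η 𝒮 ∧ ‖∫ x, F x * (g : X → 𝕜) x ∂μ‖ₑ ≤
      c * sparseForm μ (ENNReal.ofReal r) (ENNReal.ofReal b) f g 𝒮)
    {N : (X → 𝕜) → ℝ≥0∞} {M : ℝ≥0∞} (hM : M ≠ ∞)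
    (h₁ : ∀ g : X → 𝕜, AEStronglyMeasurable g μ → ∀ 𝒮, IsSparse μ 𝒟 η 𝒮 →
      sparseForm μ (ENNReal.ofReal r) (ENNReal.ofReal b) f g 𝒮 ≤ N g)
    (h₂ : ∀ g : X → 𝕜, AEStronglyMeasurable g μ → ∀ 𝒮, IsSparse μ 𝒟 η 𝒮 →
      sparseForm μ (ENNReal.ofReal r) (ENNReal.ofReal b) f g 𝒮 ≤
        M * eLpNorm g (ENNReal.ofReal t') μ)
    {g : X → 𝕜} (hg : MemLp g (ENNReal.ofReal t') μ) :
    ‖∫ x, F x * g x ∂μ‖ₑ ≤ c * N g := by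
  have := holderConjugate_ofReal htt
  refine ENNReal.le_of_forall_pos_le_add fun δ hδ _ => ?_
  set L := c * M + eLpNorm F (ENNReal.ofReal t) μ with hL
  have hLt : L ≠ ∞ := by
    have := hF.2.ne
    finiteness
  have hε : 0 < (δ : ℝ≥0∞) / (L + 1) :=
    ENNReal.div_pos (by simpa using hδ.ne') (by finiteness)
  obtain ⟨k, hk⟩ := hD.exists_approx h𝒟 htt.symm.lt.le hg hε
  have hkL := hD.memLp_one h𝒟 htt.symm.lt.le k
  obtain ⟨𝒮, h𝒮, hle⟩ := hsp k
  have e1 : ∫ x, F x * g x ∂μ = ∫ x, F x * (k : X → 𝕜) x ∂μ +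
      ∫ x, F x * (g - (k : X → 𝕜)) x ∂μ := by
    have i₁ : Integrable (fun x => F x * (k : X → 𝕜) x) μ := hF.integrable_mul hkL
    have i₂ : Integrable (fun x => F x * (g - (k : X → 𝕜)) x) μ := hF.integrable_mul (hg.sub hkL)
    rw [← integral_add i₁ i₂]
    refine integral_congr_ae (ae_of_all _ fun x => ?_)
    simp only [Pi.sub_apply]
    ring
  -- The sparse family belongs to the test function k and not to g. This does no harm, since both
  -- bounds are uniform over all η-sparse families.
  have e2 : (k : X → 𝕜) = g + ((k : X → 𝕜) - g) := by abel
  have h3 : sparseForm μ (ENNReal.ofReal r) (ENNReal.ofReal b) f k 𝒮 ≤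
      N g + M * ((δ : ℝ≥0∞) / (L + 1)) := by
    rw [e2]
    refine (sparseForm_add_le (by simpa using hb) f hg.1 (hkL.1.sub hg.1) 𝒮).trans
      (add_le_add (h₁ g hg.1 𝒮 h𝒮) ((h₂ _ (hkL.1.sub hg.1) 𝒮 h𝒮).trans ?_))
    rw [eLpNorm_sub_comm]
    gcongr
  rw [e1]
  calc _ ≤ ‖∫ x, F x * (k : X → 𝕜) x ∂μ‖ₑ + ‖∫ x, F x * (g - (k : X → 𝕜)) x ∂μ‖ₑ :=
        enorm_add_le _ _
    _ ≤ c * (N g + M * ((δ : ℝ≥0∞) / (L + 1))) +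
        eLpNorm F (ENNReal.ofReal t) μ * ((δ : ℝ≥0∞) / (L + 1)) := by
        gcongr
        · exact hle.trans (by gcongr)
        · exact (enorm_integral_mul_le htt hF.1 (hg.sub hkL).1).trans (by gcongr)
    _ = c * N g + L * ((δ : ℝ≥0∞) / (L + 1)) := by rw [hL]; ring
    _ ≤ c * N g + δ := by
        gcongr
        rw [← mul_div_assoc]
        refine ENNReal.div_le_of_le_mul ?_
        rw [mul_comm]
        gcongr
        exact le_self_add

/-- Weighted bounds for sparse forms yield weighted bounds for the operator. -/
theorem exists_opNorm_le [Finite ι] [SigmaFinite μ] (hD : IsTestSpace μ 𝒟 D)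
    (h𝒟 : IsGridSystem μ 𝒟) {T : D → X → 𝕜} {r b s₀ t t' : ℝ} {q₀ : ℝ≥0∞}
    (hT : IsSparselyDominated μ 𝒟 T r q₀) (hq₀ : ENNReal.conjExponent q₀ = ENNReal.ofReal b)
    (ht : IsExponents r b s₀ t t') (hTt : opNorm μ T t ≠ ∞) {p p' : ℝ}
    (hpp : p.HolderConjugate p') (Φ : (X → ℝ) → ℝ≥0∞)
    (hΦ : ∀ η : ℝ, 0 < η → ∃ C : ℝ≥0, ∀ w : X → ℝ, IsWeight w → Φ w ≠ ∞ →
      ∀ f g : X → 𝕜, AEStronglyMeasurable f μ → AEStronglyMeasurable g μ →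
      ∀ 𝒮, IsSparse μ 𝒟 η 𝒮 →
        sparseForm μ (ENNReal.ofReal r) (ENNReal.ofReal b) f g 𝒮 ≤ C * Φ w *
          (eLpNorm f (ENNReal.ofReal p) (wMeasure μ w) *
            eLpNorm g (ENNReal.ofReal p') (wMeasure μ fun x => w x ^ (1 - p')))) :
    ∃ C : ℝ≥0, ∀ w : X → ℝ, InAInfty μ 𝒟 w → opNorm (wMeasure μ w) T p ≤ C * Φ w := by
  obtain ⟨c, η, hη, -, hsp⟩ := hT.sparse
  obtain ⟨C, hC⟩ := hΦ η hη
  -- Used with the weight 1 only: it makes the sparse form continuous in g in the unweighted space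
  -- L^t'.
  obtain ⟨C₀, hC₀⟩ := exists_sparseForm_le_A1 (F := 𝕜) h𝒟 ht hη
  -- Adding 1 keeps the constant nonzero, so that the bound is trivial when Φ w = ∞.
  refine ⟨c * C + 1, fun w hw => ?_⟩
  have hwW : IsWeight w := by
    obtain ⟨q, -, hq⟩ := hw
    exact hq.1
  by_cases hΦt : Φ w = ∞
  · rw [hΦt, ENNReal.mul_top (by simp)]
    exact le_top
  refine sInf_le fun f => ?_
  have hfm := hD.aestronglyMeasurable h𝒟 f
  have hft := hD.memLp_one h𝒟 (le_of_lt ht.conj.lt) f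
  have hTf : MemLp (T f) (ENNReal.ofReal t) μ :=
    ⟨hT.measurable f, (eLpNorm_le_of_opNorm_le hTt le_rfl f hft.2.ne).trans_lt
      (ENNReal.mul_lt_top (lt_top_iff_ne_top.2 hTt) hft.2)⟩
  have h1 : apConst μ 𝒟 1 (fun _ => (1 : ℝ) ^ s₀) ≤ 1 := by
    simpa using apConst_const_one_le 1 h𝒟
  refine eLpNorm_le_of_forall_integral_le (hT.measurable f) hwW hpp (t := t') fun g hg => ?_
  calc ‖∫ x, T f x * g x ∂μ‖ₑ ≤ c * (C * Φ w * (eLpNorm (f : X → 𝕜) (ENNReal.ofReal p)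
        (wMeasure μ w) * eLpNorm g (ENNReal.ofReal p') (wMeasure μ fun x => w x ^ (1 - p')))) := by
        refine enorm_integral_le_of_sparse hD h𝒟 ht.one_le_b ht.conj (r := r) (f := f) hTf
          (c := c) (η := η) ?_
          (N := fun g => C * Φ w * (eLpNorm (f : X → 𝕜) (ENNReal.ofReal p)
        (wMeasure μ w) * eLpNorm g (ENNReal.ofReal p') (wMeasure μ fun x => w x ^ (1 - p'))))
          (M := C₀ * 1 * eLpNorm (f : X → 𝕜) (ENNReal.ofReal t) μ) ?_
          (fun g hg 𝒮 h𝒮 => hC w hwW hΦt f g hfm hg 𝒮 h𝒮) (fun g hg 𝒮 h𝒮 => ?_) hg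
        · intro g
          obtain ⟨𝒮, h𝒮, hle⟩ := hsp f g
          exact ⟨𝒮, h𝒮, by rwa [hq₀] at hle⟩
        · have := hft.2.ne
          finiteness
        · refine (hC₀ (fun _ => 1) isWeight_one (ne_top_of_le_ne_top ENNReal.one_ne_top h1) f g hfm hg
            𝒮 h𝒮).trans ?_
          rw [← mul_assoc]
          simp only [wMeasure_one, Real.one_rpow] at h1 ⊢
          gcongr
          exact ENNReal.rpow_le_one h1 (one_div_nonneg.2 ht.b_pos.le)
    _ = (c * C) * Φ w * eLpNorm (f : X → 𝕜) (ENNReal.ofReal p) (wMeasure μ w) *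
          eLpNorm g (ENNReal.ofReal p') (wMeasure μ fun x => w x ^ (1 - p')) := by ring
    _ ≤ _ := by
        push_cast
        gcongr
        exact le_self_add

end UpperBounds

/-! ### Lower bounds by extrapolation -/

section Weights

variable {X : Type*} [MeasurableSpace X] {ι : Type*} {μ : Measure X} {𝒟 : ι → Set (Set X)}

/-- Division of the pointwise A_1 condition by W. The average of W is finite because the condition
holds at some point of Q, which is not a null set. -/
lemma avg_one_mul_avg_top_inv_le {W : X → ℝ} (hW : IsWeight W) {Q : Set X} (hQ : MeasurableSet Q)
    (h0 : μ Q ≠ 0) (ht : μ Q ≠ ∞) {B : ℝ≥0∞} (hBt : B ≠ ∞)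
    (h : ∀ᵐ x ∂μ.restrict Q, avg μ 1 W Q ≤ B * ENNReal.ofReal (W x)) :
    avg μ 1 W Q * avg μ ∞ (fun x => (W x)⁻¹) Q ≤ B := by
  have hz : avg μ 1 W Q ≠ 0 := by
    rw [avg_one_weight hW hQ]
    exact ENNReal.div_ne_zero.2 ⟨fun h => h0 (absolutelyContinuous_wMeasure hW h), ht⟩
  have htop : avg μ 1 W Q ≠ ∞ := by
    have : NeBot (ae (μ.restrict Q)) := by
      rw [ae_neBot]
      simpa [Measure.restrict_eq_zero] using h0
    obtain ⟨x, hx⟩ := h.exists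
    exact ne_top_of_le_ne_top (by finiteness) hx
  rw [avg_top_eq _ ht, mul_comm, ← ENNReal.le_div_iff_mul_le (Or.inl hz) (Or.inl htop)]
  refine essSup_le_of_ae_le _ (h.mono fun x hx => ?_)
  have hx0 := hW.2 x
  simp only
  rw [ENNReal.le_div_iff_mul_le (Or.inl hz) (Or.inl htop), Real.enorm_of_nonneg (hW.inv.2 x).le]
  calc _ ≤ ENNReal.ofReal (W x)⁻¹ * (B * ENNReal.ofReal (W x)) := by gcongr
    _ = ENNReal.ofReal (W x) * (B * ENNReal.ofReal (W x)⁻¹) := by ring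
    _ = B := ofReal_mul_ofReal_inv hx0 B

/-- Functions have majorants of comparable norm that are `A_1` weights. -/
theorem exists_weight_majorant [Finite ι] [SigmaFinite μ] (h𝒟 : IsGridSystem μ 𝒟) {u : X → ℝ≥0∞}
    (hu : AEMeasurable u μ) {t : ℝ} (ht : 1 < t) (hut : ∫⁻ x, u x ^ t ∂μ ≠ ∞) {δ : ℝ≥0∞}
    (hδ : δ ≠ 0) :
    ∃ W : X → ℝ, IsWeight W ∧ (∀ᵐ x ∂μ, u x ≤ ENNReal.ofReal (W x)) ∧
      ∫⁻ x, ENNReal.ofReal (W x) ^ t ∂μ ≤ 2 ^ t * (∫⁻ x, u x ^ t ∂μ + δ) ∧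
      ∀ a, ∀ Q ∈ 𝒟 a, avg μ 1 W Q * avg μ ∞ (fun x => (W x)⁻¹) Q ≤
        ENNReal.ofReal (4 * (Nat.card ι + 1) * (t / (t - 1))) := by
  have ht0 : 0 < t := by linarith
  -- A strictly positive function of small integral makes the majorant positive even where u
  -- vanishes. The minimum with 1 keeps its integral finite when δ = ∞.
  obtain ⟨ρ, hρ0, hρm, hρ⟩ := exists_pos_lintegral_lt_of_sigmaFinite μ
    (ε := min δ 1) (by simp [hδ])
  set v : X → ℝ≥0∞ := fun x => max (hu.mk u x) ((ρ x : ℝ≥0∞) ^ (1 / t)) with hv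
  have hvm : Measurable v := hu.measurable_mk.max (hρm.coe_nnreal_ennreal.pow_const _)
  have hvt : ∫⁻ x, v x ^ t ∂μ ≤ ∫⁻ x, u x ^ t ∂μ + min δ 1 := by
    calc ∫⁻ x, v x ^ t ∂μ ≤ ∫⁻ x, (hu.mk u x ^ t + ρ x) ∂μ := by
          refine lintegral_mono fun x => ?_
          have e : ((ρ x : ℝ≥0∞) ^ (1 / t)) ^ t = ρ x := by
            rw [← ENNReal.rpow_mul, one_div_mul_cancel ht0.ne', ENNReal.rpow_one]
          rcases max_cases (hu.mk u x) ((ρ x : ℝ≥0∞) ^ (1 / t)) with h | h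
          · simp only [hv, h.1]
            exact le_self_add
          · simp only [hv, h.1, e]
            exact le_add_self
      _ = ∫⁻ x, u x ^ t ∂μ + ∫⁻ x, ρ x ∂μ := by
          rw [lintegral_add_left (hu.measurable_mk.pow_const t)]
          congr 1
          exact lintegral_congr_ae (hu.ae_eq_mk.mono fun x hx => by simp [hx])
      _ ≤ _ := by gcongr
  have hvfin : ∫⁻ x, v x ^ t ∂μ ≠ ∞ :=
    ne_top_of_le_ne_top (ENNReal.add_ne_top.2 ⟨hut, by simp⟩) hvt
  obtain ⟨H, hHm, hvH, hHt, hHQ⟩ := exists_majorant h𝒟 hvm ht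
  have hHpos : ∀ x, 0 < H x := fun x => by
    refine lt_of_lt_of_le ?_ ((le_max_right _ _).trans (hvH x))
    exact ENNReal.rpow_pos (by simpa using hρ0 x) (by simp)
  have hHfin : ∀ᵐ x ∂μ, H x < ∞ := by
    have : ∫⁻ x, H x ^ t ∂μ ≠ ∞ := ne_top_of_le_ne_top (by finiteness) hHt
    filter_upwards [ae_lt_top (hHm.pow_const t) this] with x hx
    by_contra h
    rw [not_lt, top_le_iff] at h
    rw [h, ENNReal.top_rpow_of_pos ht0] at hx
    exact lt_irrefl _ hx
  -- H is infinite only on a null set, where any positive value will do.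
  set W : X → ℝ := fun x => if H x = ∞ then 1 else (H x).toReal with hW
  have hWH : ∀ᵐ x ∂μ, ENNReal.ofReal (W x) = H x := by
    filter_upwards [hHfin] with x hx
    simp only [hW, hx.ne, if_false]
    exact ENNReal.ofReal_toReal hx.ne
  have hWw : IsWeight W := by
    refine ⟨Measurable.ite (hHm (measurableSet_singleton ∞)) measurable_const hHm.ennreal_toReal,
      fun x => ?_⟩
    by_cases hx : H x = ∞
    · simp [hW, hx]
    · simp only [hW, hx, if_false]
      exact ENNReal.toReal_pos (hHpos x).ne' hx
  refine ⟨W, hWw, ?_, ?_, fun a Q hQ => ?_⟩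
  · filter_upwards [hWH, hu.ae_eq_mk] with x h1 h2
    rw [h1, h2]
    exact (le_max_left _ _).trans (hvH x)
  · calc ∫⁻ x, ENNReal.ofReal (W x) ^ t ∂μ = ∫⁻ x, H x ^ t ∂μ :=
          lintegral_congr_ae (hWH.mono fun x hx => by simp [hx])
      _ ≤ 2 ^ t * ∫⁻ x, v x ^ t ∂μ := hHt
      _ ≤ _ := by
          gcongr
          exact hvt.trans (by gcongr; exact min_le_left _ _)
  · have hQm := (h𝒟.nestedFamily a).measurable Q hQ
    refine avg_one_mul_avg_top_inv_le hWw hQm (h𝒟.pos a Q hQ).ne' (h𝒟.finite a Q hQ).ne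
      ENNReal.ofReal_ne_top ?_
    have e : avg μ 1 W Q = (∫⁻ y in Q, H y ∂μ) / μ Q := by
      rw [avg_one_weight hWw hQm, wMeasure_apply hQm]
      congr 1
      exact lintegral_congr_ae (ae_restrict_of_ae hWH)
    filter_upwards [ae_restrict_of_ae hWH, ae_restrict_mem hQm] with x h1 h2
    rw [e, h1]
    exact hHQ a Q hQ x h2

variable {W : X → ℝ} {B : ℝ≥0∞}

/-- Roots of `A_1` weights. -/
lemma avg_mul_avg_le_of_root (hW : IsWeight W) {s : ℝ} (hs : 1 ≤ s) {Q : Set X}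
    (hB : avg μ 1 W Q * avg μ ∞ (fun x => (W x)⁻¹) Q ≤ B) :
    avg μ (ENNReal.ofReal s) (fun x => W x ^ (1 / s)) Q *
      avg μ (ENNReal.ofReal (1 - 1))⁻¹ (fun x => (W x ^ (1 / s))⁻¹) Q ≤ B ^ (1 / s) := by
  have hs0 : 0 < s := by linarith
  have h1 : 0 < 1 / s := by positivity
  have e1 : ENNReal.ofReal s * ENNReal.ofReal (1 / s) = 1 := by
    rw [← ENNReal.ofReal_mul hs0.le, mul_one_div_cancel hs0.ne', ENNReal.ofReal_one]
  have e2 : (fun x => (W x ^ (1 / s))⁻¹) = fun x => ((W x)⁻¹) ^ (1 / s) := by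
    ext x
    rw [Real.inv_rpow (hW.2 x).le]
  rw [avg_rpow (fun x => (hW.2 x).le) h1, e1, e2, avg_rpow (fun x => (hW.inv.2 x).le) h1, sub_self,
    ENNReal.ofReal_zero, ENNReal.inv_zero, ENNReal.top_mul (by simpa using h1),
    ← ENNReal.mul_rpow_of_nonneg _ _ h1.le]
  gcongr

/-- Negative powers of `A_1` weights. -/
lemma avg_mul_avg_le_of_neg_rpow (hW : IsWeight W) {s q τ : ℝ} (hq : 1 < q) (hτ : 0 < τ)
    (hτq : τ ≤ q - 1) {Q : Set X} (h0 : μ Q ≠ 0) (ht : μ Q ≠ ∞)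
    (hB : avg μ 1 W Q * avg μ ∞ (fun x => (W x)⁻¹) Q ≤ B) :
    avg μ (ENNReal.ofReal s) (fun x => W x ^ (-τ)) Q *
      avg μ (ENNReal.ofReal (q - 1))⁻¹ (fun x => (W x ^ (-τ))⁻¹) Q ≤ B ^ τ := by
  have e1 : (fun x => W x ^ (-τ)) = fun x => ((W x)⁻¹) ^ τ := by
    ext x
    rw [Real.inv_rpow (hW.2 x).le, Real.rpow_neg (hW.2 x).le]
  have e2 : (fun x => (W x ^ (-τ))⁻¹) = fun x => W x ^ τ := by
    ext x
    rw [Real.rpow_neg (hW.2 x).le, inv_inv]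
  have hq1 : 0 < q - 1 := by linarith
  -- The first average is raised to exponent ∞ and the second to exponent 1; the latter is allowed
  -- since τ/(q-1) ≤ 1.
  calc _ ≤ avg μ ∞ (fun x => ((W x)⁻¹) ^ τ) Q * avg μ 1 W Q ^ τ := by
        rw [e1, e2, avg_rpow (fun x => (hW.2 x).le) hτ]
        gcongr
        · exact avg_mono_exponent (hW.inv.rpow τ).1.aestronglyMeasurable le_top h0 ht
        · refine avg_mono_exponent hW.1.aestronglyMeasurable ?_ h0 ht
          rw [← ENNReal.ofReal_inv_of_pos hq1, ← ENNReal.ofReal_mul (by positivity),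
            ← ENNReal.ofReal_one]
          refine ENNReal.ofReal_le_ofReal ?_
          rw [inv_mul_le_iff₀ hq1]
          linarith
    _ = (avg μ 1 W Q * avg μ ∞ (fun x => (W x)⁻¹) Q) ^ τ := by
        rw [avg_rpow (fun x => (hW.inv.2 x).le) hτ, ENNReal.top_mul (by simpa using hτ),
          ENNReal.mul_rpow_of_nonneg _ _ hτ.le, mul_comm]
    _ ≤ _ := by gcongr

end Weights

/-! ### Extrapolation to unweighted Lebesgue spaces -/

section Extrapolation

variable {X : Type*} [MeasurableSpace X] {ι : Type*} {μ : Measure X} {𝒟 : ι → Set (Set X)}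
  {𝕜 : Type*} [RCLike 𝕜] {D : Submodule 𝕜 (X → 𝕜)} {T : D → X → 𝕜}

lemma le_mul_of_forall_le_mul_add {a b L : ℝ≥0∞} (hL : L ≠ ∞)
    (h : ∀ δ : ℝ≥0∞, δ ≠ 0 → a ≤ L * (b + δ)) : a ≤ L * b := by
  refine ENNReal.le_of_forall_pos_le_add fun ε hε _ => ?_
  refine (h (ε / (L + 1)) (ENNReal.div_ne_zero.2 ⟨by simpa using hε.ne', by finiteness⟩)).trans ?_
  rw [mul_add]
  gcongr
  rw [← mul_div_assoc]
  refine ENNReal.div_le_of_le_mul ?_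
  rw [mul_comm]
  gcongr
  exact le_self_add

lemma ofReal_rpow_eq {w : ℝ} (hw : 0 < w) (a : ℝ) :
    ENNReal.ofReal (w ^ a) = ENNReal.ofReal w ^ a := (ENNReal.ofReal_rpow_of_pos hw).symm

/-- Extrapolation from `L^p(w)` to `L^r` with `r > p`. -/
theorem opNorm_le_of_lt [Finite ι] [SigmaFinite μ] (hD : IsTestSpace μ 𝒟 D)
    (h𝒟 : IsGridSystem μ 𝒟) (hTm : ∀ f, AEStronglyMeasurable (T f) μ) {p r s : ℝ} (hp : 1 < p)
    (hpr : p < r) (hs : 1 ≤ s) (hsr : 1 < r / (r - p) / s) {K : ℝ≥0∞} (hKt : K ≠ ∞)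
    (hK : ∀ w : X → ℝ, IsWeight w → (∀ a, ∀ Q ∈ 𝒟 a, avg μ (ENNReal.ofReal s) w Q *
        avg μ (ENNReal.ofReal (1 - 1))⁻¹ (fun x => (w x)⁻¹) Q ≤
          ENNReal.ofReal (4 * (Nat.card ι + 1) *
            ((r / (r - p) / s) / (r / (r - p) / s - 1))) ^ (1 / s)) →
      opNorm (wMeasure μ w) T p ≤ K) :
    opNorm μ T r ≤ 4 * K := by
  have hp0 : 0 < p := by linarith
  have hr0 : 0 < r := by linarith
  have hrp : 0 < r - p := by linarith
  have hs0 : 0 < s := by linarith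
  set θ := r / (r - p) with hθ
  have hθ0 : 0 < θ := by positivity
  set t := θ / s with ht
  have ht0 : 0 < t := by positivity
  have hr1 : 1 < r := by linarith
  set p' := p / (p - 1) with hp'
  set r' := r / (r - 1) with hr'
  have hpp : p.HolderConjugate p' := Real.HolderConjugate.conjExponent hp
  have hrr : r.HolderConjugate r' := Real.HolderConjugate.conjExponent hr1
  have hp'0 := hpp.symm.pos
  have hr'0 := hrr.symm.pos
  have hθc : (r / p).HolderConjugate θ := by
    have h := Real.HolderConjugate.conjExponent (p := r / p) (by rwa [one_lt_div hp0])
    have e : (r / p).conjExponent = θ := by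
      rw [Real.conjExponent, hθ]
      field_simp
    rwa [e] at h
  refine sInf_le fun f => ?_
  have hfr : MemLp (f : X → 𝕜) (ENNReal.ofReal r) μ := hD.memLp_one h𝒟 hr1.le f
  have key : ∀ g : X → 𝕜, MemLp g (ENNReal.ofReal r') μ → ‖∫ x, T f x * g x ∂μ‖ₑ ≤
      4 * K * eLpNorm (f : X → 𝕜) (ENNReal.ofReal r) μ *
        eLpNorm g (ENNReal.ofReal r') (wMeasure μ fun _ => (1 : ℝ) ^ (1 - r')) := by
    intro g hg
    simp only [Real.one_rpow, wMeasure_one]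
    set I := ∫⁻ x, ‖g x‖ₑ ^ r' ∂μ with hI
    have hgI : eLpNorm g (ENNReal.ofReal r') μ = I ^ (1 / r') := eLpNorm_ofReal_eq hr'0 g μ
    by_cases hI0 : I = 0
    · have : g =ᵐ[μ] 0 := by
        rw [← eLpNorm_eq_zero_iff (p := ENNReal.ofReal r') hg.1 (by simpa using hr'0), hgI, hI0]
        simp [hr'0]
      have h0 : ∫ x, T f x * g x ∂μ = 0 := by
        rw [integral_congr_ae (g := fun _ => 0) (this.mono fun x hx => by simp [hx])]
        simp
      simp [h0]
    have hIt : I ≠ ∞ := by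
      intro h
      have := hg.2.ne
      rw [hgI, h, ENNReal.top_rpow_of_pos (by positivity)] at this
      exact this rfl
    -- The power is such that u^t = |g|^r' and that the root w = W^(1/s) of a majorant W of u
    -- satisfies w ≥ |g|^(r'/θ), with ∫ w^θ comparable to ∫ |g|^r'. Here θ = (r/p)' is the exponent
    -- that Hölder's inequality needs in passing from L^p(w) to L^r for f.
    set u : X → ℝ≥0∞ := fun x => ‖g x‖ₑ ^ (r' / t) with hu
    have hum : AEMeasurable u μ := hg.1.enorm.pow_const _
    have hut : ∫⁻ x, u x ^ t ∂μ = I := by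
      refine lintegral_congr fun x => ?_
      rw [hu, ← ENNReal.rpow_mul, div_mul_cancel₀ _ ht0.ne']
    -- The admissible error is I itself, which is nonzero here.
    obtain ⟨W, hW, huW, hWt, hWQ⟩ := exists_weight_majorant h𝒟 hum hsr (by rwa [hut]) hI0
    rw [hut, ← two_mul] at hWt
    set w : X → ℝ := fun x => W x ^ (1 / s) with hw
    have hwW : IsWeight w := hW.rpow _
    have hQ : ∀ a, ∀ Q ∈ 𝒟 a, _ := fun a Q hQ => avg_mul_avg_le_of_root hW hs (hWQ a Q hQ)
    have hop := hK w hwW hQ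
    have hwA : InAInfty μ 𝒟 w := ⟨1, le_rfl, inA_of_avg_mul_avg_le hwW hs h𝒟 (by finiteness) hQ⟩
    have hfp := hD.memLp hwA hp.le f
    have hTf := eLpNorm_le_of_opNorm_le hKt hop f hfp.2.ne
    set ω : X → ℝ≥0∞ := fun x => ENNReal.ofReal (w x) with hω
    have hω0 : ∀ x, ω x ≠ 0 := fun x => by simpa [hω] using hwW.2 x
    have hωt : ∀ x, ω x ≠ ∞ := fun x => ENNReal.ofReal_ne_top
    have hωm : Measurable ω := hwW.1.ennreal_ofReal
    have hωg : ∀ᵐ x ∂μ, ‖g x‖ₑ ^ (r' / θ) ≤ ω x := by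
      filter_upwards [huW] with x hx
      calc ‖g x‖ₑ ^ (r' / θ) = u x ^ (1 / s) := by
            rw [hu, ← ENNReal.rpow_mul, ht]
            congr 1
            field_simp
        _ ≤ ENNReal.ofReal (W x) ^ (1 / s) := by gcongr
        _ = ω x := (ofReal_rpow_eq (hW.2 x) _).symm
    have hωθ : ∫⁻ x, ω x ^ θ ∂μ ≤ 2 ^ t * (2 * I) := by
      refine le_trans (le_of_eq (lintegral_congr fun x => ?_)) hWt
      rw [hω, hw]
      simp only
      rw [ofReal_rpow_eq (hW.2 x), ← ENNReal.rpow_mul, ht]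
      congr 1
      field_simp
    have hfω : ∫⁻ x, ω x * ‖(f : X → 𝕜) x‖ₑ ^ p ∂μ ≤
        (∫⁻ x, ‖(f : X → 𝕜) x‖ₑ ^ r ∂μ) ^ (p / r) * (∫⁻ x, ω x ^ θ ∂μ) ^ (1 / θ) := by
      have h := ENNReal.lintegral_mul_le_Lp_mul_Lq μ hθc
        (hfr.1.enorm.pow_const p) hωm.aemeasurable
      simp only [Pi.mul_apply, ← ENNReal.rpow_mul, one_div_div] at h
      rw [mul_div_cancel₀ _ hp0.ne'] at h
      simpa only [mul_comm] using h
    -- The lower bound for w enters with a negative power, and p' - p'r'/(θp) = r'.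
    have hgω : ∫⁻ x, (‖g x‖ₑ * ω x ^ (-(1 / p))) ^ p' ∂μ ≤ I := by
      refine lintegral_mono_ae ?_
      filter_upwards [hωg] with x hx
      by_cases hz : ‖g x‖ₑ = 0
      · simp [hz, hp'0]
      have hzt : ‖g x‖ₑ ≠ ∞ := enorm_ne_top
      rw [ENNReal.mul_rpow_of_nonneg _ _ hp'0.le, ← ENNReal.rpow_mul]
      calc ‖g x‖ₑ ^ p' * ω x ^ (-(1 / p) * p') ≤
            ‖g x‖ₑ ^ p' * (‖g x‖ₑ ^ (r' / θ)) ^ (-(1 / p) * p') := by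
            gcongr ‖g x‖ₑ ^ p' * ?_
            rw [neg_mul, ENNReal.rpow_neg, ENNReal.rpow_neg]
            gcongr
        _ = ‖g x‖ₑ ^ r' := by
            rw [← ENNReal.rpow_mul, ← ENNReal.rpow_add _ _ hz hzt]
            congr 1
            rw [hθ, hp', hr']
            have h1 : r - 1 ≠ 0 := by linarith
            have h2 : p - 1 ≠ 0 := by linarith
            field_simp
            ring
    have hTfω : (∫⁻ x, (‖T f x‖ₑ * ω x ^ (1 / p)) ^ p ∂μ) ^ (1 / p) =
        eLpNorm (T f) (ENNReal.ofReal p) (wMeasure μ w) := by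
      rw [eLpNorm_ofReal_eq hp0, lintegral_wMeasure hwW.1]
      congr 1
      refine lintegral_congr fun x => ?_
      rw [ENNReal.mul_rpow_of_nonneg _ _ hp0.le, ← ENNReal.rpow_mul, one_div_mul_cancel hp0.ne',
        ENNReal.rpow_one, mul_comm]
    have hexp : 1 / θ * (1 / p) + 1 / p' = 1 / r' := by
      rw [hθ, hp', hr']
      have h1 : r - 1 ≠ 0 := by linarith
      have h2 : p - 1 ≠ 0 := by linarith
      field_simp
      ring
    have hconst : ((2 : ℝ≥0∞) ^ t * 2) ^ (1 / θ * (1 / p)) ≤ 4 := by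
      have h1 : ((2 : ℝ≥0∞) ^ t * 2) ≤ 4 ^ t := by
        have : (4 : ℝ≥0∞) = 2 * 2 := by norm_num
        rw [this, ENNReal.mul_rpow_of_nonneg _ _ ht0.le]
        gcongr
        exact ENNReal.le_rpow_self_of_one_le (by norm_num) hsr.le
      calc ((2 : ℝ≥0∞) ^ t * 2) ^ (1 / θ * (1 / p)) ≤ (4 ^ t) ^ (1 / θ * (1 / p)) := by gcongr
        _ = 4 ^ (1 / (s * p)) := by
            rw [← ENNReal.rpow_mul, ht]
            congr 1
            field_simp
        _ ≤ 4 ^ (1 : ℝ) := by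
            refine ENNReal.rpow_le_rpow_of_exponent_le (by norm_num) ?_
            rw [div_le_one (by positivity)]
            nlinarith
        _ = 4 := ENNReal.rpow_one _
    calc ‖∫ x, T f x * g x ∂μ‖ₑ ≤ ∫⁻ x, ‖T f x * g x‖ₑ ∂μ := enorm_integral_le_lintegral_enorm _
      _ = ∫⁻ x, ((fun x => ‖T f x‖ₑ * ω x ^ (1 / p)) *
            fun x => ‖g x‖ₑ * ω x ^ (-(1 / p))) x ∂μ := by
          refine lintegral_congr fun x => ?_
          rw [Pi.mul_apply, enorm_mul, mul_mul_mul_comm, ← ENNReal.rpow_add _ _ (hω0 x) (hωt x)]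
          simp
      _ ≤ (∫⁻ x, (‖T f x‖ₑ * ω x ^ (1 / p)) ^ p ∂μ) ^ (1 / p) *
            (∫⁻ x, (‖g x‖ₑ * ω x ^ (-(1 / p))) ^ p' ∂μ) ^ (1 / p') :=
          ENNReal.lintegral_mul_le_Lp_mul_Lq μ hpp
            ((hTm f).enorm.mul (hωm.pow_const _).aemeasurable)
            (hg.1.enorm.mul (hωm.pow_const _).aemeasurable)
      _ ≤ (K * ((∫⁻ x, ‖(f : X → 𝕜) x‖ₑ ^ r ∂μ) ^ (p / r) * (2 ^ t * (2 * I)) ^ (1 / θ)) ^ (1 / p)) *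
            I ^ (1 / p') := by
          rw [hTfω]
          gcongr
          refine hTf.trans ?_
          gcongr
          rw [eLpNorm_ofReal_eq hp0, lintegral_wMeasure hwW.1]
          gcongr
          exact hfω.trans (by gcongr)
      _ = K * eLpNorm (f : X → 𝕜) (ENNReal.ofReal r) μ *
            (((2 : ℝ≥0∞) ^ t * 2) ^ (1 / θ * (1 / p)) * (I ^ (1 / θ * (1 / p)) * I ^ (1 / p'))) := by
          rw [eLpNorm_ofReal_eq hr0, ENNReal.mul_rpow_of_nonneg _ _ (by positivity),
            ← ENNReal.rpow_mul, ← ENNReal.rpow_mul, ← mul_assoc (2 ^ t),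
            ENNReal.mul_rpow_of_nonneg _ I (by positivity)]
          have : p / r * (1 / p) = 1 / r := by field_simp
          rw [this]
          ring
      _ ≤ K * eLpNorm (f : X → 𝕜) (ENNReal.ofReal r) μ * (4 * I ^ (1 / r')) := by
          rw [← ENNReal.rpow_add _ _ hI0 hIt, hexp]
          gcongr
      _ = _ := by
          rw [hgI]
          ring
  have := eLpNorm_le_of_forall_integral_le (hTm f) isWeight_one hrr key
  simpa using this

/-- Extrapolation from `L^p(w)` to `L^r` with `r < p`. -/
theorem opNorm_le_of_gt [Finite ι] [SigmaFinite μ] (hD : IsTestSpace μ 𝒟 D)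
    (h𝒟 : IsGridSystem μ 𝒟) (hTm : ∀ f, AEStronglyMeasurable (T f) μ) {p₀ p r s : ℝ} (hp₀ : 1 ≤ p₀)
    (hr : p₀ < r) (hrp : r < p) (hs : 1 ≤ s) {K : ℝ≥0∞} (hKt : K ≠ ∞)
    (hK : ∀ w : X → ℝ, IsWeight w → (∀ a, ∀ Q ∈ 𝒟 a, avg μ (ENNReal.ofReal s) w Q *
        avg μ (ENNReal.ofReal (p / p₀ - 1))⁻¹ (fun x => (w x)⁻¹) Q ≤
          ENNReal.ofReal (4 * (Nat.card ι + 1) * ((r / p₀) / (r / p₀ - 1))) ^ ((p - r) / p₀)) →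
      opNorm (wMeasure μ w) T p ≤ K) :
    opNorm μ T r ≤ 2 * K := by
  have hp₀0 : 0 < p₀ := by linarith
  have hr0 : 0 < r := by linarith
  have hp0 : 0 < p := by linarith
  have hrp' : 0 < p - r := by linarith
  set t := r / p₀ with ht
  have ht1 : 1 < t := by rwa [ht, one_lt_div hp₀0]
  set τ := (p - r) / p₀ with hτ
  have hτ0 : 0 < τ := by positivity
  refine sInf_le fun f => ?_
  have hfr : MemLp (f : X → 𝕜) (ENNReal.ofReal r) μ := hD.memLp_one h𝒟 (by linarith) f
  set J := ∫⁻ x, ‖(f : X → 𝕜) x‖ₑ ^ r ∂μ with hJ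
  have hfJ : eLpNorm (f : X → 𝕜) (ENNReal.ofReal r) μ = J ^ (1 / r) := eLpNorm_ofReal_eq hr0 _ μ
  have hJt : J ≠ ∞ := by
    intro h
    have := hfr.2.ne
    rw [hfJ, h, ENNReal.top_rpow_of_pos (by positivity)] at this
    exact this rfl
  have key : ∫⁻ x, ‖T f x‖ₑ ^ r ∂μ ≤ (2 * K) ^ r * J := by
    -- The error of the majorant is sent to zero, which also covers the case J = 0.
    refine le_mul_of_forall_le_mul_add (by finiteness) fun δ hδ => ?_
    set u : X → ℝ≥0∞ := fun x => ‖(f : X → 𝕜) x‖ₑ ^ p₀ with hu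
    have hut : ∫⁻ x, u x ^ t ∂μ = J := by
      refine lintegral_congr fun x => ?_
      rw [hu, ← ENNReal.rpow_mul, ht, mul_div_cancel₀ _ hp₀0.ne']
    have hq1 : 1 < p / p₀ := by rw [one_lt_div hp₀0]; exact hr.trans hrp
    obtain ⟨W, hW, huW, hWt, hWQ⟩ := exists_weight_majorant h𝒟 (hfr.1.enorm.pow_const p₀) ht1
      (by change ∫⁻ x, u x ^ t ∂μ ≠ ∞; rwa [hut]) hδ
    change _ ≤ 2 ^ t * (∫⁻ x, u x ^ t ∂μ + δ) at hWt
    rw [hut] at hWt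
    set Y := ∫⁻ x, ENNReal.ofReal (W x) ^ t ∂μ with hY
    -- Since |f|^p₀ ≤ W and p/p₀ - τ = t, the function |f|^p w is at most W^t, which is integrable.
    set w : X → ℝ := fun x => W x ^ (-τ) with hw
    have hwW : IsWeight w := hW.rpow _
    have hQ : ∀ a, ∀ Q ∈ 𝒟 a, _ := fun a Q hQ => avg_mul_avg_le_of_neg_rpow (s := s) (q := p / p₀) hW
      hq1 hτ0
      (by rw [hτ, div_sub_one hp₀0.ne']; gcongr) (h𝒟.pos a Q hQ).ne' (h𝒟.finite a Q hQ).ne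
      (hWQ a Q hQ)
    have hop := hK w hwW hQ
    have hwA : InAInfty μ 𝒟 w := by
      have hq : 1 ≤ p / p₀ := by rw [one_le_div hp₀0]; linarith
      exact ⟨p / p₀, hq, inA_of_avg_mul_avg_le hwW hs h𝒟 (by finiteness) hQ⟩
    have hfp := hD.memLp (p := p) hwA (by linarith) f
    have hTf := eLpNorm_le_of_opNorm_le hKt hop f hfp.2.ne
    set v : X → ℝ≥0∞ := fun x => ENNReal.ofReal (W x) with hv
    have hv0 : ∀ x, v x ≠ 0 := fun x => by simpa [hv] using hW.2 x
    have hvt : ∀ x, v x ≠ ∞ := fun x => ENNReal.ofReal_ne_top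
    have hvm : Measurable v := hW.1.ennreal_ofReal
    have hwv : ∀ x, ENNReal.ofReal (w x) = v x ^ (-τ) := fun x => ofReal_rpow_eq (hW.2 x) _
    have hfY : ∫⁻ x, ENNReal.ofReal (w x) * ‖(f : X → 𝕜) x‖ₑ ^ p ∂μ ≤ Y := by
      refine lintegral_mono_ae ?_
      filter_upwards [huW] with x hx
      calc ENNReal.ofReal (w x) * ‖(f : X → 𝕜) x‖ₑ ^ p
          = v x ^ (-τ) * (‖(f : X → 𝕜) x‖ₑ ^ p₀) ^ (p / p₀) := by
            rw [hwv, ← ENNReal.rpow_mul, mul_div_cancel₀ _ hp₀0.ne']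
        _ ≤ v x ^ (-τ) * v x ^ (p / p₀) := by gcongr
        _ = v x ^ t := by
            rw [← ENNReal.rpow_add _ _ (hv0 x) (hvt x), hτ, ht]
            congr 1
            ring
    have hTfY : ∫⁻ x, ENNReal.ofReal (w x) * ‖T f x‖ₑ ^ p ∂μ ≤ K ^ p * Y := by
      rw [eLpNorm_ofReal_eq hp0, eLpNorm_ofReal_eq hp0, lintegral_wMeasure hwW.1,
        lintegral_wMeasure hwW.1] at hTf
      have h := ENNReal.rpow_le_rpow hTf hp0.le
      rw [ENNReal.mul_rpow_of_nonneg _ _ hp0.le, ← ENNReal.rpow_mul, ← ENNReal.rpow_mul,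
        one_div_mul_cancel hp0.ne', ENNReal.rpow_one, ENNReal.rpow_one] at h
      exact h.trans (by gcongr)
    have hc : (p / r).HolderConjugate (p / (p - r)) := by
      have h := Real.HolderConjugate.conjExponent (p := p / r) (by rwa [one_lt_div hr0])
      have e : (p / r).conjExponent = p / (p - r) := by
        rw [Real.conjExponent]
        field_simp
      rwa [e] at h
    -- Hölder's inequality with exponents p/r and p/(p-r): the power of W that compensates for
    -- w^(r/p) becomes W^t in the second factor.
    calc ∫⁻ x, ‖T f x‖ₑ ^ r ∂μ
        = ∫⁻ x, ((fun x => ‖T f x‖ₑ ^ r * v x ^ (-(τ * r / p))) *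
            fun x => v x ^ (τ * r / p)) x ∂μ := by
          refine lintegral_congr fun x => ?_
          rw [Pi.mul_apply, mul_assoc, ← ENNReal.rpow_add _ _ (hv0 x) (hvt x)]
          simp
      _ ≤ (∫⁻ x, (‖T f x‖ₑ ^ r * v x ^ (-(τ * r / p))) ^ (p / r) ∂μ) ^ (1 / (p / r)) *
            (∫⁻ x, (v x ^ (τ * r / p)) ^ (p / (p - r)) ∂μ) ^ (1 / (p / (p - r))) :=
          ENNReal.lintegral_mul_le_Lp_mul_Lq μ hc
            (((hTm f).enorm.pow_const r).mul (hvm.pow_const _).aemeasurable)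
            (hvm.pow_const _).aemeasurable
      _ = (∫⁻ x, ENNReal.ofReal (w x) * ‖T f x‖ₑ ^ p ∂μ) ^ (r / p) * Y ^ ((p - r) / p) := by
          rw [one_div_div, one_div_div]
          congr 2
          · refine lintegral_congr fun x => ?_
            rw [ENNReal.mul_rpow_of_nonneg _ _ (by positivity), ← ENNReal.rpow_mul,
              ← ENNReal.rpow_mul, mul_div_cancel₀ _ hr0.ne', hwv, mul_comm]
            congr 2
            field_simp
          · refine lintegral_congr fun x => ?_
            rw [← ENNReal.rpow_mul, hτ, ht]
            congr 1
            field_simp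
      _ ≤ (K ^ p * Y) ^ (r / p) * Y ^ ((p - r) / p) := by gcongr
      _ = K ^ r * Y := by
          rw [ENNReal.mul_rpow_of_nonneg _ _ (by positivity), ← ENNReal.rpow_mul,
            mul_div_cancel₀ _ hp0.ne', mul_assoc,
            ← ENNReal.rpow_add_of_nonneg _ _ (by positivity) (by positivity), ← add_div,
            add_sub_cancel, div_self hp0.ne', ENNReal.rpow_one]
      _ ≤ K ^ r * (2 ^ r * (J + δ)) := by
          gcongr
          refine hWt.trans ?_
          gcongr
          · norm_num
          · rw [ht, div_le_iff₀ hp₀0]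
            nlinarith
      _ = (2 * K) ^ r * (J + δ) := by
          rw [ENNReal.mul_rpow_of_nonneg _ _ hr0.le]
          ring
  rw [hfJ, eLpNorm_ofReal_eq hr0]
  calc (∫⁻ x, ‖T f x‖ₑ ^ r ∂μ) ^ (1 / r) ≤ ((2 * K) ^ r * J) ^ (1 / r) := by gcongr
    _ = 2 * K * J ^ (1 / r) := by
        rw [ENNReal.mul_rpow_of_nonneg _ _ (by positivity), ← ENNReal.rpow_mul,
          mul_one_div_cancel hr0.ne', ENNReal.rpow_one]

end Extrapolation

/-! ### Exponents -/

section Exponents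

/-- Written in terms of the real number `(x⁻¹).toReal`, which is 0 for x = ∞, the conjugate exponent
needs no separate case at infinity. All exponents below are expressed in this way through 1/q₀. -/
lemma conjExponent_eq {x : ℝ≥0∞} (hx : 1 < x) :
    ENNReal.conjExponent x = ENNReal.ofReal (1 / (1 - (x⁻¹).toReal)) := by
  rcases eq_or_ne x ∞ with rfl | hxt
  · simp [ENNReal.conjExponent]
  lift x to ℝ≥0 using hxt
  have h1 : (1 : ℝ) < x := by exact_mod_cast hx
  have h2 : (x : ℝ) - 1 ≠ 0 := by linarith
  have e : (x : ℝ≥0∞) = ENNReal.ofReal x := by simp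
  rw [ENNReal.conjExponent, e, ← ENNReal.ofReal_one, ← ENNReal.ofReal_sub _ zero_le_one,
    ← ENNReal.ofReal_inv_of_pos (by linarith), ← ENNReal.ofReal_inv_of_pos (by linarith),
    ENNReal.toReal_ofReal (by positivity), ← ENNReal.ofReal_add zero_le_one
      (inv_nonneg.2 (by linarith))]
  congr 1
  have h3 : (x : ℝ) ≠ 0 := by linarith
  field_simp
  ring

variable {p : ℝ} {q₀ : ℝ≥0∞}

lemma mul_inv_toReal_lt_one (hp : 0 < p) (hq₀ : ENNReal.ofReal p < q₀) :
    p * (q₀⁻¹).toReal < 1 := by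
  have h : q₀⁻¹ < (ENNReal.ofReal p)⁻¹ := ENNReal.inv_lt_inv.2 hq₀
  rw [← ENNReal.ofReal_inv_of_pos hp] at h
  have := ENNReal.toReal_lt_of_lt_ofReal h
  calc p * (q₀⁻¹).toReal < p * p⁻¹ := by gcongr
    _ = 1 := mul_inv_cancel₀ hp.ne'

lemma dualRatio_eq (hp : 0 < p) (hq₀ : ENNReal.ofReal p < q₀) :
    dualRatio q₀ p = 1 / (1 - p * (q₀⁻¹).toReal) := by
  have h := mul_inv_toReal_lt_one hp hq₀
  have h1 : 1 < q₀ / ENNReal.ofReal p := by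
    rw [ENNReal.lt_div_iff_mul_lt (Or.inl (by simpa using hp)) (Or.inl ENNReal.ofReal_ne_top),
      one_mul]
    exact hq₀
  have h2 : ((q₀ / ENNReal.ofReal p)⁻¹).toReal = p * (q₀⁻¹).toReal := by
    rw [ENNReal.inv_div (Or.inl ENNReal.ofReal_ne_top) (Or.inl (by simpa using hp)),
      ENNReal.div_eq_inv_mul, mul_comm, ENNReal.toReal_mul, ENNReal.toReal_ofReal hp.le]
  rw [dualRatio, conjExponent_eq h1, h2, ENNReal.toReal_ofReal]
  have : 0 < 1 - p * (q₀⁻¹).toReal := by linarith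
  positivity

lemma one_le_dualRatio (hp : 0 < p) (hq₀ : ENNReal.ofReal p < q₀) : 1 ≤ dualRatio q₀ p := by
  have h := mul_inv_toReal_lt_one hp hq₀
  have h0 : 0 ≤ p * (q₀⁻¹).toReal := by positivity
  rw [dualRatio_eq hp hq₀, one_le_div (by linarith)]
  linarith

lemma upperExp_eq (hp : 0 < p) (hq₀ : ENNReal.ofReal p < q₀) :
    upperExp q₀ p = (1 - (q₀⁻¹).toReal) / (1 - p * (q₀⁻¹).toReal) := by
  rw [upperExp]
  split_ifs with h
  · simp [h]
  · have h1 : p < q₀.toReal := (ENNReal.ofReal_lt_iff_lt_toReal hp.le h).1 hq₀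
    have h2 : q₀.toReal ≠ 0 := by linarith
    have h3 : q₀.toReal - p ≠ 0 := by linarith
    rw [ENNReal.toReal_inv]
    field_simp

lemma inv_toReal_lt_one (hq₀ : 1 < q₀) : (q₀⁻¹).toReal < 1 := by
  have := mul_inv_toReal_lt_one one_pos (q₀ := q₀) (by simpa using hq₀)
  linarith

lemma invConj_eq (hq₀ : 1 < q₀) : invConj q₀ = 1 - (q₀⁻¹).toReal := by
  have := inv_toReal_lt_one hq₀
  rw [invConj, conjExponent_eq hq₀, ENNReal.toReal_ofReal, one_div_one_div]
  have : 0 < 1 - (q₀⁻¹).toReal := by linarith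
  positivity

/-- With κ = 1/q₀ the relation for b = q₀' reads 1 - κ = (1 - 1/p) + (1 - pκ)/p. -/
lemma isExponents {p₀ : ℝ} (hp₀ : 1 ≤ p₀) (hp : p₀ < p) (hq₀ : ENNReal.ofReal p < q₀) :
    IsExponents p₀ (1 / (1 - (q₀⁻¹).toReal)) (dualRatio q₀ p) p (p / (p - 1)) := by
  have hp1 : 1 < p := by linarith
  have hp0 : 0 < p := by linarith
  have h := mul_inv_toReal_lt_one hp0 hq₀
  have h0 : 0 ≤ (q₀⁻¹).toReal := ENNReal.toReal_nonneg
  have h1 : (q₀⁻¹).toReal < 1 := by nlinarith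
  refine ⟨hp₀, hp, ?_, one_le_dualRatio hp0 hq₀, Real.HolderConjugate.conjExponent hp1, ?_⟩
  · rw [one_le_div (by linarith)]
    linarith
  · have h2 : 1 - p * (q₀⁻¹).toReal ≠ 0 := by linarith
    have h3 : 1 - (q₀⁻¹).toReal ≠ 0 := by linarith
    have h4 : p - 1 ≠ 0 := by linarith
    rw [dualRatio_eq hp0 hq₀]
    field_simp
    ring

/-- On the left is the power of the weight constant lost by the sparse form, on the right the one in
the theorem. The two entries of the maxima agree separately. -/
lemma exponent_identity {p₀ : ℝ} (hp₀ : 1 ≤ p₀) (hp : p₀ < p) (hq₀ : ENNReal.ofReal p < q₀) :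
    1 / (dualRatio q₀ p * p) +
      max (1 / (p * (dualRatio q₀ p * (p / p₀ - 1)))) (1 / (p / (p - 1))) =
    max (1 / (p - p₀)) (upperExp q₀ p) / dualRatio q₀ p := by
  have hp1 : p - 1 ≠ 0 := by linarith
  have hp0 : 0 < p := by linarith
  have hp₀0 : 0 < p₀ := by linarith
  have hpp : p - p₀ ≠ 0 := by linarith
  have h := mul_inv_toReal_lt_one hp0 hq₀
  have hs := one_le_dualRatio hp0 hq₀
  have hs0 : 0 < dualRatio q₀ p := by linarith
  have h2 : 1 - p * (q₀⁻¹).toReal ≠ 0 := by linarith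
  rw [← max_div_div_right hs0.le, ← max_add_add_left]
  congr 1
  · field_simp
    ring
  · rw [upperExp_eq hp0 hq₀, dualRatio_eq hp0 hq₀]
    field_simp
    ring

end Exponents

/-! ### The critical exponents -/

section Critical

variable {X : Type*} [MeasurableSpace X] {μ : Measure X}
  {𝕜 : Type*} [RCLike 𝕜] {D : Submodule 𝕜 (X → 𝕜)} {T : D → X → 𝕜} {p : ℝ} {q₀ : ℝ≥0∞}

/-- If all norms on L^t with p < t < q₀ were infinite, every γ ≥ 0 would qualify in the supremum
that defines γ_T(q₀). -/
lemma exists_opNorm_ne_top (hp : 0 < p) (hq₀ : ENNReal.ofReal p < q₀)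
    (hγ : gammaExp μ T q₀ ≠ ∞) : ∃ t, p < t ∧ ENNReal.ofReal t < q₀ ∧ opNorm μ T t ≠ ∞ := by
  by_contra! h
  refine hγ (ENNReal.eq_top_of_forall_nnreal_le fun γ => le_sSup ⟨γ, γ.2, by simp, fun ε _ => ?_⟩)
  split_ifs with hq
  · have : (fun t : ℝ => opNorm μ T t / ENNReal.ofReal (t ^ (γ - ε))) =ᶠ[atTop] fun _ => ∞ := by
      filter_upwards [eventually_gt_atTop p] with t ht
      rw [h t ht (by simp [hq]), ENNReal.top_div_of_ne_top ENNReal.ofReal_ne_top]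
    rw [limsup_congr this, limsup_const]
  · have hpq : p < q₀.toReal := (ENNReal.ofReal_lt_iff_lt_toReal hp.le hq).1 hq₀
    have : (fun t : ℝ => ENNReal.ofReal ((q₀.toReal - t) ^ (γ - ε)) * opNorm μ T t)
        =ᶠ[𝓝[<] q₀.toReal] fun _ => ∞ := by
      filter_upwards [Ioo_mem_nhdsLT hpq] with t ht
      rw [h t ht.1 ((ENNReal.ofReal_lt_iff_lt_toReal (hp.trans ht.1).le hq).2 ht.2),
        ENNReal.mul_top]
      have := Real.rpow_pos_of_pos (sub_pos.2 ht.2) (γ - ε)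
      simpa using this
    rw [limsup_congr this, limsup_const]

lemma ofReal_rpow_mul_le {x a e : ℝ} (hx : 0 < x) (hx1 : x ≤ 1) (hea : e ≤ a) (C : ℝ≥0∞) :
    ENNReal.ofReal (x ^ a) * (C * ENNReal.ofReal x ^ (-e)) ≤ C := by
  rw [ofReal_rpow_eq hx, mul_left_comm,
    ← ENNReal.rpow_add _ _ (by simpa using hx) ENNReal.ofReal_ne_top]
  refine mul_le_of_le_one_right' (ENNReal.rpow_le_one ?_ (by linarith))
  simpa using hx1

/-- For α > e + ε the factor (r-p₀)^(α-ε) absorbs the blow-up once r - p₀ ≤ 1, so the upper limit is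
finite. -/
lemma alphaExp_le {p₀ e : ℝ} {C : ℝ≥0∞} (hC : C ≠ ∞) (hp : p₀ < p)
    (h : ∀ r, p₀ < r → r < p → opNorm μ T r ≤ C * ENNReal.ofReal (r - p₀) ^ (-e)) :
    alphaExp μ T p₀ ≤ ENNReal.ofReal e := by
  refine sSup_le ?_
  rintro _ ⟨α, -, rfl, hα⟩
  refine ENNReal.ofReal_le_ofReal (le_of_forall_pos_le_add fun ε hε => ?_)
  by_contra! hlt
  have hle : limsup (fun r : ℝ => ENNReal.ofReal ((r - p₀) ^ (α - ε)) * opNorm μ T r) (𝓝[>] p₀)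
      ≤ C := by
    refine limsup_le_of_le (by isBoundedDefault) ?_
    filter_upwards [Ioo_mem_nhdsGT hp, Ioo_mem_nhdsGT (show p₀ < p₀ + 1 by linarith)] with r hr hr1
    calc _ ≤ ENNReal.ofReal ((r - p₀) ^ (α - ε)) * (C * ENNReal.ofReal (r - p₀) ^ (-e)) := by
          gcongr
          exact h r hr.1 hr.2
      _ ≤ C := ofReal_rpow_mul_le (sub_pos.2 hr.1) (by linarith [hr1.2]) (by linarith) C
  rw [hα ε hε] at hle
  exact hC (top_le_iff.1 hle)

/-- The quantity 1/r - 1/q₀ measures the distance to the endpoint in both cases: it is 1/r for q₀ =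
∞ and (q₀-r)/(r q₀) otherwise, where r q₀ stays bounded. -/
lemma gammaExp_le {e : ℝ} (he : 0 ≤ e) {C : ℝ≥0∞} (hC : C ≠ ∞) (hp : 0 < p)
    (hq₀ : ENNReal.ofReal p < q₀)
    (h : ∀ r, p < r → ENNReal.ofReal r < q₀ →
      opNorm μ T r ≤ C * ENNReal.ofReal (1 / r - (q₀⁻¹).toReal) ^ (-e)) :
    gammaExp μ T q₀ ≤ ENNReal.ofReal e := by
  refine sSup_le ?_
  rintro _ ⟨γ, -, rfl, hγ⟩
  refine ENNReal.ofReal_le_ofReal (le_of_forall_pos_le_add fun ε hε => ?_)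
  by_contra! hlt
  have hγ := hγ ε hε
  split_ifs at hγ with hq
  · have hle : limsup (fun r : ℝ => opNorm μ T r / ENNReal.ofReal (r ^ (γ - ε))) atTop ≤ C := by
      refine limsup_le_of_le (by isBoundedDefault) ?_
      filter_upwards [eventually_gt_atTop p, eventually_ge_atTop 1] with r hr hr1
      have hr0 : 0 < r := by linarith
      have h1 := h r hr (by simp [hq])
      simp only [hq, ENNReal.inv_top, ENNReal.toReal_zero, sub_zero] at h1
      have h2 := ofReal_rpow_mul_le (x := 1 / r) (a := γ - ε) (e := e) (by positivity)
        (by rwa [div_le_one hr0]) (by linarith) C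
      calc _ = ENNReal.ofReal ((1 / r) ^ (γ - ε)) * opNorm μ T r := by
            rw [one_div, Real.inv_rpow hr0.le, ENNReal.ofReal_inv_of_pos (by positivity),
              mul_comm, div_eq_mul_inv]
        _ ≤ _ := by gcongr
        _ ≤ C := h2
    rw [hγ] at hle
    exact hC (top_le_iff.1 hle)
  · set q := q₀.toReal with hqq
    have hpq : p < q := (ENNReal.ofReal_lt_iff_lt_toReal hp.le hq).1 hq₀
    have hq0 : 0 < q := by linarith
    have hle : limsup (fun r : ℝ => ENNReal.ofReal ((q - r) ^ (γ - ε)) * opNorm μ T r) (𝓝[<] q)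
        ≤ C * ENNReal.ofReal (q * q) ^ e := by
      refine limsup_le_of_le (by isBoundedDefault) ?_
      filter_upwards [Ioo_mem_nhdsLT hpq, Ioo_mem_nhdsLT (show q - 1 < q by linarith)] with r hr hr1
      have hr0 : 0 < r := hp.trans hr.1
      have hqr : 0 < q - r := sub_pos.2 hr.2
      have h1 := h r hr.1 ((ENNReal.ofReal_lt_iff_lt_toReal hr0.le hq).2 hr.2)
      have e1 : 1 / r - (q₀⁻¹).toReal = (q - r) * (r * q)⁻¹ := by
        rw [ENNReal.toReal_inv, ← hqq]
        field_simp
      rw [e1, ENNReal.ofReal_mul hqr.le, ENNReal.ofReal_inv_of_pos (by positivity),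
        ENNReal.mul_rpow_of_ne_top ENNReal.ofReal_ne_top (by simpa using by positivity),
        ENNReal.inv_rpow, ENNReal.rpow_neg _ e, ENNReal.rpow_neg _ e, inv_inv,
        ← ENNReal.rpow_neg] at h1
      calc _ ≤ ENNReal.ofReal ((q - r) ^ (γ - ε)) *
            (C * (ENNReal.ofReal (q - r) ^ (-e) * ENNReal.ofReal (r * q) ^ e)) := by gcongr
        _ = ENNReal.ofReal ((q - r) ^ (γ - ε)) * (C * ENNReal.ofReal (q - r) ^ (-e)) *
            ENNReal.ofReal (r * q) ^ e := by ring
        _ ≤ C * ENNReal.ofReal (q * q) ^ e := by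
            gcongr
            · exact ofReal_rpow_mul_le hqr (by linarith [hr1.1]) (by linarith) C
            · exact hr.2.le
    rw [hγ] at hle
    exact absurd (top_le_iff.1 hle) (by finiteness)

end Critical

/-! ### The least exponents -/

section Least

variable {X : Type*} [MeasurableSpace X] {ι : Type*} {μ : Measure X} {𝒟 : ι → Set (Set X)}
  {𝕜 : Type*} [RCLike 𝕜] {D : Submodule 𝕜 (X → 𝕜)} {T : D → X → 𝕜} {p₀ p : ℝ} {q₀ : ℝ≥0∞}

/-- Upward extrapolation uses weights w with [w^s]_{A_1} of order 1/(1/r - 1/q₀). A bound by the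
e-th power of that constant thus becomes a bound for the norm on L^r. -/
lemma gammaExp_le_of_forall_opNorm_le [Finite ι] [SigmaFinite μ] (hD : IsTestSpace μ 𝒟 D)
    (h𝒟 : IsGridSystem μ 𝒟) (hTm : ∀ f, AEStronglyMeasurable (T f) μ) (hp : 1 < p)
    (hq₀ : ENNReal.ofReal p < q₀) {e : ℝ} (he : 0 ≤ e) {c : ℝ≥0}
    (h : ∀ w : X → ℝ, InA μ 𝒟 1 w → InRH μ 𝒟 (dualRatio q₀ p) w →
      opNorm (wMeasure μ w) T p ≤ c * apConst μ 𝒟 1 (fun x => w x ^ dualRatio q₀ p) ^ e) :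
    gammaExp μ T q₀ ≤ ENNReal.ofReal e := by
  have hp0 : 0 < p := by linarith
  have hs := one_le_dualRatio hp0 hq₀
  have hseq := dualRatio_eq hp0 hq₀
  have hpκ := mul_inv_toReal_lt_one hp0 hq₀
  set s := dualRatio q₀ p with hs_def
  set κ := (q₀⁻¹).toReal with hκ
  set M : ℝ := 4 * (Nat.card ι + 1) * ((1 - p * κ) / p) with hM
  have hκ0 : 0 ≤ κ := ENNReal.toReal_nonneg
  have h1 : 0 < 1 - p * κ := by linarith
  have hM0 : 0 < M := by positivity
  refine gammaExp_le he (C := 4 * (c * ENNReal.ofReal M ^ e)) (by finiteness) hp0 hq₀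
    fun r hpr hrq => ?_
  have hr0 : 0 < r := by linarith
  have hrp : 0 < r - p := by linarith
  have hrκ := mul_inv_toReal_lt_one hr0 hrq
  rw [← hκ] at hrκ
  have h2 : 0 < 1 - r * κ := by linarith
  have h3 : 0 < 1 / r - κ := by
    have : 1 / r - κ = (1 - r * κ) / r := by field_simp
    rw [this]
    positivity
  have ht : r / (r - p) / s = r * (1 - p * κ) / (r - p) := by
    rw [hseq]
    field_simp
  have ht1 : 1 < r / (r - p) / s := by
    rw [ht, one_lt_div hrp]
    nlinarith
  set B : ℝ := 4 * (Nat.card ι + 1) * ((r / (r - p) / s) / (r / (r - p) / s - 1)) with hB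
  have hBM : B = M * (1 / r - κ)⁻¹ := by
    have h4 : r * (1 - p * κ) / (r - p) - 1 = p * (1 - r * κ) / (r - p) := by
      field_simp
      ring
    rw [hB, hM, ht, h4]
    field_simp
  have key := opNorm_le_of_lt hD h𝒟 hTm hp hpr hs ht1 (K := c * ENNReal.ofReal B ^ e)
    (by finiteness) fun w hw hL => by
      have hle := apConst_rpow_le hw hs hL
      rw [sub_self, mul_zero, zero_add, ← hB, ← ENNReal.rpow_mul,
        one_div_mul_cancel (by linarith), ENNReal.rpow_one] at hle
      refine (h w (inA_of_avg_mul_avg_le hw hs h𝒟 (by finiteness) hL)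
        (inRH_of_avg_mul_avg_le hw hs le_rfl h𝒟 (by finiteness) hL)).trans ?_
      gcongr
  refine key.trans (le_of_eq ?_)
  rw [hBM, ENNReal.ofReal_mul hM0.le, ENNReal.ofReal_inv_of_pos h3,
    ENNReal.mul_rpow_of_nonneg _ _ he, ENNReal.inv_rpow, ← ENNReal.rpow_neg]
  ring

/-- Downward extrapolation uses w = W^(-(p-r)/p₀) with an A_1 weight W of constant B = O(1/(r-p₀));
the constant of w^s is then at most B to the power s(p-r)/p₀. -/
lemma alphaExp_le_of_forall_opNorm_le [Finite ι] [SigmaFinite μ] (hD : IsTestSpace μ 𝒟 D)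
    (h𝒟 : IsGridSystem μ 𝒟) (hTm : ∀ f, AEStronglyMeasurable (T f) μ) (hp₀ : 1 ≤ p₀) (hp : p₀ < p)
    {s : ℝ} (hs : 1 ≤ s) {e : ℝ} (he : 0 ≤ e) {c : ℝ≥0}
    (h : ∀ w : X → ℝ, InA μ 𝒟 (p / p₀) w → InRH μ 𝒟 s w →
      opNorm (wMeasure μ w) T p ≤
        c * apConst μ 𝒟 (s * (p / p₀ - 1) + 1) (fun x => w x ^ s) ^ e) :
    alphaExp μ T p₀ ≤ ENNReal.ofReal ((p - p₀) / p₀ * s * e) := by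
  have hp₀0 : 0 < p₀ := by linarith
  have hp0 : 0 < p := by linarith
  have hpp : 0 < p - p₀ := by linarith
  have hs0 : 0 < s := by linarith
  -- The value at r = p₀ of the exponent (p-r)se/p₀; it dominates for all r > p₀ because B ≥ 1.
  set E := (p - p₀) / p₀ * s * e with hE
  have hE0 : 0 ≤ E := by positivity
  set M : ℝ := 4 * (Nat.card ι + 1) * p with hM
  have hM0 : 0 < M := by positivity
  refine alphaExp_le (C := 2 * (c * ENNReal.ofReal M ^ E)) (by finiteness) hp fun r hr hrp => ?_
  have hr0 : 0 < r - p₀ := by linarith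
  have hpr : 0 < p - r := by linarith
  set B : ℝ := 4 * (Nat.card ι + 1) * ((r / p₀) / (r / p₀ - 1)) with hB
  have hBr : B = 4 * (Nat.card ι + 1) * (r / (r - p₀)) := by
    rw [hB, div_sub_one hp₀0.ne', div_div_div_cancel_right₀ hp₀0.ne']
  have hB1 : 1 ≤ ENNReal.ofReal B := by
    rw [ENNReal.one_le_ofReal, hBr]
    have h1 : 1 ≤ r / (r - p₀) := by rw [one_le_div hr0]; linarith
    have h2 : (0 : ℝ) ≤ Nat.card ι := by positivity
    nlinarith
  have hBM : B ≤ M * (r - p₀)⁻¹ := by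
    rw [hBr, hM, div_eq_mul_inv, ← mul_assoc]
    gcongr
  have key := opNorm_le_of_gt hD h𝒟 hTm hp₀ hr hrp hs (K := c * ENNReal.ofReal B ^ E)
    (by finiteness) fun w hw hL => by
      have hq : 1 ≤ p / p₀ := by rw [one_le_div hp₀0]; linarith
      have hle := apConst_rpow_le hw hs hL
      rw [← hB, ← ENNReal.rpow_mul] at hle
      refine (h w (inA_of_avg_mul_avg_le hw hs h𝒟 (by finiteness) hL)
        (inRH_of_avg_mul_avg_le hw hs hq h𝒟 (by finiteness) hL)).trans ?_
      gcongr (c : ℝ≥0∞) * ?_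
      calc _ ≤ (ENNReal.ofReal B ^ ((p - r) / p₀ * s)) ^ e := by gcongr
        _ = ENNReal.ofReal B ^ ((p - r) / p₀ * s * e) := by rw [← ENNReal.rpow_mul]
        _ ≤ ENNReal.ofReal B ^ E := by
          refine ENNReal.rpow_le_rpow_of_exponent_le hB1 ?_
          rw [hE]
          gcongr
  refine key.trans ?_
  calc 2 * (c * ENNReal.ofReal B ^ E) ≤ 2 * (c * ENNReal.ofReal (M * (r - p₀)⁻¹) ^ E) := by gcongr
    _ = _ := by
      rw [ENNReal.ofReal_mul hM0.le, ENNReal.ofReal_inv_of_pos hr0,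
        ENNReal.mul_rpow_of_nonneg _ _ hE0, ENNReal.inv_rpow, ← ENNReal.rpow_neg]
      ring

lemma exists_isExponents (hp₀ : 1 ≤ p₀) (hp : p₀ < p) (hq₀ : ENNReal.ofReal p < q₀)
    (hγ : gammaExp μ T q₀ = ENNReal.ofReal (invConj q₀)) :
    ∃ t, IsExponents p₀ (1 / (1 - (q₀⁻¹).toReal)) (dualRatio q₀ t) t (t / (t - 1)) ∧
      opNorm μ T t ≠ ∞ := by
  obtain ⟨t, hpt, htq, ht⟩ := exists_opNorm_ne_top (by linarith) hq₀
    (hγ.trans_ne ENNReal.ofReal_ne_top)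
  exact ⟨t, isExponents hp₀ (hp.trans hpt) htq, ht⟩

lemma one_lt_of_ofReal_lt (hp : 1 ≤ p) (hq₀ : ENNReal.ofReal p < q₀) : 1 < q₀ :=
  lt_of_le_of_lt (by simpa using hp) hq₀

lemma ne_top_of_rpow_ne_top {a : ℝ≥0∞} {e : ℝ} (he : 0 < e) (h : a ^ e ≠ ∞) : a ≠ ∞ := by
  rintro rfl
  exact h (ENNReal.top_rpow_of_pos he)

lemma max_mem_apExponents [Finite ι] [SigmaFinite μ] (hD : IsTestSpace μ 𝒟 D)
    (h𝒟 : IsGridSystem μ 𝒟) (hT : IsSparselyDominated μ 𝒟 T p₀ q₀) (hp₀ : 1 ≤ p₀) (hp : p₀ < p)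
    (hq₀ : ENNReal.ofReal p < q₀) (hγ : gammaExp μ T q₀ = ENNReal.ofReal (invConj q₀)) :
    max (1 / (p - p₀)) (upperExp q₀ p) ∈ apExponents μ 𝒟 T p₀ q₀ p := by
  obtain ⟨t, ht, hTt⟩ := exists_isExponents hp₀ hp hq₀ hγ
  have hx := isExponents hp₀ hp hq₀
  have hpp : 0 < p - p₀ := by linarith
  have hs := hx.s_pos
  have he : 0 < max (1 / (p - p₀)) (upperExp q₀ p) / dualRatio q₀ p :=
    div_pos (lt_max_of_lt_left (by positivity)) hs
  obtain ⟨C, hC⟩ := exists_opNorm_le hD h𝒟 hT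
    (conjExponent_eq (one_lt_of_ofReal_lt (by linarith) hq₀)) ht hTt hx.conj
    (fun w => apConst μ 𝒟 (phi p₀ q₀ p) (fun x => w x ^ dualRatio q₀ p) ^
      (max (1 / (p - p₀)) (upperExp q₀ p) / dualRatio q₀ p)) fun η hη => by
        obtain ⟨C, hC⟩ := exists_sparseForm_le_Aq (F := 𝕜) h𝒟 hx hη
        refine ⟨C, fun w hw hΦ f g hf hg 𝒮 h𝒮 => ?_⟩
        rw [← exponent_identity hp₀ hp hq₀]
        exact hC w hw (ne_top_of_rpow_ne_top he hΦ) f g hf hg 𝒮 h𝒮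
  refine ⟨C, fun w hw _ => hC w ⟨p / p₀, ?_, hw⟩⟩
  rw [one_le_div hx.r_pos]
  exact hp.le

lemma invConj_mem_a1Exponents [Finite ι] [SigmaFinite μ] (hD : IsTestSpace μ 𝒟 D)
    (h𝒟 : IsGridSystem μ 𝒟) (hT : IsSparselyDominated μ 𝒟 T p₀ q₀) (hp₀ : 1 ≤ p₀) (hp : p₀ < p)
    (hq₀ : ENNReal.ofReal p < q₀) (hγ : gammaExp μ T q₀ = ENNReal.ofReal (invConj q₀)) :
    invConj q₀ ∈ a1Exponents μ 𝒟 T q₀ p := by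
  obtain ⟨t, ht, hTt⟩ := exists_isExponents hp₀ hp hq₀ hγ
  have hx := isExponents hp₀ hp hq₀
  have hq1 := one_lt_of_ofReal_lt (by linarith) hq₀
  have hb : 1 / (1 / (1 - (q₀⁻¹).toReal)) = invConj q₀ := by rw [one_div_one_div, invConj_eq hq1]
  have he : 0 < invConj q₀ := by
    rw [invConj_eq hq1, sub_pos]
    exact inv_toReal_lt_one hq1
  obtain ⟨C, hC⟩ := exists_opNorm_le hD h𝒟 hT (conjExponent_eq hq1) ht hTt hx.conj
    (fun w => apConst μ 𝒟 1 (fun x => w x ^ dualRatio q₀ p) ^ invConj q₀) fun η hη => by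
        obtain ⟨C, hC⟩ := exists_sparseForm_le_A1 (F := 𝕜) h𝒟 hx hη
        refine ⟨C, fun w hw hΦ f g hf hg 𝒮 h𝒮 => ?_⟩
        rw [hb] at hC
        exact hC w hw (ne_top_of_rpow_ne_top he hΦ) f g hf hg 𝒮 h𝒮
  exact ⟨C, fun w hw _ => hC w ⟨1, le_rfl, hw⟩⟩

/-- The least exponent for `A_{p/p₀} ∩ RH_{(q₀/p)'}`. -/
theorem isLeast_apExponents [Finite ι] [SigmaFinite μ] (hD : IsTestSpace μ 𝒟 D)
    (h𝒟 : IsGridSystem μ 𝒟) (hne : ∃ a, (𝒟 a).Nonempty) (hT : IsSparselyDominated μ 𝒟 T p₀ q₀)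
    (hp₀ : 1 ≤ p₀) (hp : p₀ < p) (hq₀ : ENNReal.ofReal p < q₀)
    (hα : alphaExp μ T p₀ = ENNReal.ofReal (1 / p₀))
    (hγ : gammaExp μ T q₀ = ENNReal.ofReal (invConj q₀)) :
    IsLeast (apExponents μ 𝒟 T p₀ q₀ p) (max (1 / (p - p₀)) (upperExp q₀ p)) := by
  refine ⟨max_mem_apExponents hD h𝒟 hT hp₀ hp hq₀ hγ, ?_⟩
  rintro β ⟨c, hc⟩
  have hp₀0 : 0 < p₀ := by linarith
  have hp0 : 0 < p := by linarith
  have hpp : 0 < p - p₀ := by linarith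
  have hq1 := one_lt_of_ofReal_lt (by linarith) hq₀
  have hs := one_le_dualRatio hp0 hq₀
  have hs0 : 0 < dualRatio q₀ p := by linarith
  have hpκ := mul_inv_toReal_lt_one hp0 hq₀
  have hφ : 1 ≤ phi p₀ q₀ p := by
    have : 0 ≤ p / p₀ - 1 := by rw [sub_nonneg, one_le_div hp₀0]; exact hp.le
    have := mul_nonneg hs0.le this
    rw [phi]
    linarith
  -- A negative β can be replaced by 0 since weight constants are at least 1; that β is in fact
  -- positive follows at the end from 1/(p-p₀) > 0.
  have hβ : 0 ≤ max β 0 / dualRatio q₀ p := by positivity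
  have hc' : ∀ w : X → ℝ, InA μ 𝒟 (p / p₀) w → InRH μ 𝒟 (dualRatio q₀ p) w →
      opNorm (wMeasure μ w) T p ≤ c * apConst μ 𝒟 (phi p₀ q₀ p)
        (fun x => w x ^ dualRatio q₀ p) ^ (max β 0 / dualRatio q₀ p) := by
    intro w h1 h2
    refine (hc w h1 h2).trans ?_
    gcongr (c : ℝ≥0∞) * ?_
    refine ENNReal.rpow_le_rpow_of_exponent_le
      (one_le_apConst (h1.1.rpow _) hφ h𝒟 hne) ?_
    gcongr
    exact le_max_left _ _
  have h1 := alphaExp_le_of_forall_opNorm_le hD h𝒟 hT.measurable hp₀ hp hs hβ hc'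
  -- For the endpoint q₀ the assumed bound is only needed for A_1 weights, for which the A_1
  -- constant dominates the A_φ constant.
  have h2 := gammaExp_le_of_forall_opNorm_le hD h𝒟 hT.measurable (by linarith) hq₀ hβ
    fun w h1 h2 => by
      refine (hc' w ⟨h1.1, (apConst_anti h1.1 ?_ h𝒟).trans_lt h1.2⟩ h2).trans ?_
      · rw [one_le_div hp₀0]
        exact hp.le
      · gcongr
        exact apConst_anti (h1.1.rpow _) hφ h𝒟
  rw [hα, ENNReal.ofReal_le_ofReal_iff (by positivity)] at h1
  rw [hγ, ENNReal.ofReal_le_ofReal_iff hβ, invConj_eq hq1, le_div_iff₀ hs0,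
    dualRatio_eq hp0 hq₀, mul_one_div, ← upperExp_eq hp0 hq₀] at h2
  have h3 : 1 / (p - p₀) ≤ max β 0 := by
    have e : (p - p₀) / p₀ * dualRatio q₀ p * (max β 0 / dualRatio q₀ p) =
      (p - p₀) * max β 0 / p₀ := by field_simp
    rw [e] at h1
    rw [div_le_iff₀' hpp]
    exact (div_le_div_iff_of_pos_right hp₀0).1 h1
  have h4 : 0 < 1 / (p - p₀) := by positivity
  have h5 : max β 0 = β := max_eq_left (by
    by_contra! hlt
    rw [max_eq_right hlt.le] at h3
    linarith)
  rw [h5] at h2 h3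
  exact max_le h3 h2

/-- The least exponent for `A_1 ∩ RH_{(q₀/p)'}`. -/
theorem isLeast_a1Exponents [Finite ι] [SigmaFinite μ] (hD : IsTestSpace μ 𝒟 D)
    (h𝒟 : IsGridSystem μ 𝒟) (hne : ∃ a, (𝒟 a).Nonempty) (hT : IsSparselyDominated μ 𝒟 T p₀ q₀)
    (hp₀ : 1 ≤ p₀) (hp : p₀ < p) (hq₀ : ENNReal.ofReal p < q₀)
    (hγ : gammaExp μ T q₀ = ENNReal.ofReal (invConj q₀)) :
    IsLeast (a1Exponents μ 𝒟 T q₀ p) (invConj q₀) := by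
  refine ⟨invConj_mem_a1Exponents hD h𝒟 hT hp₀ hp hq₀ hγ, ?_⟩
  rintro β ⟨c, hc⟩
  have hq1 := one_lt_of_ofReal_lt (by linarith) hq₀
  have hβ : 0 ≤ max β 0 := le_max_right _ _
  have h := gammaExp_le_of_forall_opNorm_le hD h𝒟 hT.measurable (by linarith) hq₀ hβ (c := c)
    fun w h1 h2 => by
      refine (hc w h1 h2).trans ?_
      gcongr (c : ℝ≥0∞) * ?_
      exact ENNReal.rpow_le_rpow_of_exponent_le
        (one_le_apConst (h1.1.rpow _) le_rfl h𝒟 hne) (le_max_left _ _)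
  have h0 : 0 < invConj q₀ := by
    rw [invConj_eq hq1, sub_pos]
    exact inv_toReal_lt_one hq1
  rw [hγ, ENNReal.ofReal_le_ofReal_iff hβ] at h
  by_contra! hlt
  rcases le_total β 0 with h1 | h1
  · rw [max_eq_right h1] at h
    linarith
  · rw [max_eq_left h1] at h
    linarith

end Least

/-! ### Grids -/

section Grids

lemma IsDoubling.sigmaFinite {X : Type*} [MeasurableSpace X] {d : X → X → ℝ} {μ : Measure X}
    (hμ : IsDoubling d μ) : SigmaFinite μ := by
  rcases isEmpty_or_nonempty X with hX | ⟨⟨x₀⟩⟩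
  · rw [Measure.eq_zero_of_isEmpty μ]
    infer_instance
  refine ⟨⟨⟨fun n : ℕ => qball d x₀ n, fun _ => trivial, fun n => hμ.finite x₀ n, ?_⟩⟩⟩
  refine Set.eq_univ_of_forall fun x => Set.mem_iUnion.2 ?_
  exact exists_nat_gt (d x₀ x)

variable {X : Type*} [MeasurableSpace X] {d : X → X → ℝ} {μ : Measure X}

/-- Each generation consists of disjoint sets of positive measure in a σ-finite space, hence is
countable. The balls inside and around the cubes give the bounds on their measures. -/
lemma IsDyadicFamily.isGridSystem (hμ : IsDoubling d μ) {K : ℕ} {𝒬 : Fin K → ℤ → Set (Set X)}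
    (h𝒬 : IsDyadicFamily d 𝒬) : IsGridSystem μ (gridOf 𝒬) := by
  have := hμ.sigmaFinite
  obtain ⟨c₀, C₀, δ, hc₀, -, hδ, -, hsys⟩ := h𝒬.systems
  have hpos : ∀ a k, ∀ Q ∈ 𝒬 a k, 0 < μ Q := fun a k Q hQ => by
    obtain ⟨z, hz, -⟩ := (hsys a).centres
    exact (hμ.pos _ _ (by positivity)).trans_le (measure_mono (hz k Q hQ).1)
  refine ⟨fun a => ⟨?_, ?_, ?_⟩, ?_, ?_⟩
  · refine Set.countable_iUnion fun k => ?_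
    have h := Measure.countable_meas_pos_of_disjoint_iUnion (μ := μ)
      (As := fun Q : 𝒬 a k => (Q : Set X)) (fun Q => (hsys a).measurable k Q Q.2)
      fun Q R hQR => (hsys a).disjoint k Q.2 R.2 (Subtype.coe_injective.ne hQR)
    have hu : {Q : 𝒬 a k | 0 < μ (Q : Set X)} = Set.univ :=
      Set.eq_univ_of_forall fun Q => hpos a k Q Q.2
    rw [hu, Set.countable_univ_iff] at h
    exact Set.countable_coe_iff.1 h
  · intro Q hQ
    obtain ⟨k, hk⟩ := Set.mem_iUnion.1 hQ
    exact (hsys a).measurable k Q hk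
  · intro Q hQ R hR
    obtain ⟨k, hk⟩ := Set.mem_iUnion.1 hQ
    obtain ⟨l, hl⟩ := Set.mem_iUnion.1 hR
    rcases le_total k l with h | h
    · rcases (hsys a).nested k l h R hl Q hk with h | h
      · exact Or.inl h.symm
      · exact Or.inr (Or.inr h)
    · rcases (hsys a).nested l k h Q hk R hl with h | h
      · exact Or.inl h
      · exact Or.inr (Or.inl h)
  · intro a Q hQ
    obtain ⟨k, hk⟩ := Set.mem_iUnion.1 hQ
    exact hpos a k Q hk
  · intro a Q hQ
    obtain ⟨k, hk⟩ := Set.mem_iUnion.1 hQ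
    obtain ⟨z, hz, -⟩ := (hsys a).centres
    exact (measure_mono (hz k Q hk).2).trans_lt (hμ.finite _ _)

lemma IsDyadicFamily.exists_nonempty [Nonempty X] {K : ℕ} {𝒬 : Fin K → ℤ → Set (Set X)}
    (h𝒬 : IsDyadicFamily d 𝒬) : ∃ a, (gridOf 𝒬 a).Nonempty := by
  obtain ⟨ρ, -, h⟩ := h𝒬.covering
  obtain ⟨a, k, Q, hQ, -⟩ := h (Classical.arbitrary X) 1 one_pos
  exact ⟨a, Q, Set.mem_iUnion.2 ⟨k, hQ⟩⟩

/-- Over the empty space all operator norms vanish, so the hypothesis that γ_T(q₀) is the positive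
number 1/q₀' fails. -/
lemma gammaExp_of_isEmpty [IsEmpty X] {𝕜 : Type*} [RCLike 𝕜] {D : Submodule 𝕜 (X → 𝕜)}
    (T : D → X → 𝕜) {p : ℝ} {q₀ : ℝ≥0∞} (hp : 0 < p) (hq₀ : ENNReal.ofReal p < q₀) :
    gammaExp μ T q₀ = 0 := by
  have h := gammaExp_le (μ := μ) (T := T) le_rfl ENNReal.zero_ne_top hp hq₀ fun r _ _ =>
    sInf_le fun f => by simp [Measure.eq_zero_of_isEmpty μ]
  simpa using h

lemma three_dvd_two_pow_sub (j : ℕ) : (3 : ℤ) ∣ 2 ^ j - (-1) ^ j := by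
  have h : (2 : ℤ) ≡ -1 [ZMOD 3] := by decide
  exact (h.pow j).symm.dvd

/-- As 2 ≡ -1 mod 3, the shifts by thirds of two generations differ by an integer after rescaling.
The alternating sign in the definition of the cubes serves exactly this purpose. -/
lemma exists_int_eq_two_pow_mul_add (k : ℤ) (j : ℕ) (a : ℕ) (m m' : ℤ) :
    ∃ z : ℤ, (m' + (-1) ^ (k + j) * (a / 3) : ℝ) = 2 ^ j * (m + (-1) ^ k * (a / 3)) + z := by
  obtain ⟨u, hu⟩ := three_dvd_two_pow_sub j
  have hu' : (2 : ℝ) ^ j - (-1) ^ j = 3 * u := by exact_mod_cast hu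
  have hk : ((-1 : ℝ)) ^ k = 1 ∨ ((-1 : ℝ)) ^ k = -1 := by
    rcases Int.even_or_odd k with h | h
    · exact Or.inl h.neg_one_zpow
    · exact Or.inr h.neg_one_zpow
  rw [zpow_add₀ (by norm_num), zpow_natCast]
  have hj : (-1 : ℝ) ^ j = 2 ^ j - 3 * u := by linarith
  rw [hj]
  rcases hk with h | h
  · refine ⟨m' - 2 ^ j * m - a * u, ?_⟩
    rw [h]
    push_cast
    ring
  · refine ⟨m' - 2 ^ j * m + a * u, ?_⟩
    rw [h]
    push_cast
    ring

variable {n : ℕ}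

lemma euclideanCube_nested (a : Fin n → Fin 3) (k : ℤ) (j : ℕ) (m m' : Fin n → ℤ) :
    Disjoint (euclideanCube a (k + j) m') (euclideanCube a k m) ∨
      euclideanCube a (k + j) m' ⊆ euclideanCube a k m := by
  choose z hz using fun i => exists_int_eq_two_pow_mul_add k j (a i) (m i) (m' i)
  have e : (2 : ℝ) ^ (-k) = 2 ^ (-(k + j)) * 2 ^ j := by
    rw [← zpow_natCast, ← zpow_add₀ two_ne_zero]
    congr 1
    ring
  have h0 : (0 : ℝ) < 2 ^ (-(k + j)) := by positivity
  -- In units of the side of the smaller cube, z is its integral position relative to the larger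
  -- one, whose side is 2^j. If some coordinate is out of range, the two intervals in that
  -- coordinate are disjoint.
  by_cases hin : ∀ i, 0 ≤ z i ∧ z i + 1 ≤ 2 ^ j
  · refine Or.inr fun x hx i => ?_
    obtain ⟨h1, h2⟩ := hx i
    obtain ⟨h3, h4⟩ := hin i
    have h3' : (0 : ℝ) ≤ z i := by exact_mod_cast h3
    have h4' : (z i + 1 : ℝ) ≤ 2 ^ j := by exact_mod_cast h4
    rw [add_assoc, hz i] at h2
    rw [hz i] at h1
    rw [e, mul_assoc, mul_assoc]
    refine ⟨le_trans ?_ h1, h2.trans_le ?_⟩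
    · gcongr
      linarith
    · gcongr
      linarith
  · push Not at hin
    obtain ⟨i, hi⟩ := hin
    refine Or.inl (Set.disjoint_left.2 fun x hx hx' => ?_)
    obtain ⟨h1, h2⟩ := hx i
    obtain ⟨h3, h4⟩ := hx' i
    rw [add_assoc, hz i] at h2
    rw [hz i] at h1
    rw [e, mul_assoc] at h3 h4
    have h5 := lt_of_mul_lt_mul_left (h3.trans_lt h2) h0.le
    have h6 := lt_of_mul_lt_mul_left (h1.trans_lt h4) h0.le
    have h7 : (-1 : ℝ) < z i := by linarith
    have h8 : (z i : ℝ) < 2 ^ j := by linarith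
    have h9 : -1 < z i := by exact_mod_cast h7
    have h10 : z i < 2 ^ j := by exact_mod_cast h8
    have := hi (by lia)
    lia

lemma measurableSet_euclideanCube (a : Fin n → Fin 3) (k : ℤ) (m : Fin n → ℤ) :
    MeasurableSet (euclideanCube a k m) := by
  have : euclideanCube a k m = ⋂ i, {x | (2 : ℝ) ^ (-k) * (m i + (-1) ^ k * ((a i : ℕ) / 3 : ℝ)) ≤
      x i ∧ x i < (2 : ℝ) ^ (-k) * (1 + m i + (-1) ^ k * ((a i : ℕ) / 3 : ℝ))} := by
    ext x
    simp [euclideanCube]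
  rw [this]
  refine MeasurableSet.iInter fun i => ?_
  have hx : Measurable fun x : EuclideanSpace ℝ (Fin n) => x i := by fun_prop
  exact (measurableSet_le measurable_const hx).inter (measurableSet_lt hx measurable_const)

lemma exists_qball_subset_euclideanCube (a : Fin n → Fin 3) (k : ℤ) (m : Fin n → ℤ) :
    ∃ x r, 0 < r ∧ qball dist x r ⊆ euclideanCube a k m := by
  have h0 : (0 : ℝ) < 2 ^ (-k) := by positivity
  refine ⟨WithLp.toLp 2 fun i => (2 : ℝ) ^ (-k) * (1 / 2 + m i + (-1) ^ k * ((a i : ℕ) / 3 : ℝ)),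
    2 ^ (-k) / 2, by positivity, fun y hy i => ?_⟩
  have h := (PiLp.norm_apply_le (p := 2) (_ - y) i).trans_lt ((dist_eq_norm _ y).symm.trans_lt hy)
  rw [PiLp.sub_apply, Real.norm_eq_abs, abs_lt] at h
  simp only [] at h
  constructor <;> nlinarith

lemma exists_euclideanCube_subset_qball (a : Fin n → Fin 3) (k : ℤ) (m : Fin n → ℤ) :
    ∃ x r, euclideanCube a k m ⊆ qball dist x r := by
  set x : EuclideanSpace ℝ (Fin n) := WithLp.toLp 2 fun i =>
    (2 : ℝ) ^ (-k) * (m i + (-1) ^ k * ((a i : ℕ) / 3 : ℝ)) with hx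
  -- The radius is the diameter of the cube, plus 1 to have a strict inequality even for n = 0.
  refine ⟨x, √(∑ _i : Fin n, (2 ^ (-k)) ^ 2) + 1, fun y hy => ?_⟩
  change dist x y < _
  rw [EuclideanSpace.dist_eq]
  refine lt_of_le_of_lt ?_ (lt_add_one _)
  gcongr with i
  obtain ⟨h1, h2⟩ := hy i
  rw [Real.dist_eq, abs_sub_comm, abs_of_nonneg (sub_nonneg.2 h1)]
  linarith

lemma isGridSystem_euclideanGrid {μ : Measure (EuclideanSpace ℝ (Fin n))}
    (hμ : IsDoubling dist μ) : IsGridSystem μ (euclideanGrid n) := by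
  refine ⟨fun a => ⟨?_, ?_, ?_⟩, ?_, ?_⟩
  · refine (Set.countable_range fun km : ℤ × (Fin n → ℤ) => euclideanCube a km.1 km.2).mono ?_
    rintro _ ⟨k, m, rfl⟩
    exact ⟨(k, m), rfl⟩
  · rintro _ ⟨k, m, rfl⟩
    exact measurableSet_euclideanCube a k m
  · rintro _ ⟨k, m, rfl⟩ _ ⟨l, m', rfl⟩
    rcases le_total k l with h | h
    · obtain ⟨j, rfl⟩ := Int.le.dest h
      rcases euclideanCube_nested a k j m m' with h | h
      · exact Or.inl h.symm
      · exact Or.inr (Or.inr h)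
    · obtain ⟨j, rfl⟩ := Int.le.dest h
      rcases euclideanCube_nested a l j m' m with h | h
      · exact Or.inl h
      · exact Or.inr (Or.inl h)
  · rintro a _ ⟨k, m, rfl⟩
    obtain ⟨x, r, hr, h⟩ := exists_qball_subset_euclideanCube a k m
    exact (hμ.pos x r hr).trans_le (measure_mono h)
  · rintro a _ ⟨k, m, rfl⟩
    obtain ⟨x, r, h⟩ := exists_euclideanCube_subset_qball a k m
    exact (measure_mono h).trans_lt (hμ.finite x r)

end Grids

end SparseDom

end

open SparseDom in
/-- The two exponents are the least ones, in `ℝⁿ` with a doubling measure and the translated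
dyadic grids (first part), and in a space of homogeneous type with a finite family of dyadic
systems (second part). -/
theorem theorem1p4 {𝕜 : Type*} [RCLike 𝕜] (p₀ p : ℝ) (q₀ : ℝ≥0∞)
    (hp₀ : 1 ≤ p₀) (hp : p₀ < p) (hq₀ : ENNReal.ofReal p < q₀) :
    (∀ (n : ℕ) (μ : Measure (EuclideanSpace ℝ (Fin n))),
      IsDoubling dist μ →
      ∀ D : Submodule 𝕜 (EuclideanSpace ℝ (Fin n) → 𝕜), IsTestSpace μ (euclideanGrid n) D →
      ∀ T : D → EuclideanSpace ℝ (Fin n) → 𝕜,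
        IsSparselyDominated μ (euclideanGrid n) T p₀ q₀ →
        (alphaExp μ T p₀ = ENNReal.ofReal (1 / p₀) →
          gammaExp μ T q₀ = ENNReal.ofReal (invConj q₀) →
          IsLeast (apExponents μ (euclideanGrid n) T p₀ q₀ p)
            (max (1 / (p - p₀)) (upperExp q₀ p))) ∧
        (gammaExp μ T q₀ = ENNReal.ofReal (invConj q₀) →
          IsLeast (a1Exponents μ (euclideanGrid n) T q₀ p) (invConj q₀))) ∧
    (∀ (X : Type*) [MeasurableSpace X] (d : X → X → ℝ) (μ : Measure X),
      IsQuasimetric d → IsDoubling d μ →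
      ∀ (K : ℕ) (𝒬 : Fin K → ℤ → Set (Set X)), IsDyadicFamily d 𝒬 →
      ∀ D : Submodule 𝕜 (X → 𝕜), IsTestSpace μ (gridOf 𝒬) D →
      ∀ T : D → X → 𝕜, IsSparselyDominated μ (gridOf 𝒬) T p₀ q₀ →
        (alphaExp μ T p₀ = ENNReal.ofReal (1 / p₀) →
          gammaExp μ T q₀ = ENNReal.ofReal (invConj q₀) →
          IsLeast (apExponents μ (gridOf 𝒬) T p₀ q₀ p)
            (max (1 / (p - p₀)) (upperExp q₀ p))) ∧
        (gammaExp μ T q₀ = ENNReal.ofReal (invConj q₀) →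
          IsLeast (a1Exponents μ (gridOf 𝒬) T q₀ p) (invConj q₀))) := by
  have hp0 : 0 < p := by linarith
  refine ⟨fun n μ hμ D hD T hT => ?_, fun X _ d μ _ hμ K 𝒬 h𝒬 D hD T hT => ?_⟩
  · have := hμ.sigmaFinite
    have h𝒟 := isGridSystem_euclideanGrid hμ
    have hne : ∃ a, (euclideanGrid n a).Nonempty := ⟨0, euclideanCube 0 0 0, 0, 0, rfl⟩
    exact ⟨isLeast_apExponents hD h𝒟 hne hT hp₀ hp hq₀,
      isLeast_a1Exponents hD h𝒟 hne hT hp₀ hp hq₀⟩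
  · have := hμ.sigmaFinite
    have h𝒟 := h𝒬.isGridSystem hμ
    -- In the empty space there may be no cubes, and then weight constants need not be at least 1;
    -- the claim is vacuous there.
    rcases isEmpty_or_nonempty X with hX | hX
    · have hq1 := one_lt_of_ofReal_lt (by linarith) hq₀
      have hγ : gammaExp μ T q₀ ≠ ENNReal.ofReal (invConj q₀) := by
        rw [gammaExp_of_isEmpty T hp0 hq₀, invConj_eq hq1]
        have := inv_toReal_lt_one hq1
        exact (ENNReal.ofReal_pos.2 (by linarith)).ne
      exact ⟨fun _ h => absurd h hγ, fun h => absurd h hγ⟩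
    · exact ⟨isLeast_apExponents hD h𝒟 h𝒬.exists_nonempty hT hp₀ hp hq₀,
        isLeast_a1Exponents hD h𝒟 h𝒬.exists_nonempty hT hp₀ hp hq₀⟩
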